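/- Let $m\ge 3$, $k\in\mathbb N_0$, and let $m=2n$ or $m=2n-1$. Let $e_1,\dots,e_m$ be the standard basis of $\mathbb R^m$, with Clifford multiplication $e_ie_j+e_je_i=-2\delta_{ij}$, and let $\mathbb S$ be a basic spinor representation of $Spin(m)$, that is, an irreducible complex $Spin(m)$-submodule of a finite-dimensional complex module over the Clifford algebra of $\mathbb R^m$. Let $\mathcal M_k(\mathbb R^m,\mathbb S)$ be the space of $k$-homogeneous polynomials $P:\mathbb R^m\to\mathbb S$ with $\sum_{i=1}^m e_i\partial_{x_i}P=0$; it is a $Spin(m)$-module under $[L(s)P](x)=s\,P(s^{-1}xs)$. For $2\le r\le m$, let $Spin(r)\subset Spin(m)$ be the subgroup of those $s$ whose rotation $x\mapsto sxs^{-1}$ fixes $e_{r+1},\dots,e_m$. A Gelfand–Tsetlin basis of an irreducible $Spin(r)$-module $U$ is defined recursively: for $r=2$, it is a single non-zero vector spanning the (one-dimensional) module $U$; for $r>2$, $U$ is a direct sum of irreducible, pairwise inequivalent $Spin(r-1)$-submodules, and the basis is a union of Gelfand–Tsetlin bases of these. Let $\mathcal S^m$ be the set of sequences $\nu=(\nu_1,\dots,\nu_{n-1})$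 of signs. For $\nu\in\mathcal S^m$ put $$\mathbb S^\nu=\{u\in\mathbb S:\ (-i)^{p}e_1e_2\cdots e_{2p}\,u=\nu_{n-p}\,u\ \text{ for } p=1,\dots,n-1\},$$ and let $v^\nu\in\mathbb S^\nu$ be an arbitrary non-zero vector. Let $J^m_k$ be the set of integer sequences $\mu=(k_{m-1},\dots,k_2)$ with $k=k_m\ge k_{m-1}\ge\cdots\ge k_2\ge 0$. With $(a)_l=a(a+1)\cdots(a+l-1)$, with the Gegenbauer polynomials $C^a_l(z)=\sum_{i=0}^{\lfloor l/2\rfloor}\frac{(-1)^i(a)_{l-i}}{i!\,(l-2i)!}(2z)^{l-2i}$ and with $|x|_r^2=x_1^2+\cdots+x_r^2$, put for $3\le r\le m$ and $j,l\ge 0$ $$F^{(l)}_{r,j}(x)=\frac{(j+1)_l}{(r+2j-2)_l}\,|x|_r^{\,l}\,C^{r/2+j-1}_l\!\left(\frac{x_r}{|x|_r}\right),\qquad F^{(-1)}_{r,j}=0,$$ $$X^{(l)}_{r,j}(x)=F^{(l)}_{r,j}(x)+\frac{j+1}{r+2j-1}\,F^{(l-1)}_{r,j+1}(x)\,(x_1e_1+\cdots+x_{r-1}e_{r-1})\,e_r,$$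 $$f_{k,\mu}=X^{(k-k_{m-1})}_{m,k_{m-1}}X^{(k_{m-1}-k_{m-2})}_{m-1,k_{m-2}}\cdots X^{(k_3-k_2)}_{3,k_2}\,(x_1-e_1e_2x_2)^{k_2},\qquad f^\nu_{k,\mu}=f_{k,\mu}\,v^\nu .$$ (i) The polynomials $f^\nu_{k,\mu}$, $\nu\in\mathcal S^m$, $\mu\in J^m_k$, form a Gelfand–Tsetlin basis of the irreducible $Spin(m)$-module $\mathcal M_k(\mathbb R^m,\mathbb S)$. This basis is orthogonal with respect to every $Spin(m)$-invariant inner product on $\mathcal M_k(\mathbb R^m,\mathbb S)$. For every $Spin(m)$-invariant inner product $(\cdot,\cdot)$ on $\mathbb S$, such invariant inner products include the $L^2$-inner product $\int_{|x|<1}(P(x),Q(x))\,dx$ and the Fischer inner product $\sum_{|\alpha|=k}\alpha!\,(P_\alpha,Q_\alpha)$, where $P=\sum_\alpha x^\alpha P_\alpha$ and $Q=\sum_\alpha x^\alpha Q_\alpha$. (ii) For all $\nu\in\mathcal S^m$ and $\mu\in J^m_k$, $$\partial_\pm^{k_2}\,\partial_{x_3}^{k_3-k_2}\cdots\partial_{x_m}^{k-k_{m-1}}f^\nu_{k,\mu}=k!\,v^\nu,\qquad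 \partial_\pm=\tfrac12(\partial_{x_1}\pm i\,\partial_{x_2}),$$ where $\pm$ is the last sign $\nu_{n-1}$ of $\nu$. The basis is uniquely determined by this property: if a family $g^\nu_{k,\mu}$ ($\nu\in\mathcal S^m$, $\mu\in J^m_k$) is a Gelfand–Tsetlin basis of $\mathcal M_k(\mathbb R^m,\mathbb S)$ and satisfies the same equations for all $\nu$ and $\mu$, then $g^\nu_{k,\mu}=f^\nu_{k,\mu}$ for all $\nu$ and $\mu$. -/

import Mathlib

open CliffordAlgebra

noncomputable section

namespace SpinorMonogenic

/-! ### The Clifford algebra of Euclidean space -/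

/-- Euclidean space `ℝ^m`. -/
abbrev E (m : ℕ) : Type := EuclideanSpace ℝ (Fin m)

/-- The quadratic form `x ↦ -|x|²` on `ℝ^m`. -/
def negNormSq (m : ℕ) : QuadraticForm ℝ (E m) := -LinearMap.BilinMap.toQuadraticMap (innerₗ (E m))

theorem negNormSq_apply (m : ℕ) (x : E m) : negNormSq m x = -‖x‖ ^ 2 := by
  simp [negNormSq, LinearMap.BilinMap.toQuadraticMap_apply]

/-- The real Clifford algebra of `ℝ^m`, in which a vector `x` satisfies `x² = -|x|²`. -/
abbrev Cl (m : ℕ) : Type := CliffordAlgebra (negNormSq m)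

/-- The group `Spin(m)`. -/
abbrev Spin (m : ℕ) := spinGroup (negNormSq m)

/-- The `i`-th vector of the standard orthonormal basis of `ℝ^m`, for `1 ≤ i ≤ m`
(and `0` for other values of `i`). -/
def bv (m i : ℕ) : E m := WithLp.toLp 2 fun j : Fin m => if (j : ℕ) + 1 = i then 1 else 0

/-- The Clifford algebra generator `e_i`, for `1 ≤ i ≤ m`. -/
def e (m i : ℕ) : Cl m := ι (negNormSq m) (bv m i)

/-- The coordinate `x_i`, for `1 ≤ i ≤ m`. -/
def crd {m : ℕ} (i : ℕ) (x : E m) : ℝ := inner ℝ (bv m i) x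

theorem bv_succ (m : ℕ) (i : Fin m) : bv m (i + 1) = EuclideanSpace.basisFun (Fin m) ℝ i := by
  ext j
  simp [bv, Fin.ext_iff]

theorem crd_succ {m : ℕ} (i : Fin m) (x : E m) : crd ((i : ℕ) + 1) x = x i := by
  simp [crd, bv_succ, EuclideanSpace.inner_single_left]

theorem ι_injective (m : ℕ) : Function.Injective (ι (negNormSq m)) := by
  rw [← LinearMap.ker_eq_bot, LinearMap.ker_eq_bot']
  intro x hx
  have h := ι_sq_scalar (negNormSq m) x
  rw [hx, zero_mul, negNormSq_apply] at h
  have h2 : -‖x‖ ^ 2 = 0 := (algebraMap ℝ (Cl m)).injective (by rw [← h, map_zero])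
  simpa using h2

theorem spin_mul_inv {m : ℕ} (s : Spin m) : (s : Cl m) * ((s⁻¹ : Spin m) : Cl m) = 1 := by
  exact congrArg Subtype.val (mul_inv_cancel s)

theorem spin_inv_mul {m : ℕ} (s : Spin m) : ((s⁻¹ : Spin m) : Cl m) * (s : Cl m) = 1 := by
  exact congrArg Subtype.val (inv_mul_cancel s)

theorem exists_rot {m : ℕ} (s : Spin m) (x : E m) :
    ∃ y : E m, ι (negNormSq m) y = (s : Cl m) * ι (negNormSq m) x * ((s⁻¹ : Spin m) : Cl m) := by
  have : Invertible (2 : ℝ) := invertibleOfNonzero two_ne_zero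
  have h := spinGroup.conjAct_smul_ι_mem_range_ι (x := spinGroup.toUnits s)
    (by simp [s.2]) x
  rw [ConjAct.units_smul_def, ConjAct.ofConjAct_toConjAct] at h
  obtain ⟨y, hy⟩ := h
  refine ⟨y, ?_⟩
  rw [hy]
  simp [spinGroup.toUnits]

/-- The rotation `x ↦ s x s⁻¹` of `ℝ^m` given by `s ∈ Spin(m)`. -/
def rot {m : ℕ} (s : Spin m) : E m →ₗ[ℝ] E m where
  toFun x := (exists_rot s x).choose
  map_add' x y := by
    apply ι_injective
    refine (exists_rot s (x + y)).choose_spec.trans ?_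
    rw [map_add, map_add, (exists_rot s x).choose_spec, (exists_rot s y).choose_spec, mul_add,
      add_mul]
  map_smul' c x := by
    apply ι_injective
    refine (exists_rot s (c • x)).choose_spec.trans ?_
    rw [map_smul, map_smul, (exists_rot s x).choose_spec]
    simp

theorem ι_rot {m : ℕ} (s : Spin m) (x : E m) :
    ι (negNormSq m) (rot s x) = (s : Cl m) * ι (negNormSq m) x * ((s⁻¹ : Spin m) : Cl m) :=
  (exists_rot s x).choose_spec

theorem rot_one {m : ℕ} (x : E m) : rot (1 : Spin m) x = x := by
  apply ι_injective
  rw [ι_rot]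
  simp

theorem rot_mul {m : ℕ} (s t : Spin m) (x : E m) : rot (s * t) x = rot s (rot t x) := by
  apply ι_injective
  rw [ι_rot, ι_rot, ι_rot, mul_inv_rev]
  simp [mul_assoc]

theorem norm_rot {m : ℕ} (s : Spin m) (x : E m) : ‖rot s x‖ = ‖x‖ := by
  have h := ι_sq_scalar (negNormSq m) (rot s x)
  have h1 : ι (negNormSq m) (rot s x) * ι (negNormSq m) (rot s x)
      = algebraMap ℝ _ (negNormSq m x) := by
    rw [ι_rot]
    calc _ = (s : Cl m) * ι (negNormSq m) x * (((s⁻¹ : Spin m) : Cl m) * (s : Cl m))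
          * ι (negNormSq m) x * ((s⁻¹ : Spin m) : Cl m) := by simp only [mul_assoc]
      _ = (s : Cl m) * (ι (negNormSq m) x * ι (negNormSq m) x) * ((s⁻¹ : Spin m) : Cl m) := by
          rw [spin_inv_mul]; simp only [mul_assoc, mul_one]
      _ = _ := by
          rw [ι_sq_scalar, ← Algebra.commutes, mul_assoc, spin_mul_inv, mul_one]
  rw [h] at h1
  have h2 := (algebraMap ℝ (Cl m)).injective h1
  rw [negNormSq_apply, negNormSq_apply, neg_inj] at h2
  exact (sq_eq_sq₀ (norm_nonneg _) (norm_nonneg _)).1 h2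

/-- The rotation given by `s ∈ Spin(m)`, as a linear isometry. -/
def rotIso {m : ℕ} (s : Spin m) : E m ≃ₗᵢ[ℝ] E m where
  toLinearEquiv := LinearEquiv.ofLinearMap (rot s) (rot s⁻¹)
    (by ext1 x; simp [← rot_mul, rot_one]) (by ext1 x; simp [← rot_mul, rot_one])
  norm_map' x := norm_rot s x

/-- `Spin(r)` as the subgroup of `Spin(m)` of those elements whose rotation fixes the last
basis vectors `e_{r+1}, …, e_m`. -/
def subSpin (m r : ℕ) : Subgroup (Spin m) where
  carrier := {s | ∀ i, r < i → i ≤ m → rot s (bv m i) = bv m i}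
  one_mem' := fun i _ _ => rot_one _
  mul_mem' := fun {a b} ha hb i h1 h2 => by rw [rot_mul, hb i h1 h2, ha i h1 h2]
  inv_mem' := fun {a} ha i h1 h2 => by
    conv_lhs => rw [← ha i h1 h2]
    rw [← rot_mul, inv_mul_cancel, rot_one]

/-! ### Gelfand–Tsetlin bases -/

section GelfandTsetlin

variable {G V : Type*} [Group G] [AddCommGroup V] [Module ℂ V]

/-- `U` is an irreducible submodule for the subgroup `K`. -/
def IsIrreducibleOn (ρ : Representation ℂ G V) (K : Subgroup G) (U : Submodule ℂ V) : Prop :=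
  ∃ σ : Subrepresentation (ρ.comp K.subtype),
    σ.toSubmodule = U ∧ σ.toRepresentation.IsIrreducible

/-- Given subgroups `H 0, H 1, …, H d` of `G`, `IsGelfandTsetlin ρ H d U B` says that `B` is a
Gelfand–Tsetlin basis of the irreducible `H d`-module `U`: for `d = 0`, the module `U` is
irreducible and spanned by a single non-zero vector `b`, and `B = {b}`; for `d + 1`, the module `U`
is irreducible for `H (d + 1)`, it is the direct sum of irreducible, pairwise inequivalent
`H d`-submodules, and `B` is the union of Gelfand–Tsetlin bases of these. -/
def IsGelfandTsetlin (ρ : Representation ℂ G V) (H : ℕ → Subgroup G) :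
    ℕ → Submodule ℂ V → Set V → Prop
  | 0, U, B => IsIrreducibleOn ρ (H 0) U ∧ ∃ b : V, b ≠ 0 ∧ U = Submodule.span ℂ {b} ∧ B = {b}
  | d + 1, U, B => IsIrreducibleOn ρ (H (d + 1)) U ∧
      ∃ (N : ℕ) (σ : Fin N → Subrepresentation (ρ.comp (H d).subtype)) (β : Fin N → Set V),
        iSupIndep (fun i => (σ i).toSubmodule) ∧ (⨆ i, (σ i).toSubmodule) = U ∧
        (∀ i j, i ≠ j → IsEmpty ((σ i).toRepresentation.Equiv (σ j).toRepresentation)) ∧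
        (∀ i, IsGelfandTsetlin ρ H d (σ i).toSubmodule (β i)) ∧
        B = ⋃ i, β i

/-- An indexed family is a Gelfand–Tsetlin basis of the whole module `V` with respect to the chain
of subgroups `H d ⊇ … ⊇ H 0`. -/
def IsGelfandTsetlinBasis {κ : Type*} (ρ : Representation ℂ G V) (H : ℕ → Subgroup G) (d : ℕ)
    (f : κ → V) : Prop :=
  LinearIndependent ℂ f ∧ Submodule.span ℂ (Set.range f) = ⊤ ∧
    IsGelfandTsetlin ρ H d ⊤ (Set.range f)

/-- `B` is an inner product on the complex vector space `V` (conjugate-linear in the first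
argument, as in Mathlib) that is invariant under the representation `ρ`. -/
def IsInvariantInner (ρ : Representation ℂ G V) (B : V → V → ℂ) : Prop :=
  (∃ c : InnerProductSpace.Core ℂ V, ∀ x y, c.inner x y = B x y) ∧
    ∀ g x y, B (ρ g x) (ρ g y) = B x y

end GelfandTsetlin

/-! ### Spinor valued spherical monogenics

Throughout, `T` is a finite-dimensional complex vector space with an action `γ` of the Clifford
algebra; the norm on `T` only serves to differentiate `T`-valued functions. -/

section Monogenic

variable {m : ℕ} {T : Type*} [NormedAddCommGroup T] [NormedSpace ℂ T]

/-- The partial derivative `∂_{x_i}`, for `1 ≤ i ≤ m`. -/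
def pd {F : Type*} [NormedAddCommGroup F] [NormedSpace ℝ F] (i : ℕ) (P : E m → F) : E m → F :=
  fun x => fderiv ℝ P x (bv m i)

/-- The Dirac operator `∂ = e_1 ∂_{x_1} + ⋯ + e_m ∂_{x_m}`. -/
def dirac (γ : Cl m →ₐ[ℝ] Module.End ℂ T) (P : E m → T) : E m → T :=
  fun x => ∑ i : Fin m, γ (e m (i + 1)) (pd ((i : ℕ) + 1) P x)

/-- The action of `Spin(m)` on a complex module over the Clifford algebra. -/
def spinRep (γ : Cl m →ₐ[ℝ] Module.End ℂ T) : Representation ℂ (Spin m) T :=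
  (γ : Cl m →* Module.End ℂ T).comp (Submonoid.subtype (spinGroup (negNormSq m)))

theorem spinRep_apply (γ : Cl m →ₐ[ℝ] Module.End ℂ T) (s : Spin m) : spinRep γ s = γ (s : Cl m) :=
  rfl

/-- The `L`-action `[L(s)P](x) = s P(s⁻¹ x s)` of `Spin(m)` on functions. -/
def lAction (γ : Cl m →ₐ[ℝ] Module.End ℂ T) : Representation ℂ (Spin m) (E m → T) where
  toFun s :=
    { toFun := fun P x => γ (s : Cl m) (P (rot s⁻¹ x))
      map_add' := fun P Q => by ext x; simp
      map_smul' := fun c P => by ext x; simp }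
  map_one' := by ext P x; simp [rot_one]
  map_mul' s t := by ext P x; simp [rot_mul]

/-- The space of `k`-homogeneous polynomials on `ℝ^m` with values in `S`. -/
def homogPoly (m : ℕ) (S : Submodule ℂ T) (k : ℕ) : Submodule ℂ (E m → T) :=
  Submodule.span ℂ {P | ∃ α : Fin m → ℕ, ∑ i, α i = k ∧ ∃ s ∈ S,
    P = fun x => ((∏ i, x i ^ α i : ℝ) : ℂ) • s}

theorem homogPoly_differentiable {S : Submodule ℂ T} {k : ℕ} {P : E m → T}
    (hP : P ∈ homogPoly m S k) : Differentiable ℝ P := by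
  induction hP using Submodule.span_induction with
  | mem P h =>
    obtain ⟨α, -, s, -, rfl⟩ := h
    have : Differentiable ℝ fun x : E m => (∏ i, x i ^ α i : ℝ) := by fun_prop
    exact (Complex.ofRealCLM.differentiable.comp this).smul_const s
  | zero => exact differentiable_const 0
  | add P Q _ _ hP hQ => exact hP.add hQ
  | smul c P _ hP => exact hP.const_smul c

theorem homogPoly_apply_mem {S : Submodule ℂ T} {k : ℕ} {P : E m → T}
    (hP : P ∈ homogPoly m S k) (x : E m) : P x ∈ S := by
  induction hP using Submodule.span_induction with
  | mem P h =>
    obtain ⟨α, -, s, hs, rfl⟩ := h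
    exact S.smul_mem _ hs
  | zero => exact S.zero_mem
  | add P Q _ _ hP hQ => exact S.add_mem hP hQ
  | smul c P _ hP => exact S.smul_mem c hP

theorem homogPoly_coord_smul {S : Submodule ℂ T} {k : ℕ} {P : E m → T}
    (hP : P ∈ homogPoly m S k) (i : Fin m) :
    (fun x => (x i : ℂ) • P x) ∈ homogPoly m S (k + 1) := by
  induction hP using Submodule.span_induction with
  | mem P h =>
    obtain ⟨α, hα, s, hs, rfl⟩ := h
    refine Submodule.subset_span ⟨α + Pi.single i 1, ?_, s, hs, ?_⟩
    · simp [Finset.sum_add_distrib, hα]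
    · ext x
      rw [smul_smul]
      congr 1
      rw [← Complex.ofReal_mul]
      congr 1
      simp only [Pi.add_apply, pow_add, Finset.prod_mul_distrib]
      rw [mul_comm]
      congr 1
      rw [Finset.prod_eq_single i] <;> simp +contextual
  | zero =>
    convert (homogPoly m S (k + 1)).zero_mem using 1
    ext x
    simp
  | add P Q _ _ hP hQ =>
    have := (homogPoly m S (k + 1)).add_mem hP hQ
    convert this using 1
    ext x
    simp
  | smul c P _ hP =>
    have := (homogPoly m S (k + 1)).smul_mem c hP
    convert this using 1
    ext x
    exact smul_comm _ _ _

theorem homogPoly_linear_smul {S : Submodule ℂ T} {k : ℕ} {P : E m → T}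
    (hP : P ∈ homogPoly m S k) (A : E m →ₗ[ℝ] E m) (i : Fin m) :
    (fun x => (A x i : ℂ) • P x) ∈ homogPoly m S (k + 1) := by
  have h : ∀ x, A x i = ∑ j, A (EuclideanSpace.basisFun (Fin m) ℝ j) i * x j := by
    intro x
    conv_lhs => rw [← (EuclideanSpace.basisFun (Fin m) ℝ).sum_repr x]
    simp [mul_comm]
  have h2 : (fun x => (A x i : ℂ) • P x) =
      ∑ j, (A (EuclideanSpace.basisFun (Fin m) ℝ j) i : ℂ) • fun x : E m => (x j : ℂ) • P x := by
    ext x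
    rw [h x, Finset.sum_apply, Complex.ofReal_sum, Finset.sum_smul]
    refine Finset.sum_congr rfl fun j _ => ?_
    rw [Complex.ofReal_mul, mul_smul]
    rfl
  rw [h2]
  exact Submodule.sum_mem _ fun j _ => Submodule.smul_mem _ _ (homogPoly_coord_smul hP j)

theorem homogPoly_comp {S : Submodule ℂ T} {k : ℕ} {P : E m → T}
    (hP : P ∈ homogPoly m S k) (A : E m →ₗ[ℝ] E m) (g : T →ₗ[ℂ] T) (hg : ∀ s ∈ S, g s ∈ S) :
    (fun x => g (P (A x))) ∈ homogPoly m S k := by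
  induction hP using Submodule.span_induction with
  | mem P h =>
    obtain ⟨α, hα, s, hs, rfl⟩ := h
    rw [← hα]
    have key : ∀ t : Finset (Fin m), (fun x => ((∏ i ∈ t, A x i ^ α i : ℝ) : ℂ) • g s) ∈
        homogPoly m S (∑ i ∈ t, α i) := by
      intro t
      induction t using Finset.induction_on with
      | empty =>
        refine Submodule.subset_span ⟨0, by simp, g s, hg s hs, ?_⟩
        simp
      | insert a t ha ih =>
        rw [Finset.sum_insert ha, add_comm]
        have : ∀ n : ℕ, (fun x => ((A x a ^ n * ∏ i ∈ t, A x i ^ α i : ℝ) : ℂ) • g s) ∈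
            homogPoly m S (∑ i ∈ t, α i + n) := by
          intro n
          induction n with
          | zero => simpa using ih
          | succ n ihn =>
            have := homogPoly_linear_smul ihn A a
            rw [← add_assoc]
            convert this using 1
            ext x
            rw [smul_smul]
            congr 1
            push_cast
            ring
        convert this (α a) using 1
        ext x
        rw [Finset.prod_insert ha]
    convert key Finset.univ using 1
    ext x
    simp
  | zero =>
    convert (homogPoly m S k).zero_mem using 1
    ext x
    simp
  | add P Q _ _ hP hQ =>
    have := (homogPoly m S k).add_mem hP hQ
    convert this using 1
    ext x
    simp
  | smul c P _ hP =>
    have := (homogPoly m S k).smul_mem c hP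
    convert this using 1
    ext x
    simp

/-- The space `M_k(ℝ^m, S)` of `k`-homogeneous `S`-valued polynomials `P` on `ℝ^m` with
`∂P = 0`. -/
def monogenic (γ : Cl m →ₐ[ℝ] Module.End ℂ T) (S : Submodule ℂ T) (k : ℕ) :
    Submodule ℂ (E m → T) where
  carrier := {P | P ∈ homogPoly m S k ∧ ∀ x, dirac γ P x = 0}
  zero_mem' := by
    refine ⟨Submodule.zero_mem _, fun x => ?_⟩
    simp [dirac, pd]
  add_mem' := by
    rintro P Q ⟨hP, hP'⟩ ⟨hQ, hQ'⟩
    refine ⟨Submodule.add_mem _ hP hQ, fun x => ?_⟩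
    have h1 := homogPoly_differentiable hP x
    have h2 := homogPoly_differentiable hQ x
    have := congrArg₂ (· + ·) (hP' x) (hQ' x)
    simpa [dirac, pd, fderiv_add h1 h2, Finset.sum_add_distrib] using this
  smul_mem' := by
    rintro c P ⟨hP, hP'⟩
    refine ⟨Submodule.smul_mem _ c hP, fun x => ?_⟩
    have h1 := homogPoly_differentiable hP x
    have := congrArg (c • ·) (hP' x)
    simpa [dirac, pd, fderiv_const_smul h1, Finset.smul_sum] using this

/-- `M_k(ℝ^m, S)` is a `Spin(m)`-module under the `L`-action. -/
def monogenicSub [FiniteDimensional ℂ T] (γ : Cl m →ₐ[ℝ] Module.End ℂ T)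
    (S : Subrepresentation (spinRep γ)) (k : ℕ) : Subrepresentation (lAction γ) where
  toSubmodule := monogenic γ S.toSubmodule k
  apply_mem_toSubmodule s P hP := by
    obtain ⟨hP, hP'⟩ := hP
    refine ⟨homogPoly_comp hP (rot s⁻¹) (γ (s : Cl m)) (fun t ht => S.apply_mem_toSubmodule s ht),
      fun x => ?_⟩
    have hd : ∀ v, fderiv ℝ (lAction γ s P) x v =
        γ (s : Cl m) (fderiv ℝ P (rot s⁻¹ x) (rot s⁻¹ v)) := by
      intro v
      have h1 : HasFDerivAt P (fderiv ℝ P (rot s⁻¹ x)) (rot s⁻¹ x) :=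
        (homogPoly_differentiable hP _).hasFDerivAt
      have h2 : HasFDerivAt (fun y => rot s⁻¹ y) (rot (s⁻¹)).toContinuousLinearMap x :=
        (rot (s⁻¹)).toContinuousLinearMap.hasFDerivAt
      have h3 := h1.comp x h2
      have h4 := ((LinearMap.toContinuousLinearMap (γ (s : Cl m))).restrictScalars ℝ).hasFDerivAt
        (x := P (rot s⁻¹ x))
      have h5 := h4.comp x h3
      have h6 : (lAction γ s P) = ((LinearMap.toContinuousLinearMap (γ (s : Cl m))).restrictScalars ℝ) ∘
        (P ∘ fun y => rot s⁻¹ y) := rfl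
      rw [h6, h5.fderiv]
      rfl
    set b := EuclideanSpace.basisFun (Fin m) ℝ with hb
    set D := fderiv ℝ P (rot s⁻¹ x) with hD
    have hP0 : ∑ i : Fin m, γ (ι (negNormSq m) (b i)) (D (b i)) = 0 := by
      have := hP' (rot s⁻¹ x)
      simpa only [dirac, pd, e, bv_succ] using this
    have key : ∑ i : Fin m, γ (ι (negNormSq m) (rot s⁻¹ (b i))) (D (rot s⁻¹ (b i))) = 0 := by
      have hexp : ∀ i, rot s⁻¹ (b i) = ∑ j, (inner ℝ (b j) (rot s⁻¹ (b i)) : ℝ) • b j :=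
        fun i => (b.sum_repr' _).symm
      have hexp2 : ∀ j, b j = ∑ i, (inner ℝ (b j) (rot s⁻¹ (b i)) : ℝ) • rot s⁻¹ (b i) := by
        intro j
        have := (b.map (rotIso s⁻¹)).sum_repr' (b j)
        conv_lhs => rw [← this]
        refine Finset.sum_congr rfl fun i _ => ?_
        rw [real_inner_comm]
        rfl
      calc _ = ∑ i, ∑ j, (inner ℝ (b j) (rot s⁻¹ (b i)) : ℝ) •
              γ (ι (negNormSq m) (rot s⁻¹ (b i))) (D (b j)) := by
            refine Finset.sum_congr rfl fun i _ => ?_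
            conv_lhs => rw [hexp i, map_sum D, ← hexp i]
            rw [map_sum]
            refine Finset.sum_congr rfl fun j _ => ?_
            rw [map_smul D]
            exact LinearMap.map_smul_of_tower _ _ _
        _ = ∑ j, ∑ i, (inner ℝ (b j) (rot s⁻¹ (b i)) : ℝ) •
              γ (ι (negNormSq m) (rot s⁻¹ (b i))) (D (b j)) := Finset.sum_comm
        _ = ∑ j, γ (ι (negNormSq m) (b j)) (D (b j)) := by
            refine Finset.sum_congr rfl fun j _ => ?_
            conv_rhs => rw [hexp2 j, map_sum (ι (negNormSq m)), ← hexp2 j]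
            rw [map_sum, LinearMap.sum_apply]
            refine Finset.sum_congr rfl fun i _ => ?_
            rw [map_smul, map_smul]
            rfl
        _ = 0 := hP0
    have : dirac γ (lAction γ s P) x = γ (s : Cl m)
        (∑ i : Fin m, γ (ι (negNormSq m) (rot s⁻¹ (b i))) (D (rot s⁻¹ (b i)))) := by
      rw [map_sum]
      refine Finset.sum_congr rfl fun i _ => ?_
      rw [pd, hd, bv_succ, e, bv_succ, ← Module.End.mul_apply, ← Module.End.mul_apply, ← map_mul,
        ← map_mul, ι_rot, inv_inv, ← mul_assoc, ← mul_assoc, spin_mul_inv, one_mul]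
    rw [this, key, map_zero]

/-- The `Spin(m)`-module `M_k(ℝ^m, S)`. -/
def monogenicRep [FiniteDimensional ℂ T] (γ : Cl m →ₐ[ℝ] Module.End ℂ T)
    (S : Subrepresentation (spinRep γ)) (k : ℕ) :
    Representation ℂ (Spin m) (monogenic γ S.toSubmodule k) :=
  (monogenicSub γ S k).toRepresentation

/-- The elements of `M_k(ℝ^m, S)` as functions with values in `S`. -/
def toS {γ : Cl m →ₐ[ℝ] Module.End ℂ T} {S : Submodule ℂ T} {k : ℕ}
    (P : monogenic γ S k) (x : E m) : S :=
  ⟨P.1 x, homogPoly_apply_mem P.2.1 x⟩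

/-- The `L²`-inner product `∫ (P(x), Q(x)) dx` over the unit ball, for an inner product `b`
on `S`. -/
def l2Inner {γ : Cl m →ₐ[ℝ] Module.End ℂ T} {S : Submodule ℂ T} {k : ℕ} (b : S → S → ℂ)
    (P Q : monogenic γ S k) : ℂ :=
  ∫ x in Metric.ball (0 : E m) 1, b (toS P x) (toS Q x)

/-- The derivative `∂^α = ∂_{x_1}^{α_1} ⋯ ∂_{x_m}^{α_m}`. -/
def multiPd {F : Type*} [NormedAddCommGroup F] [NormedSpace ℝ F] (α : Fin m → ℕ) (P : E m → F) :
    E m → F :=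
  (List.finRange m).foldr (fun (i : Fin m) Q => (pd ((i : ℕ) + 1))^[α i] Q) P

/-- The Fischer inner product `∑_α α! (P_α, Q_α)` of `P = ∑_α x^α P_α` and `Q = ∑_α x^α Q_α`, for
an inner product `b` on `S`; here `P_α = (∂^α P)(0) / α!`. -/
def fischerInner {γ : Cl m →ₐ[ℝ] Module.End ℂ T} {S : Submodule ℂ T} {k : ℕ} (b : S → S → ℂ)
    (P Q : monogenic γ S k) : ℂ :=
  ∑ α ∈ Finset.piAntidiag (Finset.univ : Finset (Fin m)) k,
    ((∏ i, (α i).factorial : ℕ) : ℂ)⁻¹ * b (multiPd α (toS P) 0) (multiPd α (toS Q) 0)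

/-! ### The explicit basis -/

/-- `|x|^l C_l^ν(x_r / |x|)` as a polynomial in `t = x_r` and `q = |x|²`, where `C_l^ν` is the
Gegenbauer polynomial
`C_l^ν(z) = ∑_{i ≤ l/2} (-1)^i (ν)_{l-i} / (i! (l-2i)!) (2z)^{l-2i}`. -/
def homGegenbauer (ν : ℝ) (l : ℕ) (t q : ℝ) : ℝ :=
  ∑ i ∈ Finset.range (l / 2 + 1),
    (-1) ^ i * (ascPochhammer ℝ (l - i)).eval ν / ((i.factorial : ℝ) * ((l - 2 * i).factorial : ℝ))
      * (2 * t) ^ (l - 2 * i) * q ^ i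

/-- The embedding factor `F^{(l)}_{r,j}`, a polynomial in the first `r` variables. -/
def harmFactor (r j l : ℕ) (x : E m) : ℝ :=
  (ascPochhammer ℝ l).eval ((j : ℝ) + 1) / (ascPochhammer ℝ l).eval ((r : ℝ) + 2 * j - 2) *
    homGegenbauer ((r : ℝ) / 2 + j - 1) l (crd r x) (∑ i ∈ Finset.Icc 1 r, crd i x ^ 2)

/-- The Clifford algebra valued embedding factor
`X^{(l)}_{r,j} = F^{(l)}_{r,j} + (j+1)/(r+2j-1) F^{(l-1)}_{r,j+1} (x_1 e_1 + ⋯ + x_{r-1} e_{r-1}) e_r`,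
with `F^{(-1)}_{r,j+1} = 0`. -/
def monFactor (r j l : ℕ) (x : E m) : Cl m :=
  algebraMap ℝ (Cl m) (harmFactor r j l x) +
    (((j : ℝ) + 1) / ((r : ℝ) + 2 * j - 1) * (if l = 0 then 0 else harmFactor r (j + 1) (l - 1) x)) •
      ((∑ i ∈ Finset.Icc 1 (r - 1), crd i x • e m i) * e m r)

/-- For a sequence `κ = (κ 2, κ 3, …)`, the product
`X^{(κ r - κ (r-1))}_{r, κ (r-1)} ⋯ X^{(κ 3 - κ 2)}_{3, κ 2} (x_1 - e_1 e_2 x_2)^{κ 2}`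
with `r = d + 2`. -/
def gtPoly (κ : ℕ → ℕ) : ℕ → E m → Cl m
  | 0, x => (algebraMap ℝ (Cl m) (crd 1 x) - crd 2 x • (e m 1 * e m 2)) ^ κ 2
  | d + 1, x => monFactor (d + 3) (κ (d + 2)) (κ (d + 3) - κ (d + 2)) x * gtPoly κ d x

/-- The set `J^m_k` of integer sequences `k ≥ k_{m-1} ≥ ⋯ ≥ k_2 ≥ 0`; the entry `k_r` is
`μ.1 (r - 2)`. -/
abbrev J (m k : ℕ) : Type := {μ : Fin (m - 2) → ℕ // Monotone μ ∧ ∀ i, μ i ≤ k}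

/-- The entry `k_r` of `μ ∈ J^m_k` for `2 ≤ r ≤ m - 1`, and `k_m = k`. -/
def J.entry {k : ℕ} (μ : J m k) (r : ℕ) : ℕ := if h : r - 2 < m - 2 then μ.1 ⟨r - 2, h⟩ else k

/-- The Clifford algebra valued polynomial `f_{k,μ}` on `ℝ^m`. -/
def fPoly {k : ℕ} (μ : J m k) : E m → Cl m := gtPoly μ.entry (m - 2)

/-- The number `n` with `m = 2n` or `m = 2n - 1`. -/
def half (m : ℕ) : ℕ := (m + 1) / 2

/-- The set `𝒮^m` of sequences of `n - 1` signs. -/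
abbrev Signs (m : ℕ) : Type := Fin (half m - 1) → ℤˣ

/-- The last sign of a sequence in `𝒮^m`. -/
def lastSign (ν : Signs m) : ℤˣ := if h : 0 < half m - 1 then ν ⟨half m - 1 - 1, by omega⟩ else 1

/-- The action of `θ_{2p} = (-i)^p e_1 e_2 ⋯ e_{2p}`. -/
def theta (γ : Cl m →ₐ[ℝ] Module.End ℂ T) (p : ℕ) : Module.End ℂ T :=
  ((-Complex.I) ^ p) • γ (((List.range' 1 (2 * p)).map (e m)).prod)

/-- The piece `S^ν` of `S`, for `ν = (ν_1, …, ν_{n-1})`: starting from `S`, one takes for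
`j = 1, …, n - 1` the part of sign `ν_j` under `Spin(2n - 2j)`, that is, the eigenspace of
`θ_{2n-2j}` for the eigenvalue `ν_j`. -/
def spinorPiece (γ : Cl m →ₐ[ℝ] Module.End ℂ T) (S : Submodule ℂ T) (ν : Signs m) :
    Submodule ℂ T :=
  S ⊓ ⨅ j : Fin (half m - 1),
    LinearMap.ker (theta γ (half m - 1 - j) - algebraMap ℂ (Module.End ℂ T) ((ν j : ℤ) : ℂ))

/-- The polynomial `f^ν_{k,μ} = f_{k,μ} v^ν`. -/
def fSpinor (γ : Cl m →ₐ[ℝ] Module.End ℂ T) (v : Signs m → T) {k : ℕ} (a : Signs m × J m k) :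
    E m → T :=
  fun x => γ (fPoly a.2 x) (v a.1)

/-- The operator `∂_± = (1/2)(∂_{x_1} ± i ∂_{x_2})`. -/
def pdSign (ε : ℤˣ) (P : E m → T) : E m → T :=
  fun x => (1 / 2 : ℂ) • (pd 1 P x + (((ε : ℤ) : ℂ) * Complex.I) • pd 2 P x)

/-- The operator `∂_±^{κ 2} ∂_{x_3}^{κ 3 - κ 2} ⋯ ∂_{x_r}^{κ r - κ (r-1)}` with `r = d + 2`. -/
def appellOp (ε : ℤˣ) (κ : ℕ → ℕ) : ℕ → (E m → T) → (E m → T)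
  | 0, P => (pdSign ε)^[κ 2] P
  | d + 1, P => appellOp ε κ d ((pd (d + 3))^[κ (d + 3) - κ (d + 2)] P)

/-- The Appell normalization
`∂_±^{k_2} ∂_{x_3}^{k_3-k_2} ⋯ ∂_{x_m}^{k-k_{m-1}} g^ν_μ = k! v^ν` for all `ν = (…, ±)`
in `𝒮^m` and all `μ` in `J^m_k`. -/
def IsAppell (v : Signs m → T) {k : ℕ} (g : Signs m × J m k → E m → T) : Prop :=
  ∀ (ν : Signs m) (μ : J m k),
    appellOp (lastSign ν) μ.entry (m - 2) (g (ν, μ)) = fun _ => (k.factorial : ℂ) • v ν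

end Monogenic

end SpinorMonogenic

end

/-! The basis is built by embedding operators that go up one dimension at a time. Multiplication by
X^{(l)}_{r,j} sends a monogenic Q of degree j in the first r-1 variables to a monogenic of degree
j+l in r variables: two radial identities between Gegenbauer polynomials (`exists_radial`) are
exactly what makes the Dirac operator vanish on the product (`dirac_mulX`). Since X is made of x_r,
|x|_r and a covariant bivector, it commutes with Spin(r-1) (`lAction_mulX`). Its normalization gives
an Appell sequence: ∂_{x_r} takes X^{(l+1)}Q to (j+l+1) X^{(l)}Q (`pd_mulX_succ`). The kernel of
∂_{x_r} on monogenics in r variables consists of the monogenics in r-1 variables, so lifting through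
this derivative, by induction on the degree, shows that the monogenics of degree k in r variables
are the sum of the images under X^{(k-j)}_{r,j}, j = 0, ..., k (`monoVar_eq_iSup`). For r = 2 they
are the functions (x_1 - e_1 e_2 x_2)^k t (`exists_eq_zPow`).

The spinor values branch as well. They are treated as modules over the even Clifford algebras: an
irreducible module stays irreducible from 2p+2 to 2p+1 generators (`EvenIrr.of_even`) and splits
into the two eigenspaces of θ_{2p} from 2p+1 to 2p generators (`EvenIrr.of_odd`). Each such
splitting contributes one sign of ν, and at the bottom the pieces are the lines spanned by the v^ν.

Inequivalence of the summands has two sources. Different degrees are separated by the weights of the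
torus Spin(2), whose largest absolute value in degree k is 2k+1; different signs in even dimension
are separated by the scalar by which e_1...e_{2p} acts (`noHom_monoVar_of_ne`,
`noHom_monoVar_sign`). Irreducibility then follows by induction on r (`irr_monoVar_step`): an
invariant submodule is a sum of the inequivalent pieces for Spin(r-1). Evaluation at e_r kills every
piece of positive degree, yet it maps a nonzero Spin(r)-submodule onto all values, because Spin(r)
moves points of the sphere to e_r. Hence every nonzero submodule contains a fixed piece of degree
zero, and so would a nonzero complement. Complements come from an invariant inner product; the
Fischer product supplies one, its invariance being checked on the reproducing kernels ⟨y,x⟩^k s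
(`fischer_invariant`).

These facts form a `BranchingSystem`, which yields the Gelfand–Tsetlin basis. Two basis vectors are
orthogonal because at the last level where they lie in different modules these modules are
inequivalent. For uniqueness, Gelfand–Tsetlin bases agree up to order and scalars
(`IsGelfandTsetlin.exists_smul_eq`). The Appell operator of an index annihilates the basis
polynomials that differ from it upwards at the first differing entry, so the permutation relating
the two bases can only decrease entries; a permutation of a finite set preserves their sum, hence
fixes them. The vectors v^ν then fix the signs and the scalars. -/

noncomputable section

namespace SpinorMonogenic

/-! ### Invariant and irreducible submodules -/

section Abstract

variable {G V : Type*} [Group G] [AddCommGroup V] [Module ℂ V]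

/-- `U` is invariant under the subgroup `K`. -/
def Inv (ρ : Representation ℂ G V) (K : Subgroup G) (U : Submodule ℂ V) : Prop :=
  ∀ g ∈ K, ∀ x ∈ U, ρ g x ∈ U

/-- `U` is a nonzero `K`-invariant submodule without proper nonzero `K`-invariant submodules. -/
def Irr (ρ : Representation ℂ G V) (K : Subgroup G) (U : Submodule ℂ V) : Prop :=
  U ≠ ⊥ ∧ Inv ρ K U ∧ ∀ W ≤ U, Inv ρ K W → W ≠ ⊥ → W = U

/-- Every linear map that is `K`-equivariant from `U` to `U'` vanishes on `U`. -/
def NoHom (ρ : Representation ℂ G V) (K : Subgroup G) (U U' : Submodule ℂ V) : Prop :=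
  ∀ φ : V →ₗ[ℂ] V, (∀ x ∈ U, φ x ∈ U') → (∀ g ∈ K, ∀ x ∈ U, φ (ρ g x) = ρ g (φ x)) →
    ∀ x ∈ U, φ x = 0

variable {ρ : Representation ℂ G V} {K : Subgroup G}

/-- An invariant submodule as a subrepresentation. -/
def Inv.sub {U : Submodule ℂ V} (h : Inv ρ K U) : Subrepresentation (ρ.comp K.subtype) where
  toSubmodule := U
  apply_mem_toSubmodule g x hx := h g g.2 x hx

theorem Inv.inf {U W : Submodule ℂ V} (h : Inv ρ K U) (h' : Inv ρ K W) : Inv ρ K (U ⊓ W) :=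
  fun g hg x hx => ⟨h g hg x hx.1, h' g hg x hx.2⟩

theorem inv_iSup {ι : Sort*} {U : ι → Submodule ℂ V} (h : ∀ i, Inv ρ K (U i)) :
    Inv ρ K (⨆ i, U i) := by
  intro g hg x hx
  have : (⨆ i, U i) ≤ (⨆ i, U i).comap (ρ g) :=
    iSup_le fun i y hy => Submodule.mem_iSup_of_mem i (h i g hg y hy)
  exact this hx

theorem inv_sub (σ : Subrepresentation (ρ.comp K.subtype)) : Inv ρ K σ.toSubmodule :=
  fun g hg _ hx => σ.apply_mem_toSubmodule ⟨g, hg⟩ hx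

/-- Moves irreducibility from the subtype carrying the subrepresentation to the submodule lattice of
the ambient space, so that modules for different subgroups can be compared inside one vector space.
-/
theorem irr_iff_isIrreducible (σ : Subrepresentation (ρ.comp K.subtype)) :
    σ.toRepresentation.IsIrreducible ↔ Irr ρ K σ.toSubmodule := by
  constructor
  · intro h
    refine ⟨?_, inv_sub σ, ?_⟩
    · intro h0
      obtain ⟨a, b, hab⟩ := h.toNontrivial
      apply hab
      ext x
      have : x = 0 := by
        have h1 : (x : V) ∈ (⊥ : Submodule ℂ V) := h0 ▸ x.2
        exact Subtype.ext (by simpa using h1)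
      subst this
      exact ⟨fun _ => b.toSubmodule.zero_mem, fun _ => a.toSubmodule.zero_mem⟩
    · intro W hW hWi hW0
      let τ : Subrepresentation σ.toRepresentation :=
        { toSubmodule := W.comap σ.toSubmodule.subtype
          apply_mem_toSubmodule := fun g x hx => hWi g g.2 x hx }
      rcases h.eq_bot_or_eq_top τ with h1 | h1
      · exfalso
        apply hW0
        rw [eq_bot_iff]
        intro x hx
        have : (⟨x, hW hx⟩ : σ.toSubmodule) ∈ τ.toSubmodule := hx
        rw [h1] at this
        have h2 : (⟨x, hW hx⟩ : σ.toSubmodule) = 0 := this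
        simpa using congrArg Subtype.val h2
      · refine le_antisymm hW fun x hx => ?_
        have : (⟨x, hx⟩ : σ.toSubmodule) ∈ τ.toSubmodule := by
          rw [h1]; exact Submodule.mem_top
        exact this
  · rintro ⟨h0, -, h⟩
    refine { exists_pair_ne := ⟨⊥, ⊤, ?_⟩, eq_bot_or_eq_top := ?_ }
    · intro hbt
      apply h0
      rw [eq_bot_iff]
      intro x hx
      have : (⟨x, hx⟩ : σ.toSubmodule) ∈ (⊤ : Subrepresentation σ.toRepresentation).toSubmodule :=
        Submodule.mem_top
      rw [← hbt] at this
      have h2 : (⟨x, hx⟩ : σ.toSubmodule) = 0 := this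
      simpa using congrArg Subtype.val h2
    · intro τ
      by_cases hb : τ.toSubmodule = ⊥
      · exact Or.inl (Subrepresentation.toSubmodule_injective hb)
      · right
        apply Subrepresentation.toSubmodule_injective
        have := h (τ.toSubmodule.map σ.toSubmodule.subtype) ?_ ?_ ?_
        · change τ.toSubmodule = ⊤
          rw [eq_top_iff]
          rintro ⟨x, hx⟩ -
          rw [← this] at hx
          obtain ⟨y, hy, hyx⟩ := hx
          have : y = ⟨x, by rw [← this]; exact ⟨y, hy, hyx⟩⟩ := Subtype.ext hyx
          rw [← this]
          exact hy
        · rintro _ ⟨y, -, rfl⟩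
          exact y.2
        · rintro g hg _ ⟨y, hy, rfl⟩
          exact ⟨_, τ.apply_mem_toSubmodule ⟨g, hg⟩ hy, rfl⟩
        · intro h1
          exact hb (Submodule.map_injective_of_injective (Submodule.injective_subtype _)
            (h1.trans (Submodule.map_bot _).symm))

theorem isIrreducibleOn_iff {U : Submodule ℂ V} : IsIrreducibleOn ρ K U ↔ Irr ρ K U := by
  constructor
  · rintro ⟨σ, rfl, h⟩
    exact (irr_iff_isIrreducible σ).1 h
  · intro h
    exact ⟨h.2.1.sub, rfl, (irr_iff_isIrreducible _).2 h⟩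

/-- Schur's lemma: a nonzero equivariant map between irreducible submodules is invertible. -/
theorem Irr.exists_inverse {U U' : Submodule ℂ V} (hU : Irr ρ K U) (hU' : Irr ρ K U')
    (φ : V →ₗ[ℂ] V) (h1 : ∀ x ∈ U, φ x ∈ U') (h2 : ∀ g ∈ K, ∀ x ∈ U, φ (ρ g x) = ρ g (φ x))
    {x₀ : V} (hx₀ : x₀ ∈ U) (h0 : φ x₀ ≠ 0) :
    ∃ ψ : V →ₗ[ℂ] V, (∀ y ∈ U', ψ y ∈ U ∧ φ (ψ y) = y) ∧ (∀ x ∈ U, ψ (φ x) = x) ∧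
      ∀ g ∈ K, ∀ y ∈ U', ψ (ρ g y) = ρ g (ψ y) := by
  -- The kernel inside `U` is invariant and proper, hence zero by irreducibility of `U`; dually the
  -- image is all of `U'`.
  have hker : ∀ x ∈ U, φ x = 0 → x = 0 := by
    by_contra! hcon
    obtain ⟨x, hx, hx1, hx2⟩ := hcon
    have := hU.2.2 (U ⊓ LinearMap.ker φ) inf_le_left ?_ ?_
    · rw [← this] at hx₀
      exact h0 hx₀.2
    · intro g hg y hy
      refine ⟨hU.2.1 g hg y hy.1, ?_⟩
      have : φ y = 0 := hy.2
      simp [h2 g hg y hy.1, this]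
    · intro hb
      have : x ∈ U ⊓ LinearMap.ker φ := ⟨hx, hx1⟩
      rw [hb] at this
      exact hx2 (by simpa using this)
  have him : U.map φ = U' := by
    apply hU'.2.2
    · rintro _ ⟨y, hy, rfl⟩; exact h1 y hy
    · rintro g hg _ ⟨y, hy, rfl⟩; exact ⟨ρ g y, hU.2.1 g hg y hy, h2 g hg y hy⟩
    · intro hb
      have : φ x₀ ∈ U.map φ := ⟨x₀, hx₀, rfl⟩
      rw [hb] at this
      exact h0 (by simpa using this)
  let φ' : U →ₗ[ℂ] U' := φ.restrict h1
  have hbij : Function.Bijective φ' := by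
    constructor
    · rw [← LinearMap.ker_eq_bot, LinearMap.ker_eq_bot']
      intro x hx
      exact Subtype.ext (hker x x.2 (congrArg Subtype.val hx))
    · rintro ⟨y, hy⟩
      rw [← him] at hy
      obtain ⟨x, hx, rfl⟩ := hy
      exact ⟨⟨x, hx⟩, rfl⟩
  let ε := LinearEquiv.ofBijective φ' hbij
  -- `NoHom` quantifies over endomorphisms of the whole space, so the inverse is extended
  -- arbitrarily; only its values on `U'` matter.
  obtain ⟨ψ, hψ⟩ := (U.subtype.comp ε.symm.toLinearMap).exists_extend
  have hψ' : ∀ y : U', ψ y = ε.symm y := fun y => LinearMap.congr_fun hψ y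
  have e1 : ∀ y ∈ U', ψ y ∈ U ∧ φ (ψ y) = y := by
    intro y hy
    rw [hψ' ⟨y, hy⟩]
    refine ⟨(ε.symm _).2, ?_⟩
    exact congrArg Subtype.val (ε.apply_symm_apply ⟨y, hy⟩)
  refine ⟨ψ, e1, ?_, ?_⟩
  · intro x hx
    have := hψ' (ε ⟨x, hx⟩)
    rw [ε.symm_apply_apply] at this
    exact this
  · intro g hg y hy
    have h3 := e1 y hy
    have h4 := e1 _ (hU'.2.1 g hg y hy)
    have h5 := hU.2.1 g hg _ h3.1
    have : ψ (ρ g y) - ρ g (ψ y) = 0 := by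
      apply hker _ (U.sub_mem h4.1 h5)
      rw [map_sub, h4.2, h2 g hg _ h3.1, h3.2, sub_self]
    exact sub_eq_zero.1 this

/-- An equivalence, extended linearly to `V`, would have to vanish on a nonzero module although it
is injective there. -/
theorem NoHom.isEmpty_equiv {σ τ : Subrepresentation (ρ.comp K.subtype)}
    (hσ : Irr ρ K σ.toSubmodule) (h : NoHom ρ K σ.toSubmodule τ.toSubmodule) :
    IsEmpty (σ.toRepresentation.Equiv τ.toRepresentation) := by
  constructor
  intro e
  obtain ⟨φ, hφ⟩ := (τ.toSubmodule.subtype.comp e.toLinearMap).exists_extend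
  have hφ' : ∀ y : σ.toSubmodule, φ y = e y := fun y => LinearMap.congr_fun hφ y
  have := h φ ?_ ?_
  · apply hσ.1
    rw [eq_bot_iff]
    intro x hx
    have h1 := this x hx
    rw [hφ' ⟨x, hx⟩] at h1
    have h2 : e ⟨x, hx⟩ = 0 := Subtype.ext h1
    have h3 : (⟨x, hx⟩ : σ.toSubmodule) = 0 := e.toLinearEquiv.map_eq_zero_iff.1 h2
    simpa using congrArg Subtype.val h3
  · intro x hx
    rw [hφ' ⟨x, hx⟩]
    exact (e _).2
  · intro g hg x hx
    have h1 := e.toIntertwiningMap.isIntertwining' ⟨g, hg⟩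
    have h2 := congrArg Subtype.val (LinearMap.congr_fun h1 ⟨x, hx⟩)
    have h3 := hφ' ⟨_, σ.apply_mem_toSubmodule ⟨g, hg⟩ hx⟩
    rw [hφ' ⟨x, hx⟩]
    exact h3.trans h2

theorem noHom_of_isEmpty_equiv {σ τ : Subrepresentation (ρ.comp K.subtype)}
    (hσ : Irr ρ K σ.toSubmodule) (hτ : Irr ρ K τ.toSubmodule)
    (h : IsEmpty (σ.toRepresentation.Equiv τ.toRepresentation)) :
    NoHom ρ K σ.toSubmodule τ.toSubmodule := by
  intro φ h1 h2 x hx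
  by_contra h0
  obtain ⟨ψ, e1, e2, -⟩ := hσ.exists_inverse hτ φ h1 h2 hx h0
  apply h.false
  refine Representation.Equiv.mk' (LinearMap.intertwiningMap_of_isIntertwiningMap (ρ := σ.toRepresentation) (σ := τ.toRepresentation) (φ.restrict h1) ?_) (fun y => ⟨ψ y, (e1 y y.2).1⟩) ?_ ?_
  · intro g y
    exact Subtype.ext (h2 g g.2 y y.2)
  · intro y
    exact Subtype.ext (e2 y y.2)
  · intro y
    exact Subtype.ext (e1 y y.2).2

theorem NoHom.symm {U U' : Submodule ℂ V} (hU : Irr ρ K U) (hU' : Irr ρ K U')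
    (h : NoHom ρ K U U') : NoHom ρ K U' U := by
  intro φ h1 h2 x hx
  by_contra h0
  obtain ⟨ψ, e1, e2, e3⟩ := hU'.exists_inverse hU φ h1 h2 hx h0
  have := h ψ (fun y hy => (e1 y hy).1) e3 (φ x) (h1 x hx)
  rw [e2 x hx] at this
  exact h0 (by simp [this])

/-- A complement of `A ⊔ B` is added to `A` to turn the disjoint pair into complementary subspaces.
The projection is controlled only on `A ⊔ B`, which is all that equivariance arguments need. -/
theorem exists_projection {A B : Submodule ℂ V} (h : Disjoint A B) :
    ∃ p : V →ₗ[ℂ] V, (∀ x ∈ A, p x = 0) ∧ ∀ x ∈ B, p x = x := by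
  obtain ⟨C, hC⟩ := (A ⊔ B).exists_isCompl
  have h1 : IsCompl B (A ⊔ C) := by
    constructor
    · rw [Submodule.disjoint_def]
      intro x hx hx'
      obtain ⟨a, ha, c, hc, rfl⟩ := Submodule.mem_sup.1 hx'
      have : c ∈ A ⊔ B := by
        have : c = -a + (a + c) := by abel
        rw [this]
        exact Submodule.add_mem_sup (A.neg_mem ha) hx
      have hc0 := Submodule.disjoint_def.1 hC.1 c this hc
      rw [hc0, add_zero] at hx ⊢
      exact Submodule.disjoint_def.1 h a ha hx
    · rw [codisjoint_iff, ← hC.sup_eq_top, ← sup_assoc, sup_comm B A]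
  refine ⟨B.subtype.comp (B.projectionOnto (A ⊔ C) h1), ?_, ?_⟩
  · intro x hx
    have : x ∈ A ⊔ C := Submodule.mem_sup_left hx
    simpa using (Submodule.projectionOnto_apply_eq_zero_iff h1).2 this
  · intro x hx
    simpa using congrArg Subtype.val (Submodule.projectionOnto_apply_left h1 ⟨x, hx⟩)

theorem projection_equivariant {A B : Submodule ℂ V} {p : V →ₗ[ℂ] V} (hA : Inv ρ K A)
    (hB : Inv ρ K B) (h1 : ∀ x ∈ A, p x = 0) (h2 : ∀ x ∈ B, p x = x) :
    ∀ x ∈ A ⊔ B, p x ∈ B ∧ ∀ g ∈ K, p (ρ g x) = ρ g (p x) := by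
  intro x hx
  obtain ⟨a, ha, b, hb, rfl⟩ := Submodule.mem_sup.1 hx
  refine ⟨by simpa [h1 a ha, h2 b hb] using hb, fun g hg => ?_⟩
  simp [h1 a ha, h2 b hb, h1 _ (hA g hg a ha), h2 _ (hB g hg b hb)]

/-- In a multiplicity-free direct sum, the only irreducible submodules are the summands. -/
theorem Irr.eq_of_le_iSup {ι : Type*} {U : ι → Submodule ℂ V} (hU : ∀ i, Irr ρ K (U i))
    (hind : iSupIndep U) (hne : ∀ i j, i ≠ j → NoHom ρ K (U i) (U j)) {W : Submodule ℂ V}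
    (hW : Irr ρ K W) (hle : W ≤ ⨆ i, U i) : ∃ i, W = U i := by
  classical
  have hp : ∀ i, ∃ p : V →ₗ[ℂ] V, (∀ x ∈ ⨆ j, ⨆ (_ : j ≠ i), U j, p x = 0) ∧ ∀ x ∈ U i, p x = x :=
    fun i => exists_projection (hind i).symm
  choose p hp0 hp1 using hp
  have hsup : ∀ i, (⨆ j, ⨆ (_ : j ≠ i), U j) ⊔ U i = ⨆ i, U i := by
    intro i
    apply le_antisymm
    · exact sup_le (iSup_le fun j => iSup_le fun _ => le_iSup U j) (le_iSup U i)
    · refine iSup_le fun j => ?_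
      by_cases h : j = i
      · subst h; exact le_sup_right
      · exact le_sup_of_le_left (le_iSup_of_le j (le_iSup_of_le h le_rfl))
  have hpe : ∀ i, ∀ x ∈ ⨆ i, U i, p i x ∈ U i ∧ ∀ g ∈ K, p i (ρ g x) = ρ g (p i x) := by
    intro i x hx
    refine projection_equivariant (inv_iSup fun j => inv_iSup fun _ => (hU j).2.1) (hU i).2.1
      (hp0 i) (hp1 i) x ?_
    rw [hsup]; exact hx
  -- A vector is the sum of its components `p i x`, so it lies in the span of those that do not
  -- vanish.
  have hsum : ∀ x ∈ ⨆ i, U i, x ∈ ⨆ i, Submodule.span ℂ {p i x} := by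
    intro x hx
    obtain ⟨f, hf, rfl⟩ := (Submodule.mem_iSup_iff_exists_finsupp U x).1 hx
    have h1 : ∀ i, p i (f.sum fun _ y => y) = f i := by
      intro i
      rw [Finsupp.sum, map_sum]
      rw [Finset.sum_eq_single i]
      · exact hp1 i _ (hf i)
      · intro j _ hj
        exact hp0 i _ (Submodule.mem_iSup_of_mem j (Submodule.mem_iSup_of_mem hj (hf j)))
      · intro hi
        rw [Finsupp.notMem_support_iff.1 hi, map_zero]
    simp only [h1]
    exact Submodule.sum_mem _ fun i _ => Submodule.mem_iSup_of_mem i (Submodule.mem_span_singleton_self _)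
  obtain ⟨x₀, hx₀, hx₀0⟩ := Submodule.exists_mem_ne_zero_of_ne_bot hW.1
  have : ∃ i, p i x₀ ≠ 0 := by
    by_contra! hcon
    have := hsum x₀ (hle hx₀)
    simp [hcon] at this
    exact hx₀0 this
  obtain ⟨i, hi⟩ := this
  obtain ⟨ψ, e1, e2, e3⟩ := hW.exists_inverse (hU i) (p i) (fun x hx => (hpe i x (hle hx)).1)
    (fun g hg x hx => (hpe i x (hle hx)).2 g hg) hx₀ hi
  -- `W` is isomorphic to `U i` through `p i`; inverting this and projecting to `U j` gives an
  -- equivariant map between inequivalent summands.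
  have hj : ∀ j, j ≠ i → ∀ x ∈ W, p j x = 0 := by
    intro j hji x hx
    have := hne i j hji.symm ((p j).comp ψ) (fun y hy => (hpe j _ (hle (e1 y hy).1)).1)
      (fun g hg y hy => by
        rw [LinearMap.comp_apply, e3 g hg y hy, (hpe j _ (hle (e1 y hy).1)).2 g hg]; rfl)
      (p i x) (hpe i x (hle hx)).1
    rwa [LinearMap.comp_apply, e2 x hx] at this
  refine ⟨i, (hU i).2.2 W (fun x hx => ?_) hW.2.1 hW.1⟩
  have := hsum x (hle hx)
  refine (iSup_le fun j => ?_ : (⨆ j, Submodule.span ℂ {p j x}) ≤ U i) this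
  rw [Submodule.span_singleton_le_iff_mem]
  by_cases hji : j = i
  · subst hji; exact (hpe j x (hle hx)).1
  · rw [hj j hji x hx]; exact (U i).zero_mem

theorem Irr.exists_le {W : Submodule ℂ V} [FiniteDimensional ℂ W] (hW : Inv ρ K W) (h0 : W ≠ ⊥) :
    ∃ U ≤ W, Irr ρ K U := by
  induction h : Module.finrank ℂ W using Nat.strong_induction_on generalizing W with
  | _ n ih =>
    by_cases hirr : Irr ρ K W
    · exact ⟨W, le_rfl, hirr⟩
    · have : ∃ W' ≤ W, Inv ρ K W' ∧ W' ≠ ⊥ ∧ W' ≠ W := by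
        by_contra! hcon
        exact hirr ⟨h0, hW, hcon⟩
      obtain ⟨W', h1, h2, h3, h4⟩ := this
      have : FiniteDimensional ℂ W' := Submodule.finiteDimensional_of_le h1
      obtain ⟨U, hU, hU'⟩ := ih _ (h ▸ Submodule.finrank_lt_finrank_of_lt (lt_of_le_of_ne h1 h4))
        h2 h3 rfl
      exact ⟨U, hU.trans h1, hU'⟩

/-- Every invariant submodule of `N` has an invariant complement, for all subgroups. -/
def Complemented (ρ : Representation ℂ G V) (N : Submodule ℂ V) : Prop :=
  ∀ (K : Subgroup G), ∀ W ≤ N, Inv ρ K W → ∃ W', Inv ρ K W' ∧ Disjoint W W' ∧ N ≤ W ⊔ W'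

/-- If invariant submodules have invariant complements, then every invariant submodule of a
multiplicity-free direct sum is a sum of summands. -/
theorem eq_iSup_of_le_iSup {N : Submodule ℂ V} [FiniteDimensional ℂ N] (hN : Complemented ρ N)
    {ι : Type*} {U : ι → Submodule ℂ V}
    (hU : ∀ i, Irr ρ K (U i)) (hind : iSupIndep U) (hne : ∀ i j, i ≠ j → NoHom ρ K (U i) (U j))
    {W : Submodule ℂ V} (hW : Inv ρ K W) (hWN : W ≤ N) (hle : W ≤ ⨆ i, U i) :
    W = ⨆ (i) (_ : U i ≤ W), U i := by
  set W₀ := ⨆ (i) (_ : U i ≤ W), U i with hW₀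
  have h0 : W₀ ≤ W := iSup_le fun i => iSup_le fun h => h
  obtain ⟨C, hC, hWC, hsup⟩ := hN K W₀ (h0.trans hWN) (inv_iSup fun i => inv_iSup fun _ => (hU i).2.1)
  have : FiniteDimensional ℂ (W ⊓ C : Submodule ℂ V) :=
    Submodule.finiteDimensional_of_le (inf_le_left.trans hWN)
  have h1 : W ⊓ C = ⊥ := by
    -- An irreducible part of `W ⊓ C` would be one of the summands by multiplicity-freeness; lying
    -- in `W`, it is contained in `W₀`, which meets `C` only in zero.
    by_contra hb
    obtain ⟨X, hX, hXi⟩ := Irr.exists_le (hW.inf hC) hb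
    obtain ⟨i, rfl⟩ := hXi.eq_of_le_iSup hU hind hne ((hX.trans inf_le_left).trans hle)
    have h2 : U i ≤ W₀ := le_iSup_of_le i (le_iSup_of_le (hX.trans inf_le_left) le_rfl)
    have h3 := hWC h2 (hX.trans inf_le_right)
    exact (hU i).1 (eq_bot_iff.2 h3)
  have h2 : W ≤ W₀ ⊔ (W ⊓ C) := by
    intro x hx
    obtain ⟨a, ha, c, hc, rfl⟩ := Submodule.mem_sup.1 (hsup (hWN hx))
    refine Submodule.add_mem_sup ha ⟨?_, hc⟩
    simpa using W.sub_mem hx (h0 ha)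
  rw [h1, sup_bot_eq] at h2
  exact le_antisymm h2 h0

/-- Injectivity is required on `U` only, because the embedding operators are known to be injective
just on monogenics in fewer variables. -/
theorem Irr.map {V' : Type*} [AddCommGroup V'] [Module ℂ V'] {ρ' : Representation ℂ G V'}
    {j : V →ₗ[ℂ] V'} {U : Submodule ℂ V} (hj : ∀ x ∈ U, j x = 0 → x = 0)
    (hρ : ∀ g ∈ K, ∀ x, j (ρ g x) = ρ' g (j x)) (h : Irr ρ K U) : Irr ρ' K (U.map j) := by
  refine ⟨?_, ?_, ?_⟩
  · obtain ⟨x, hx, hx0⟩ := Submodule.exists_mem_ne_zero_of_ne_bot h.1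
    intro hb
    have : j x ∈ U.map j := Submodule.mem_map_of_mem hx
    rw [hb, Submodule.mem_bot] at this
    exact hx0 (hj x hx this)
  · rintro g hg _ ⟨x, hx, rfl⟩
    exact ⟨ρ g x, h.2.1 g hg x hx, hρ g hg x⟩
  · intro W hW hWi hW0
    have h1 : U ⊓ W.comap j = U := by
      refine h.2.2 _ inf_le_left ?_ ?_
      · intro g hg x hx
        refine ⟨h.2.1 g hg x hx.1, ?_⟩
        change j (ρ g x) ∈ W
        rw [hρ g hg]
        exact hWi g hg _ hx.2
      · obtain ⟨y, hy, hy0⟩ := Submodule.exists_mem_ne_zero_of_ne_bot hW0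
        obtain ⟨x, hx, rfl⟩ := hW hy
        intro hb
        have : x ∈ U ⊓ W.comap j := ⟨hx, hy⟩
        rw [hb, Submodule.mem_bot] at this
        exact hy0 (by rw [this, map_zero])
    refine le_antisymm hW ?_
    rintro _ ⟨x, hx, rfl⟩
    rw [← h1] at hx
    exact hx.2

/-- A map between the images pulls back to a map from `U` to `U'` through a left inverse of `j'` on
`U'`. -/
theorem NoHom.map {j j' : V →ₗ[ℂ] V} {U U' : Submodule ℂ V} (hU' : Inv ρ K U')
    (hj' : ∀ x ∈ U', j' x = 0 → x = 0) (hρ : ∀ g ∈ K, ∀ x, j (ρ g x) = ρ g (j x))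
    (hρ' : ∀ g ∈ K, ∀ x, j' (ρ g x) = ρ g (j' x)) (h : NoHom ρ K U U') :
    NoHom ρ K (U.map j) (U'.map j') := by
  intro φ h1 h2
  have hker : LinearMap.ker (j'.domRestrict U') = ⊥ := by
    rw [LinearMap.ker_eq_bot']
    intro x hx
    exact Subtype.ext (hj' x x.2 hx)
  obtain ⟨ψ, hψ⟩ := LinearMap.exists_leftInverse_of_injective _ hker
  have hψ' : ∀ x ∈ U', ((ψ (j' x) : U') : V) = x := fun x hx => by
    have := LinearMap.congr_fun hψ ⟨x, hx⟩
    exact congrArg Subtype.val this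
  have key : ∀ x ∈ U, ∃ y ∈ U', φ (j x) = j' y := by
    intro x hx
    obtain ⟨y, hy, h3⟩ := h1 (j x) (Submodule.mem_map_of_mem hx)
    exact ⟨y, hy, h3.symm⟩
  have := h (U'.subtype ∘ₗ ψ ∘ₗ φ ∘ₗ j) (fun x hx => (ψ (φ (j x))).2) (by
    intro g hg x hx
    obtain ⟨y, hy, h3⟩ := key x hx
    change ((ψ (φ (j (ρ g x))) : U') : V) = ρ g ((ψ (φ (j x)) : U') : V)
    rw [hρ g hg, h2 g hg _ (Submodule.mem_map_of_mem hx), h3, hψ' y hy, ← hρ' g hg,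
      hψ' _ (hU' g hg y hy)])
  rintro _ ⟨x, hx, rfl⟩
  obtain ⟨y, hy, h3⟩ := key x hx
  have h4 : ((ψ (φ (j x)) : U') : V) = 0 := this x hx
  rw [h3, hψ' y hy] at h4
  rw [h3, h4, map_zero]

theorem Irr.not_noHom_self {U : Submodule ℂ V} (hU : Irr ρ K U) : ¬ NoHom ρ K U U := by
  intro h
  obtain ⟨x, hx, hx0⟩ := Submodule.exists_mem_ne_zero_of_ne_bot hU.1
  exact hx0 (h LinearMap.id (fun x hx => hx) (fun g _ x _ => rfl) x hx)

/-- Pairwise inequivalent irreducible submodules are independent. -/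
theorem iSupIndep_of_noHom {ι : Type*} [Finite ι] {U : ι → Submodule ℂ V}
    (hU : ∀ i, Irr ρ K (U i)) (hne : ∀ i j, i ≠ j → NoHom ρ K (U i) (U j)) : iSupIndep U := by
  classical
  have := Fintype.ofFinite ι
  rw [iSupIndep_iff_supIndep_univ]
  induction (Finset.univ : Finset ι) using Finset.induction_on with
  | empty => exact Finset.supIndep_empty _
  | insert i s hi ih =>
    refine ih.insert ?_
    rw [disjoint_iff]
    by_contra hb
    rw [Finset.sup_eq_iSup] at hb
    -- If `U i` meets the sum of the others, irreducibility puts it inside that sum, and by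
    -- multiplicity-freeness it equals one of the others.
    have h1 : U i ⊓ ⨆ j ∈ s, U j = U i := (hU i).2.2 _ inf_le_left
      ((hU i).2.1.inf (inv_iSup fun j => inv_iSup fun _ => (hU j).2.1)) hb
    rw [inf_eq_left, iSup_subtype'] at h1
    obtain ⟨j, hj⟩ := Irr.eq_of_le_iSup (U := fun j : {j // j ∈ s} => U j) (fun j => hU j)
      (iSupIndep_iff_supIndep_univ.2 (Finset.supIndep_attach.2 ih)) (fun j k hjk => hne j k fun h => hjk (Subtype.ext h))
      (hU i) h1
    have h2 : i ≠ j := by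
      rintro rfl
      exact hi j.2
    have h3 := hne i j h2
    rw [← hj] at h3
    exact (hU i).not_noHom_self h3

/-! ### Gelfand–Tsetlin bases -/

theorem IsGelfandTsetlin.irr {H : ℕ → Subgroup G} {d : ℕ} {U : Submodule ℂ V} {B : Set V}
    (h : IsGelfandTsetlin ρ H d U B) : Irr ρ (H d) U := by
  cases d with
  | zero => exact isIrreducibleOn_iff.1 h.1
  | succ d => exact isIrreducibleOn_iff.1 h.1

/-- Gelfand–Tsetlin bases are unique up to scalars. -/
theorem IsGelfandTsetlin.exists_smul_eq {H : ℕ → Subgroup G} {d : ℕ} {U : Submodule ℂ V}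
    {B B' : Set V} (h : IsGelfandTsetlin ρ H d U B) (h' : IsGelfandTsetlin ρ H d U B') {b : V}
    (hb : b ∈ B) : ∃ b' ∈ B', ∃ c : ℂ, b = c • b' := by
  induction d generalizing U B B' with
  | zero =>
    obtain ⟨-, x, -, hx, rfl⟩ := h
    obtain ⟨-, x', -, hx', rfl⟩ := h'
    rw [Set.mem_singleton_iff] at hb
    subst hb
    refine ⟨x', rfl, ?_⟩
    have : b ∈ Submodule.span ℂ {x'} := by
      rw [← hx', hx]; exact Submodule.mem_span_singleton_self _
    obtain ⟨c, hc⟩ := Submodule.mem_span_singleton.1 this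
    exact ⟨c, hc.symm⟩
  | succ d ih =>
    obtain ⟨-, N, σ, β, hind, hsup, -, hGT, rfl⟩ := h
    obtain ⟨-, N', σ', β', hind', hsup', hne', hGT', rfl⟩ := h'
    obtain ⟨i, hi⟩ := Set.mem_iUnion.1 hb
    -- An irreducible summand of the first decomposition must be a summand of the second: a
    -- multiplicity-free decomposition is unique.
    obtain ⟨j, hj⟩ := (hGT i).irr.eq_of_le_iSup (fun j => (hGT' j).irr) hind'
      (fun j k hjk => noHom_of_isEmpty_equiv (hGT' j).irr (hGT' k).irr (hne' j k hjk))
      (by rw [hsup', ← hsup]; exact le_iSup (fun i => (σ i).toSubmodule) i)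
    have h1 := hGT i
    rw [hj] at h1
    obtain ⟨b', hb', c, hc⟩ := ih h1 (hGT' j) hi
    exact ⟨b', Set.mem_iUnion.2 ⟨j, hb'⟩, c, hc⟩

theorem exists_orthogonal [FiniteDimensional ℂ V] (c : InnerProductSpace.Core ℂ V)
    (U : Submodule ℂ V) :
    ∃ U' : Submodule ℂ V, (∀ x, x ∈ U' ↔ ∀ y ∈ U, c.inner y x = 0) ∧ IsCompl U U' := by
  let i1 : NormedAddCommGroup V := c.toNormedAddCommGroup
  let i2 : InnerProductSpace ℂ V := InnerProductSpace.ofCore c.toCore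
  exact ⟨Uᗮ, fun x => Submodule.mem_orthogonal U x, Submodule.isCompl_orthogonal U⟩

theorem inv_orthogonal {c : InnerProductSpace.Core ℂ V} {U U' : Submodule ℂ V}
    (hc : ∀ g x y, c.inner (ρ g x) (ρ g y) = c.inner x y)
    (hU : Inv ρ K U) (h : ∀ x, x ∈ U' ↔ ∀ y ∈ U, c.inner y x = 0) : Inv ρ K U' := by
  intro g hg x hx
  rw [h] at hx ⊢
  intro y hy
  have h1 := hx _ (hU g⁻¹ (K.inv_mem hg) y hy)
  rw [← hc g] at h1
  rw [← h1, ← Module.End.mul_apply, ← map_mul]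
  simp

theorem exists_inv_compl [FiniteDimensional ℂ V] {B : V → V → ℂ} (hB : IsInvariantInner ρ B)
    (W : Submodule ℂ V) (hW : Inv ρ K W) : ∃ W', Inv ρ K W' ∧ IsCompl W W' := by
  obtain ⟨⟨c, hc⟩, hinv⟩ := hB
  obtain ⟨U', h1, h2⟩ := exists_orthogonal c W
  exact ⟨U', inv_orthogonal (fun g x y => by rw [hc, hc, hinv]) hW h1, h2⟩

/-- Inequivalent irreducible submodules are orthogonal. -/
theorem NoHom.orthogonal [FiniteDimensional ℂ V] {B : V → V → ℂ} (hB : IsInvariantInner ρ B)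
    {U U' : Submodule ℂ V} (hU' : Inv ρ K U') (h : NoHom ρ K U U')
    {x y : V} (hx : x ∈ U) (hy : y ∈ U') : B y x = 0 := by
  obtain ⟨⟨c, hc⟩, hinv⟩ := hB
  obtain ⟨C, h1, h2⟩ := exists_orthogonal c U'
  have hC : Inv ρ K C := inv_orthogonal (fun g x y => by rw [hc, hc, hinv]) hU' h1
  obtain ⟨p, p0, p1⟩ := exists_projection h2.symm.1
  have hp := projection_equivariant hC hU' p0 p1
  have htop : C ⊔ U' = ⊤ := h2.symm.sup_eq_top
  rw [htop] at hp
  -- The orthogonal projection onto `U'` is equivariant, so it vanishes on the inequivalent module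
  -- `U`.
  have h3 := h p (fun x _ => (hp x trivial).1) (fun g hg x _ => (hp x trivial).2 g hg) x hx
  have : x ∈ C ⊔ U' := by rw [htop]; trivial
  obtain ⟨a, ha, b, hb, rfl⟩ := Submodule.mem_sup.1 this
  rw [map_add, p0 a ha, p1 b hb, zero_add] at h3
  rw [h3, add_zero, ← hc]
  exact (h1 a).1 ha y hy

/-- The modules are constructed among all functions `E m → T`, while the theorem concerns the
subtype of monogenics; this and `NoHom.of_map` bring the results back. -/
theorem Irr.of_map {V' : Type*} [AddCommGroup V'] [Module ℂ V'] {ρ' : Representation ℂ G V'}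
    {j : V' →ₗ[ℂ] V} (hj : Function.Injective j) (hρ : ∀ g x, j (ρ' g x) = ρ g (j x))
    {U : Submodule ℂ V'} (h : Irr ρ K (U.map j)) : Irr ρ' K U := by
  have hinv : ∀ {W : Submodule ℂ V'}, Inv ρ K (W.map j) ↔ Inv ρ' K W := by
    intro W
    constructor
    · intro h g hg x hx
      obtain ⟨y, hy, hyx⟩ := h g hg (j x) ⟨x, hx, rfl⟩
      rw [← hρ] at hyx
      rwa [← hj hyx]
    · rintro h g hg _ ⟨x, hx, rfl⟩
      exact ⟨_, h g hg x hx, hρ g x⟩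
  refine ⟨fun h0 => h.1 (by rw [h0, Submodule.map_bot]), hinv.1 h.2.1, fun W hW hWi hW0 => ?_⟩
  apply Submodule.map_injective_of_injective hj
  exact h.2.2 _ (Submodule.map_mono hW) (hinv.2 hWi)
    fun h0 => hW0 (Submodule.map_injective_of_injective hj (h0.trans (Submodule.map_bot _).symm))

theorem NoHom.of_map {V' : Type*} [AddCommGroup V'] [Module ℂ V'] {ρ' : Representation ℂ G V'}
    {j : V' →ₗ[ℂ] V} (hj : Function.Injective j) (hρ : ∀ g x, j (ρ' g x) = ρ g (j x))
    {U U' : Submodule ℂ V'} (h : NoHom ρ K (U.map j) (U'.map j)) :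
    NoHom ρ' K U U' := by
  intro φ h1 h2 x hx
  obtain ⟨q, hq⟩ := LinearMap.exists_leftInverse_of_injective j (LinearMap.ker_eq_bot.2 hj)
  have hq' : ∀ x, q (j x) = x := fun x => LinearMap.congr_fun hq x
  have := h (j.comp (φ.comp q)) ?_ ?_ (j x) ⟨x, hx, rfl⟩
  · apply hj
    simpa [hq'] using this
  · rintro _ ⟨y, hy, rfl⟩
    exact ⟨φ y, h1 y hy, by simp [hq']⟩
  · rintro g hg _ ⟨y, hy, rfl⟩
    simp [hq', ← hρ, h2 g hg y hy]

/-- A compatible system of decompositions into irreducible modules down a chain of subgroups: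
`U d a` is the irreducible `H d`-module that contains the basis vector `f a`, and `rel d a b` says
that `f a` and `f b` lie in the same `H d`-module. -/
structure BranchingSystem {κ : Type*} (ρ : Representation ℂ G V) (H : ℕ → Subgroup G) (D : ℕ)
    (rel : ℕ → κ → κ → Prop) (U : ℕ → κ → Submodule ℂ V) (f : κ → V) : Prop where
  equiv : ∀ d, Equivalence (rel d)
  mono : ∀ d a b, rel d a b → rel (d + 1) a b
  eq_of_rel : ∀ a b, rel 0 a b → a = b
  total : ∀ a b, rel D a b
  congr : ∀ d a b, rel d a b → U d a = U d b
  irr : ∀ d ≤ D, ∀ a, Irr ρ (H d) (U d a)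
  sup : ∀ d < D, ∀ a, U (d + 1) a = ⨆ (b) (_ : rel (d + 1) a b), U d b
  noHom : ∀ d < D, ∀ a b, ¬ rel d a b → rel (d + 1) a b → NoHom ρ (H d) (U d a) (U d b)
  span : ∀ a, U 0 a = Submodule.span ℂ {f a}

namespace BranchingSystem

variable {κ : Type*} {H : ℕ → Subgroup G} {D : ℕ} {rel : ℕ → κ → κ → Prop}
  {U : ℕ → κ → Submodule ℂ V} {f : κ → V}

/-- The level-zero spaces are lines and every level is the sum of the spaces one level below in the
same class. -/
theorem eq_span (h : BranchingSystem ρ H D rel U f) {d : ℕ} (hd : d ≤ D) (a : κ) :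
    U d a = Submodule.span ℂ (f '' {b | rel d a b}) := by
  induction d generalizing a with
  | zero =>
    have : {b | rel 0 a b} = {a} := by
      ext b
      exact ⟨fun hb => (h.eq_of_rel _ _ hb).symm, fun hb => by
        rw [Set.mem_singleton_iff.1 hb]; exact (h.equiv 0).refl a⟩
    rw [this, Set.image_singleton, h.span]
  | succ d ih =>
    rw [h.sup d hd]
    apply le_antisymm
    · refine iSup_le fun b => iSup_le fun hb => ?_
      rw [ih (by omega)]
      exact Submodule.span_mono (Set.image_mono fun c hc =>
        (h.equiv _).trans hb (h.mono _ _ _ hc))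
    · rw [Submodule.span_le]
      rintro _ ⟨b, hb, rfl⟩
      refine Submodule.mem_iSup_of_mem b (Submodule.mem_iSup_of_mem hb ?_)
      rw [ih (by omega)]
      exact Submodule.subset_span ⟨b, (h.equiv _).refl b, rfl⟩

theorem mem (h : BranchingSystem ρ H D rel U f) {d : ℕ} (hd : d ≤ D) (a : κ) : f a ∈ U d a := by
  rw [h.eq_span hd]
  exact Submodule.subset_span ⟨a, (h.equiv _).refl a, rfl⟩

theorem span_range (h : BranchingSystem ρ H D rel U f) (a : κ) :
    Submodule.span ℂ (Set.range f) = U D a := by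
  rw [h.eq_span le_rfl, ← Set.image_univ]
  congr 2
  ext b
  simp [h.total a b]

theorem ne_zero (h : BranchingSystem ρ H D rel U f) (a : κ) : f a ≠ 0 := by
  intro h0
  apply (h.irr 0 (Nat.zero_le _) a).1
  rw [h.span, h0, Submodule.span_zero_singleton]

/-- At the smallest level where the two labels are related, the level below places the two vectors
in inequivalent irreducible modules. -/
theorem orthogonal [FiniteDimensional ℂ V] (h : BranchingSystem ρ H D rel U f) {B : V → V → ℂ}
    (hB : IsInvariantInner ρ B) {a b : κ} (hab : a ≠ b) : B (f a) (f b) = 0 := by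
  classical
  have hex : ∃ d, rel d b a := ⟨D, h.total b a⟩
  obtain ⟨d, hd, hmin⟩ : ∃ d, rel d b a ∧ ∀ c < d, ¬ rel c b a :=
    ⟨Nat.find hex, Nat.find_spec hex, fun c hc => Nat.find_min hex hc⟩
  cases d with
  | zero => exact absurd (h.eq_of_rel _ _ hd).symm hab
  | succ d =>
    have hdD : d < D := by
      by_contra hcon
      exact hmin D (by omega) (h.total _ _)
    exact (h.noHom d hdD b a (hmin d d.lt_succ_self) hd).orthogonal hB (h.irr d hdD.le a).2.1
      (h.mem hdD.le b) (h.mem hdD.le a)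

theorem linearIndependent [FiniteDimensional ℂ V] (h : BranchingSystem ρ H D rel U f)
    {B : V → V → ℂ} (hB : IsInvariantInner ρ B) : LinearIndependent ℂ f := by
  obtain ⟨⟨c, hc⟩, -⟩ := id hB
  let i1 : NormedAddCommGroup V := c.toNormedAddCommGroup
  let i2 : InnerProductSpace ℂ V := InnerProductSpace.ofCore c.toCore
  refine linearIndependent_of_ne_zero_of_inner_eq_zero h.ne_zero fun a b hab => ?_
  exact (hc _ _).trans (h.orthogonal hB hab)

theorem isGelfandTsetlin [Finite κ] [FiniteDimensional ℂ V] (h : BranchingSystem ρ H D rel U f)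
    (hf : LinearIndependent ℂ f) {d : ℕ} (hd : d ≤ D) (a : κ) :
    IsGelfandTsetlin ρ H d (U d a) (f '' {b | rel d a b}) := by
  induction d generalizing a with
  | zero =>
    refine ⟨isIrreducibleOn_iff.2 (h.irr 0 hd a), f a, h.ne_zero a, h.span a, ?_⟩
    have : {b | rel 0 a b} = {a} := by
      ext b
      exact ⟨fun hb => (h.eq_of_rel _ _ hb).symm, fun hb => by
        rw [Set.mem_singleton_iff.1 hb]; exact (h.equiv 0).refl a⟩
    rw [this, Set.image_singleton]
  | succ d ih =>
    have hd' : d ≤ D := by omega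
    refine ⟨isIrreducibleOn_iff.2 (h.irr _ hd a), ?_⟩
    -- `U d` is constant on `rel d`-classes, so the summands must be indexed by classes; one
    -- representative is chosen in each.
    let st : Setoid {b // rel (d + 1) a b} :=
      ⟨fun b c => rel d b c, ⟨fun _ => (h.equiv d).refl _, (h.equiv d).symm, (h.equiv d).trans⟩⟩
    obtain ⟨N, ⟨e⟩⟩ := Finite.exists_equiv_fin (Quotient st)
    have hs : ∀ b c : {b // rel (d + 1) a b}, (Quotient.mk st b = Quotient.mk st c) ↔ rel d b c :=
      fun b c => Quotient.eq
    let r : Fin N → κ := fun i => (e.symm i).out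
    have hr : ∀ i, rel (d + 1) a (r i) := fun i => (e.symm i).out.2
    have hrne : ∀ i j, i ≠ j → ¬ rel d (r i) (r j) := by
      intro i j hij hcon
      apply hij
      have := (hs (e.symm i).out (e.symm j).out).2 hcon
      rw [Quotient.out_eq, Quotient.out_eq] at this
      exact e.symm.injective this
    have hrex : ∀ b, rel (d + 1) a b → ∃ i, rel d (r i) b := by
      intro b hb
      refine ⟨e (Quotient.mk st ⟨b, hb⟩), ?_⟩
      have := Quotient.out_eq (Quotient.mk st ⟨b, hb⟩)
      rw [hs] at this
      simpa [r] using this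
    have hirr := fun i => h.irr d hd' (r i)
    refine ⟨N, fun i => (hirr i).2.1.sub, fun i => f '' {b | rel d (r i) b}, ?_, ?_, ?_,
      fun i => ih hd' (r i), ?_⟩
    · change iSupIndep fun i => U d (r i)
      intro i
      have h1 : (⨆ j, ⨆ (_ : j ≠ i), U d (r j)) ≤
          Submodule.span ℂ (f '' {b | ∃ j, j ≠ i ∧ rel d (r j) b}) := by
        refine iSup_le fun j => iSup_le fun hj => ?_
        rw [h.eq_span hd']
        exact Submodule.span_mono (Set.image_mono fun b hb => ⟨j, hj, hb⟩)
      refine Disjoint.mono_right h1 ?_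
      change Disjoint (U d (r i)) _
      rw [h.eq_span hd']
      refine hf.disjoint_span_image ?_
      rw [Set.disjoint_left]
      rintro b hb ⟨j, hj, hb'⟩
      exact hrne j i hj ((h.equiv d).trans hb' ((h.equiv d).symm hb))
    · change (⨆ i, U d (r i)) = U (d + 1) a
      rw [h.sup d hd]
      apply le_antisymm
      · exact iSup_le fun i => le_iSup_of_le (r i) (le_iSup_of_le (hr i) le_rfl)
      · refine iSup_le fun b => iSup_le fun hb => ?_
        obtain ⟨i, hi⟩ := hrex b hb
        rw [← h.congr d _ _ hi]
        exact le_iSup (fun i => U d (r i)) i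
    · intro i j hij
      refine NoHom.isEmpty_equiv (hirr i) ?_
      exact h.noHom d hd _ _ (hrne i j hij)
        ((h.equiv _).trans ((h.equiv _).symm (hr i)) (hr j))
    · ext x
      simp only [Set.mem_image, Set.mem_ofPred_eq, Set.mem_iUnion]
      constructor
      · rintro ⟨b, hb, rfl⟩
        obtain ⟨i, hi⟩ := hrex b hb
        exact ⟨i, b, hi, rfl⟩
      · rintro ⟨i, b, hb, rfl⟩
        exact ⟨b, (h.equiv _).trans (hr i) (h.mono _ _ _ hb), rfl⟩

theorem isGelfandTsetlinBasis [Finite κ] [Nonempty κ] [FiniteDimensional ℂ V]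
    (h : BranchingSystem ρ H D rel U f) (hU : ∀ a, U D a = ⊤) {B : V → V → ℂ}
    (hB : IsInvariantInner ρ B) : IsGelfandTsetlinBasis ρ H D f := by
  obtain ⟨a⟩ := ‹Nonempty κ›
  have hf := h.linearIndependent hB
  refine ⟨hf, by rw [h.span_range a, hU], ?_⟩
  have := h.isGelfandTsetlin hf le_rfl a
  rw [hU] at this
  convert this
  rw [← Set.image_univ]
  congr 1
  ext b
  simp [h.total a b]

end BranchingSystem

end Abstract


/-! ### Computations in the Clifford algebra -/

section Clifford

variable {m : ℕ}

theorem ι_mul_ι_swap (x y : E m) :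
    ι (negNormSq m) x * ι (negNormSq m) y = -(ι (negNormSq m) y * ι (negNormSq m) x)
      - algebraMap ℝ (Cl m) (2 * inner ℝ x y) := by
  have h := ι_mul_ι_add_swap (Q := negNormSq m) x y
  have h2 : QuadraticMap.polar (negNormSq m) x y = -(2 * inner ℝ x y) := by
    simp only [QuadraticMap.polar, negNormSq_apply]
    rw [norm_add_sq_real]
    ring
  rw [h2, map_neg] at h
  rw [← sub_eq_zero] at h ⊢
  rw [← h]
  abel

theorem inner_bv (a b : ℕ) : inner ℝ (bv m a) (bv m b) = if a = b ∧ 1 ≤ a ∧ a ≤ m then 1 else 0 := by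
  simp only [bv, PiLp.inner_apply]
  split_ifs with h
  · obtain ⟨rfl, h1, h2⟩ := h
    rw [Finset.sum_eq_single ⟨a - 1, by omega⟩]
    · simp [show a - 1 + 1 = a by omega]
    · intro j _ hj
      have : (j : ℕ) + 1 ≠ a := by
        intro hcon; apply hj; ext; simp; omega
      simp [this]
    · simp
  · refine Finset.sum_eq_zero fun j _ => ?_
    have := j.2
    by_cases h1 : (j : ℕ) + 1 = a
    · have h2 : (j : ℕ) + 1 ≠ b := by omega
      simp [h1]
      omega
    · simp [h1]

theorem norm_bv {a : ℕ} (h1 : 1 ≤ a) (h2 : a ≤ m) : ‖bv m a‖ = 1 := by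
  have : ‖bv m a‖ ^ 2 = 1 := by
    rw [← real_inner_self_eq_norm_sq, inner_bv, if_pos ⟨rfl, h1, h2⟩]
  nlinarith [norm_nonneg (bv m a)]

theorem crd_bv (a b : ℕ) : crd a (bv m b) = if a = b ∧ 1 ≤ a ∧ a ≤ m then 1 else 0 := inner_bv a b

theorem bv_zero : bv m 0 = 0 := by
  ext j; simp [bv]

theorem bv_of_lt {i : ℕ} (h : m < i) : bv m i = 0 := by
  ext j
  have := j.2
  simp [bv]; omega

theorem e_zero : e m 0 = 0 := by simp [e, bv_zero]

theorem e_of_lt {i : ℕ} (h : m < i) : e m i = 0 := by simp [e, bv_of_lt h]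

theorem e_mul_self {a : ℕ} (h1 : 1 ≤ a) (h2 : a ≤ m) : e m a * e m a = -1 := by
  rw [e, ι_sq_scalar, negNormSq_apply, norm_bv h1 h2]
  simp

theorem e_anticomm {a b : ℕ} (h : a ≠ b) : e m a * e m b = -(e m b * e m a) := by
  rw [e, e, ι_mul_ι_swap, inner_bv, if_neg (by tauto)]
  simp

theorem sum_Icc_eq_sum_fin {M : Type*} [AddCommMonoid M] (f : ℕ → M) :
    ∑ i ∈ Finset.Icc 1 m, f i = ∑ i : Fin m, f (i + 1) := by
  rw [Finset.sum_fin_eq_sum_range]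
  refine Finset.sum_nbij' (fun i => i - 1) (fun i => i + 1) ?_ ?_ ?_ ?_ ?_
  · intro i hi; simp at hi ⊢; omega
  · intro i hi; simp at hi ⊢; omega
  · intro i hi; simp at hi ⊢; omega
  · intro i hi; simp
  · intro i hi
    simp at hi
    rw [dif_pos (by omega)]
    congr 1; simp; omega

theorem sum_crd_smul_bv (x : E m) : ∑ i ∈ Finset.Icc 1 m, crd i x • bv m i = x := by
  rw [sum_Icc_eq_sum_fin]
  conv_rhs => rw [← (EuclideanSpace.basisFun (Fin m) ℝ).sum_repr x]
  simp [crd_succ, bv_succ]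

theorem ι_eq_sum (x : E m) : ι (negNormSq m) x = ∑ i ∈ Finset.Icc 1 m, crd i x • e m i := by
  conv_lhs => rw [← sum_crd_smul_bv x]
  simp [e]

theorem sum_crd_sq (x : E m) : ∑ i ∈ Finset.Icc 1 m, crd i x ^ 2 = ‖x‖ ^ 2 := by
  rw [sum_Icc_eq_sum_fin, EuclideanSpace.norm_sq_eq]
  simp [crd_succ]

theorem ι_sq_of_unit {x : E m} (h : ‖x‖ = 1) :
    ι (negNormSq m) x * ι (negNormSq m) x = -1 := by
  rw [ι_sq_scalar, negNormSq_apply, h]; simp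

theorem ι_mem_pin {x : E m} (h : ‖x‖ = 1) : ι (negNormSq m) x ∈ pinGroup (negNormSq m) := by
  have h1 := ι_sq_of_unit h
  refine ⟨?_, ?_⟩
  · refine ⟨⟨ι _ x, -ι _ x, by simp [h1], by simp [h1]⟩, ?_, rfl⟩
    exact Subgroup.subset_closure ⟨x, rfl⟩
  · exact Unitary.mem_iff.2 (by simp [h1])

/-- The product of two unit vectors, as an element of `Spin(m)`. -/
def unitPair (x y : E m) (hx : ‖x‖ = 1) (hy : ‖y‖ = 1) : Spin m :=
  ⟨ι _ x * ι _ y, ⟨mul_mem (ι_mem_pin hx) (ι_mem_pin hy), ι_mul_ι_mem_evenOdd_zero _ x y⟩⟩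

theorem coe_unitPair {x y : E m} (hx : ‖x‖ = 1) (hy : ‖y‖ = 1) :
    (unitPair x y hx hy : Cl m) = ι _ x * ι _ y := rfl

theorem unitPair_inv {x y : E m} (hx : ‖x‖ = 1) (hy : ‖y‖ = 1) :
    (unitPair x y hx hy)⁻¹ = unitPair y x hy hx := by
  rw [inv_eq_iff_mul_eq_one]
  apply Subtype.ext
  change ι _ x * ι _ y * (ι _ y * ι _ x) = 1
  rw [mul_assoc, ← mul_assoc (ι _ y), ι_sq_of_unit hy]
  simp [ι_sq_of_unit hx]

/-- As x² = -1, the product x y x is the reflection of y in the hyperplane orthogonal to x, with no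
extra sign; a product of two unit vectors thus acts as a composition of two reflections. -/
theorem ι_conj {x : E m} (hx : ‖x‖ = 1) (y : E m) :
    ι _ x * ι _ y * ι _ x = ι (negNormSq m) (y - (2 * inner ℝ x y) • x) := by
  rw [ι_mul_ι_swap x y, sub_mul, neg_mul, mul_assoc, ι_sq_of_unit hx, map_sub, map_smul,
    ← Algebra.smul_def]
  simp

theorem rot_unitPair {x y : E m} (hx : ‖x‖ = 1) (hy : ‖y‖ = 1) (z : E m) :
    rot (unitPair x y hx hy) z = z - (2 * inner ℝ y z) • y
      - (2 * inner ℝ x (z - (2 * inner ℝ y z) • y)) • x := by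
  apply ι_injective
  rw [ι_rot, unitPair_inv, coe_unitPair, coe_unitPair, ← ι_conj hx, ← ι_conj hy]
  simp only [mul_assoc]

theorem rot_unitPair_of_orthogonal {x y : E m} (hx : ‖x‖ = 1) (hy : ‖y‖ = 1) {z : E m}
    (h1 : inner ℝ x z = 0) (h2 : inner ℝ y z = 0) : rot (unitPair x y hx hy) z = z := by
  rw [rot_unitPair]; simp [h1, h2]

/-- The element `e_a e_b` of `Spin(m)`. -/
def bvPair (m : ℕ) {a b : ℕ} (ha : 1 ≤ a ∧ a ≤ m) (hb : 1 ≤ b ∧ b ≤ m) : Spin m :=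
  unitPair (bv m a) (bv m b) (norm_bv ha.1 ha.2) (norm_bv hb.1 hb.2)

theorem bvPair_inv {a b : ℕ} (ha : 1 ≤ a ∧ a ≤ m) (hb : 1 ≤ b ∧ b ≤ m) :
    (bvPair m ha hb)⁻¹ = bvPair m hb ha := unitPair_inv _ _

theorem rot_bvPair_of_ne {a b c : ℕ} (ha : 1 ≤ a ∧ a ≤ m) (hb : 1 ≤ b ∧ b ≤ m) (h1 : c ≠ a)
    (h2 : c ≠ b) : rot (bvPair m ha hb) (bv m c) = bv m c := by
  apply rot_unitPair_of_orthogonal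
  · rw [inner_bv, if_neg (by tauto)]
  · rw [inner_bv, if_neg (by tauto)]

theorem rot_bvPair_left {a b : ℕ} (ha : 1 ≤ a ∧ a ≤ m) (hb : 1 ≤ b ∧ b ≤ m) (h : a ≠ b) :
    rot (bvPair m ha hb) (bv m a) = -bv m a := by
  rw [bvPair, rot_unitPair]
  simp only [inner_bv, h.symm, false_and, if_false, mul_zero, zero_smul, sub_zero, ha,
    and_self, if_true]
  module

theorem rot_bvPair_right {a b : ℕ} (ha : 1 ≤ a ∧ a ≤ m) (hb : 1 ≤ b ∧ b ≤ m) (h : a ≠ b) :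
    rot (bvPair m ha hb) (bv m b) = -bv m b := by
  rw [bvPair, rot_unitPair]
  simp only [inner_bv, inner_sub_right, inner_smul_right, h, hb, false_and, if_false, mul_zero,
    zero_smul, sub_zero, and_self, if_true]
  module

theorem bvPair_mem {a b r : ℕ} (ha : 1 ≤ a ∧ a ≤ m) (hb : 1 ≤ b ∧ b ≤ m) (h1 : a ≤ r)
    (h2 : b ≤ r) : bvPair m ha hb ∈ subSpin m r := by
  intro i hi _
  exact rot_bvPair_of_ne ha hb (by omega) (by omega)

theorem inner_rot (s : Spin m) (x y : E m) : inner ℝ (rot s x) (rot s y) = inner ℝ x y :=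
  (rotIso s).inner_map_map x y

theorem crd_rot {s : Spin m} {r i : ℕ} (hs : s ∈ subSpin m r) (hi : r < i) (x : E m) :
    crd i (rot s x) = crd i x := by
  by_cases h : i ≤ m
  · conv_lhs => rw [crd, ← hs i hi h, inner_rot]
    rfl
  · simp [crd, bv_of_lt (not_le.1 h)]

theorem subSpin_mono {r r' : ℕ} (h : r ≤ r') : subSpin m r ≤ subSpin m r' :=
  fun _ hs i hi => hs i (h.trans_lt hi)

theorem spin_commute_e {s : Spin m} {r i : ℕ} (hs : s ∈ subSpin m r) (hi : r < i) :
    (s : Cl m) * e m i = e m i * (s : Cl m) := by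
  by_cases h : i ≤ m
  · have h1 := ι_rot s (bv m i)
    rw [hs i hi h] at h1
    rw [e]
    conv_rhs => rw [h1, mul_assoc, spin_inv_mul, mul_one]
  · simp [e_of_lt (not_le.1 h)]

/-- The even part of the Clifford algebra of the span of `e_1, …, e_r`. -/
def evenAlg (m r : ℕ) : Subalgebra ℝ (Cl m) :=
  Algebra.adjoin ℝ {x | ∃ a ≤ r, ∃ b ≤ r, x = e m a * e m b}

theorem mul_mem_evenAlg {a b r : ℕ} (ha : a ≤ r) (hb : b ≤ r) : e m a * e m b ∈ evenAlg m r :=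
  Algebra.subset_adjoin ⟨a, ha, b, hb, rfl⟩

theorem even_mem_evenAlg {x : Cl m} (hx : x ∈ evenOdd (negNormSq m) 0) : x ∈ evenAlg m m := by
  induction x, hx using even_induction with
  | algebraMap r => exact (evenAlg m m).algebraMap_mem r
  | add x y _ _ hx hy => exact add_mem hx hy
  | ι_mul_ι_mul a b x _ hx =>
    refine mul_mem ?_ hx
    rw [ι_eq_sum, ι_eq_sum, Finset.sum_mul_sum]
    refine sum_mem fun i hi => sum_mem fun j hj => ?_
    rw [Finset.mem_Icc] at hi hj
    rw [smul_mul_smul_comm]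
    exact Subalgebra.smul_mem _ (mul_mem_evenAlg hi.2 hj.2) _

theorem commute_evenAlg {r i : ℕ} (hi : r < i) {x : Cl m} (hx : x ∈ evenAlg m r) :
    x * e m i = e m i * x := by
  induction hx using Algebra.adjoin_induction with
  | mem x h =>
    obtain ⟨a, ha, b, hb, rfl⟩ := h
    rw [mul_assoc, e_anticomm (show b ≠ i by omega), mul_neg, ← mul_assoc,
      e_anticomm (show a ≠ i by omega)]
    simp [mul_assoc]
  | algebraMap c => exact Algebra.commutes c _
  | add x y _ _ hx hy => rw [add_mul, mul_add, hx, hy]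
  | mul x y _ _ hx hy => rw [mul_assoc, hy, ← mul_assoc, hx, mul_assoc]

/-- With τ = e_1 e_{r+1}, every e_c e_{r+1} with c ≤ r equals -(e_c e_1) τ. Moreover τ² = -1, and τ
can be moved past the smaller even algebra at the cost of changing its elements, so the sums u + wτ
are closed under multiplication. -/
theorem evenAlg_succ {r : ℕ} (h1 : 1 ≤ r) (hr : r + 1 ≤ m) {x : Cl m}
    (hx : x ∈ evenAlg m (r + 1)) :
    ∃ u ∈ evenAlg m r, ∃ w ∈ evenAlg m r, x = u + w * (e m 1 * e m (r + 1)) := by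
  have hgen : ∀ c ≤ r, ∃ w ∈ evenAlg m r, e m c * e m (r + 1) = w * (e m 1 * e m (r + 1)) := by
    intro c hc
    refine ⟨-(e m c * e m 1), neg_mem (mul_mem_evenAlg hc h1), ?_⟩
    calc e m c * e m (r + 1) = -(e m c * (e m 1 * e m 1) * e m (r + 1)) := by
          rw [e_mul_self le_rfl (by omega)]; simp
      _ = _ := by simp [mul_assoc]
  have hsq : (e m 1 * e m (r + 1)) * (e m 1 * e m (r + 1)) = -1 := by
    calc _ = -((e m 1 * e m 1) * (e m (r + 1) * e m (r + 1))) := by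
          rw [mul_assoc, ← mul_assoc (e m (r + 1)), e_anticomm (show r + 1 ≠ 1 by omega)]
          simp [mul_assoc]
      _ = _ := by rw [e_mul_self le_rfl (by omega), e_mul_self (by omega) hr]; simp
  have hcomm : ∀ w ∈ evenAlg m r, ∃ w' ∈ evenAlg m r,
      (e m 1 * e m (r + 1)) * w = w' * (e m 1 * e m (r + 1)) := by
    intro w hw
    induction hw using Algebra.adjoin_induction with
    | mem x h =>
      obtain ⟨a, ha, b, hb, rfl⟩ := h
      refine ⟨-(e m 1 * e m a) * (e m b * e m 1), mul_mem (neg_mem (mul_mem_evenAlg h1 ha))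
        (mul_mem_evenAlg hb h1), ?_⟩
      have h2 := commute_evenAlg (i := r + 1) (by omega) (mul_mem_evenAlg (m := m) ha hb)
      rw [mul_assoc, ← h2]
      calc _ = e m 1 * e m a * e m b * e m (r + 1) := by simp only [mul_assoc]
        _ = -(e m 1 * e m a * e m b * (e m 1 * e m 1) * e m (r + 1)) := by
          rw [e_mul_self le_rfl (by omega)]; simp
        _ = _ := by simp [mul_assoc]
    | algebraMap c => exact ⟨_, Subalgebra.algebraMap_mem _ c, (Algebra.commutes c _).symm⟩
    | add x y _ _ hx hy =>
      obtain ⟨a, ha, h⟩ := hx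
      obtain ⟨b, hb, h'⟩ := hy
      exact ⟨a + b, add_mem ha hb, by rw [mul_add, add_mul, h, h']⟩
    | mul x y _ _ hx hy =>
      obtain ⟨a, ha, h⟩ := hx
      obtain ⟨b, hb, h'⟩ := hy
      exact ⟨a * b, mul_mem ha hb, by rw [← mul_assoc, h, mul_assoc, h', ← mul_assoc]⟩
  induction hx using Algebra.adjoin_induction with
  | mem x h =>
    obtain ⟨a, ha, b, hb, rfl⟩ := h
    by_cases ha' : a = r + 1
    · subst ha'
      by_cases hb' : b = r + 1
      · subst hb'
        exact ⟨-1, neg_mem (one_mem _), 0, zero_mem _, by rw [e_mul_self (by omega) hr]; simp⟩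
      · obtain ⟨w, hw, h⟩ := hgen b (by omega)
        refine ⟨0, zero_mem _, -w, neg_mem hw, ?_⟩
        rw [e_anticomm (Ne.symm hb'), h]; simp
    · by_cases hb' : b = r + 1
      · subst hb'
        obtain ⟨w, hw, h⟩ := hgen a (by omega)
        exact ⟨0, zero_mem _, w, hw, by rw [h]; simp⟩
      · exact ⟨_, mul_mem_evenAlg (show a ≤ r by omega) (show b ≤ r by omega), 0, zero_mem _,
          by simp⟩
  | algebraMap c => exact ⟨_, Subalgebra.algebraMap_mem _ c, 0, zero_mem _, by simp⟩
  | add x y _ _ hx hy =>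
    obtain ⟨u, hu, w, hw, rfl⟩ := hx
    obtain ⟨u', hu', w', hw', rfl⟩ := hy
    exact ⟨u + u', add_mem hu hu', w + w', add_mem hw hw', by rw [add_mul]; abel⟩
  | mul x y _ _ hx hy =>
    obtain ⟨u, hu, w, hw, rfl⟩ := hx
    obtain ⟨u', hu', w', hw', rfl⟩ := hy
    obtain ⟨a, ha, h⟩ := hcomm u' hu'
    obtain ⟨b, hb, h'⟩ := hcomm w' hw'
    refine ⟨u * u' - w * b, sub_mem (mul_mem hu hu') (mul_mem hw hb), u * w' + w * a,
      add_mem (mul_mem hu hw') (mul_mem hw ha), ?_⟩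
    set τ := e m 1 * e m (r + 1)
    calc (u + w * τ) * (u' + w' * τ) = u * u' + u * w' * τ + w * (τ * u') + w * (τ * w') * τ := by
          noncomm_ring
      _ = u * u' + u * w' * τ + w * a * τ + w * b * (τ * τ) := by
          rw [h, h']; simp only [mul_assoc]
      _ = _ := by rw [hsq]; noncomm_ring

/-- `Spin(r)` lies in the even Clifford algebra of `e_1, …, e_r`. -/
theorem subSpin_mem_evenAlg {s : Spin m} {r : ℕ} (h1 : 1 ≤ r) (hr : r ≤ m) (hs : s ∈ subSpin m r) :
    (s : Cl m) ∈ evenAlg m r := by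
  obtain ⟨d, hd⟩ := Nat.exists_eq_add_of_le hr
  have key : ∀ j ≤ d, (s : Cl m) ∈ evenAlg m (m - j) := by
    intro j hj
    induction j with
    | zero => exact even_mem_evenAlg (spinGroup.mem_even s.2)
    | succ j ih =>
      have h2 : m - j = (m - (j + 1)) + 1 := by omega
      have h3 := ih (by omega)
      rw [h2] at h3
      set q := m - (j + 1) with hq
      obtain ⟨u, hu, w, hw, hx⟩ := evenAlg_succ (by omega) (by omega) h3
      -- Commuting with e_{q+1} kills the second component: moving e_{q+1} across w e_1 e_{q+1} from
      -- left or right gives opposite signs of w e_1.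
      have hc := spin_commute_e hs (show r < q + 1 by omega)
      rw [hx, add_mul, mul_add, commute_evenAlg (by omega) hu, add_right_inj] at hc
      have h5 : e m (q + 1) * (w * (e m 1 * e m (q + 1))) = w * e m 1 := by
        rw [← mul_assoc, ← commute_evenAlg (by omega) hw, mul_assoc, ← mul_assoc (e m (q + 1)),
          e_anticomm (show q + 1 ≠ 1 by omega), neg_mul, mul_assoc,
          e_mul_self (by omega) (by omega)]
        simp
      have h6 : w * (e m 1 * e m (q + 1)) * e m (q + 1) = -(w * e m 1) := by
        rw [mul_assoc, mul_assoc, e_mul_self (by omega) (by omega)]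
        simp
      rw [h5, h6] at hc
      have h7 : w * e m 1 = 0 := by
        have h8 : (2 : ℝ) • (w * e m 1) = 0 := by rw [two_smul]; nth_rw 1 [← hc]; simp
        simpa using h8
      rw [hx, ← mul_assoc, h7]
      simpa using hu
  have := key d le_rfl
  rwa [show m - d = r by omega] at this

/-- The pseudoscalar `e_1 ⋯ e_n`. -/
def vol (m n : ℕ) : Cl m := ((List.range' 1 n).map (e m)).prod

theorem vol_zero : vol m 0 = 1 := rfl

theorem vol_succ (n : ℕ) : vol m (n + 1) = vol m n * e m (n + 1) := by
  rw [vol, List.range'_1_concat, List.map_append, List.prod_append]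
  simp [vol, add_comm]

theorem vol_mul_e_of_lt {n a : ℕ} (h : n < a) :
    vol m n * e m a = (-1 : ℝ) ^ n • (e m a * vol m n) := by
  induction n with
  | zero => simp [vol_zero]
  | succ n ih =>
    rw [vol_succ, mul_assoc, e_anticomm (show n + 1 ≠ a by omega), mul_neg, ← mul_assoc,
      ih (by omega), pow_succ, smul_mul_assoc, mul_smul, neg_smul, one_smul, smul_neg, mul_assoc]

/-- One of the n factors is e_a itself and commutes with it, so only n - 1 signs arise. -/
theorem vol_mul_e_of_le {n a : ℕ} (h : a ≤ n) :
    vol m n * e m a = (-1 : ℝ) ^ (n + 1) • (e m a * vol m n) := by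
  induction n with
  | zero => simp [show a = 0 by omega, e_zero]
  | succ n ih =>
    by_cases h2 : a = n + 1
    · subst h2
      have h4 := vol_mul_e_of_lt (m := m) (lt_add_one n)
      rw [vol_succ, mul_assoc, ← mul_assoc (e m (n + 1)) (vol m n) (e m (n + 1))]
      have h3 : e m (n + 1) * vol m n = (-1 : ℝ) ^ n • (vol m n * e m (n + 1)) := by
        rw [h4, smul_smul, ← pow_add, Even.neg_one_pow ⟨n, rfl⟩, one_smul]
      rw [h3, smul_mul_assoc, smul_smul, mul_assoc, ← pow_add,
        Even.neg_one_pow ⟨n + 1, by ring⟩, one_smul]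
    · rw [vol_succ, mul_assoc, e_anticomm (show n + 1 ≠ a by omega), mul_neg, ← mul_assoc,
        ih (by omega), pow_succ _ (n + 1), smul_mul_assoc, mul_smul, neg_smul, one_smul, smul_neg,
        mul_assoc]

theorem vol_commute_of_le {n a b : ℕ} (ha : a ≤ n) (hb : b ≤ n) :
    vol m n * (e m a * e m b) = e m a * e m b * vol m n := by
  rw [← mul_assoc, vol_mul_e_of_le ha, smul_mul_assoc, mul_assoc, vol_mul_e_of_le hb, mul_smul_comm,
    smul_smul, ← pow_add, Even.neg_one_pow ⟨n + 1, rfl⟩, one_smul, mul_assoc]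

theorem vol_sq_succ {n : ℕ} (h : n + 1 ≤ m) :
    vol m (n + 1) * vol m (n + 1) = (-1 : ℝ) ^ (n + 1) • (vol m n * vol m n) := by
  have h1 := vol_mul_e_of_le (m := m) (le_refl (n + 1))
  calc vol m (n + 1) * vol m (n + 1) = vol m (n + 1) * vol m n * e m (n + 1) := by
        rw [vol_succ, mul_assoc, mul_assoc, mul_assoc]
    _ = (-1 : ℝ) ^ n • (vol m n * vol m n) * (e m (n + 1) * e m (n + 1)) := by
        have h2 : e m (n + 1) * vol m n = (-1 : ℝ) ^ n • (vol m n * e m (n + 1)) := by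
          rw [vol_mul_e_of_lt (m := m) (lt_add_one n), smul_smul, ← pow_add,
            Even.neg_one_pow ⟨n, rfl⟩, one_smul]
        rw [vol_succ, mul_assoc (vol m n), h2]
        simp [mul_assoc]
    _ = _ := by
        rw [e_mul_self (by omega) h, pow_succ]
        simp

theorem vol_sq {n : ℕ} (h : n ≤ m) : ∃ c : ℝ, c * c = 1 ∧ vol m n * vol m n = algebraMap ℝ _ c := by
  induction n with
  | zero => exact ⟨1, by simp, by simp [vol_zero]⟩
  | succ n ih =>
    obtain ⟨c, h1, h2⟩ := ih (by omega)
    refine ⟨(-1) ^ (n + 1) * c, ?_, ?_⟩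
    · rw [mul_mul_mul_comm, h1, ← pow_add, Even.neg_one_pow ⟨n + 1, rfl⟩, one_mul]
    · rw [vol_sq_succ h, h2, map_mul, ← Algebra.smul_def]

theorem vol_sq_even {p : ℕ} (h : 2 * p ≤ m) :
    vol m (2 * p) * vol m (2 * p) = algebraMap ℝ _ ((-1) ^ p) := by
  induction p with
  | zero => simp [vol_zero]
  | succ p ih =>
    rw [show 2 * (p + 1) = 2 * p + 1 + 1 by ring, vol_sq_succ (by omega), vol_sq_succ (by omega),
      ih (by omega), smul_smul, ← pow_add, Odd.neg_one_pow ⟨2 * p + 1, by ring⟩, pow_succ]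
    simp

theorem vol_even_mem {p r : ℕ} (h : 2 * p ≤ r) : vol m (2 * p) ∈ evenAlg m r := by
  induction p with
  | zero => simp [vol_zero]
  | succ p ih =>
    rw [show 2 * (p + 1) = 2 * p + 1 + 1 by ring, vol_succ, vol_succ, mul_assoc]
    exact mul_mem (ih (by omega)) (mul_mem_evenAlg (by omega) (by omega))

theorem e_mul_vol_odd_mem {p r a : ℕ} (h : 2 * p + 1 ≤ r) (ha : a ≤ r) :
    e m a * vol m (2 * p + 1) ∈ evenAlg m r := by
  induction p with
  | zero =>
    rw [vol_succ]
    simpa [vol_zero] using mul_mem_evenAlg (m := m) ha h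
  | succ p ih =>
    rw [show 2 * (p + 1) + 1 = 2 * p + 1 + 1 + 1 by ring, vol_succ, vol_succ, mul_assoc, ← mul_assoc]
    exact mul_mem (ih (by omega)) (mul_mem_evenAlg (by omega) (by omega))

end Clifford


/-! ### Modules over the even Clifford algebras -/

section Module

variable {m : ℕ} {T : Type*} [NormedAddCommGroup T] [NormedSpace ℂ T]
  {γ : Cl m →ₐ[ℝ] Module.End ℂ T}

theorem γ_mul (x y : Cl m) (t : T) : γ (x * y) t = γ x (γ y t) := by rw [map_mul]; rfl

/-- `R` is invariant under the even Clifford algebra of `e_1, …, e_r`. -/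
def EvenInv (γ : Cl m →ₐ[ℝ] Module.End ℂ T) (r : ℕ) (R : Submodule ℂ T) : Prop :=
  ∀ a ≤ r, ∀ b ≤ r, ∀ x ∈ R, γ (e m a * e m b) x ∈ R

/-- `R` is an irreducible module over the even Clifford algebra of `e_1, …, e_r`. -/
def EvenIrr (γ : Cl m →ₐ[ℝ] Module.End ℂ T) (r : ℕ) (R : Submodule ℂ T) : Prop :=
  R ≠ ⊥ ∧ EvenInv γ r R ∧ ∀ W ≤ R, EvenInv γ r W → W ≠ ⊥ → W = R

theorem EvenInv.apply_mem {r : ℕ} {R : Submodule ℂ T} (h : EvenInv γ r R) {x : Cl m}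
    (hx : x ∈ evenAlg m r) {t : T} (ht : t ∈ R) : γ x t ∈ R := by
  induction hx using Algebra.adjoin_induction generalizing t with
  | mem x hx =>
    obtain ⟨a, ha, b, hb, rfl⟩ := hx
    exact h a ha b hb t ht
  | algebraMap c =>
    rw [AlgHom.commutes, Module.algebraMap_end_apply]
    exact R.smul_of_tower_mem c ht
  | add x y _ _ hx hy =>
    rw [map_add]; exact R.add_mem (hx ht) (hy ht)
  | mul x y _ _ hx hy => rw [γ_mul]; exact hx (hy ht)

theorem EvenInv.mono {r r' : ℕ} (h : r ≤ r') {R : Submodule ℂ T} (hR : EvenInv γ r' R) :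
    EvenInv γ r R :=
  fun a ha b hb => hR a (ha.trans h) b (hb.trans h)

theorem EvenInv.inf {r : ℕ} {R R' : Submodule ℂ T} (h : EvenInv γ r R) (h' : EvenInv γ r R') :
    EvenInv γ r (R ⊓ R') :=
  fun a ha b hb x hx => ⟨h a ha b hb x hx.1, h' a ha b hb x hx.2⟩

/-- Schur's lemma for an irreducible module over an even Clifford algebra. -/
theorem EvenIrr.exists_scalar [FiniteDimensional ℂ T] {r : ℕ} {R : Submodule ℂ T}
    (hR : EvenIrr γ r R) {A : Module.End ℂ T} (h1 : ∀ x ∈ R, A x ∈ R)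
    (h2 : ∀ a ≤ r, ∀ b ≤ r, ∀ t, A (γ (e m a * e m b) t) = γ (e m a * e m b) (A t)) :
    ∃ c : ℂ, ∀ x ∈ R, A x = c • x := by
  have : Nontrivial R := Submodule.nontrivial_iff_ne_bot.2 hR.1
  -- The eigenspace in `R` of any eigenvalue is an invariant nonzero submodule, hence everything.
  obtain ⟨c, hc⟩ := Module.End.exists_eigenvalue (A.restrict h1)
  obtain ⟨v, hv, hv0⟩ := hc.exists_hasEigenvector
  have hv' : A v = c • (v : T) := congrArg Subtype.val (Module.End.mem_eigenspace_iff.1 hv)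
  refine ⟨c, fun x hx => ?_⟩
  have := hR.2.2 (R ⊓ LinearMap.ker (A - algebraMap ℂ _ c)) inf_le_left ?_ ?_
  · rw [← this] at hx
    have h3 : A x - c • x = 0 := hx.2
    exact sub_eq_zero.1 h3
  · intro a ha b hb x hx
    refine ⟨hR.2.1 a ha b hb x hx.1, ?_⟩
    have h3 : A x - c • x = 0 := hx.2
    change A (γ (e m a * e m b) x) - c • (γ (e m a * e m b) x) = 0
    rw [h2 a ha b hb, ← map_smul, ← map_sub, h3, map_zero]
  · intro hb
    have h3 : (v : T) ∈ R ⊓ LinearMap.ker (A - algebraMap ℂ _ c) :=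
      ⟨v.2, by simp [LinearMap.mem_ker, LinearMap.sub_apply, Module.algebraMap_end_apply, hv']⟩
    rw [hb] at h3
    exact hv0 (Subtype.ext (by simpa using h3))

theorem theta_apply (p : ℕ) (t : T) : theta γ p t = (-Complex.I) ^ p • γ (vol m (2 * p)) t := rfl

theorem theta_commute {p a b : ℕ} (ha : a ≤ 2 * p) (hb : b ≤ 2 * p) (t : T) :
    theta γ p (γ (e m a * e m b) t) = γ (e m a * e m b) (theta γ p t) := by
  rw [theta_apply, theta_apply, map_smul, ← γ_mul, ← γ_mul, vol_commute_of_le ha hb]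

/-- The square of e_1...e_{2p} is (-1)^p, which the factor (-i)^p in θ is there to compensate. -/
theorem theta_theta {p : ℕ} (h : 2 * p ≤ m) (t : T) : theta γ p (theta γ p t) = t := by
  rw [theta_apply, theta_apply, map_smul, ← γ_mul, vol_sq_even h, AlgHom.commutes,
    Module.algebraMap_end_apply, smul_smul, ← pow_add, ← two_mul, pow_mul]
  have : ((-1 : ℝ) ^ p) • t = ((-1 : ℂ) ^ p) • t := by
    rw [← Complex.coe_smul]; push_cast; rfl
  rw [this, smul_smul, ← mul_pow]
  simp

/-- A product of 2p generators anticommutes with each of its own vectors and commutes with the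
vectors orthogonal to all of them. -/
theorem theta_anticommute {p a b : ℕ} (ha : a ≤ 2 * p) (hb : 2 * p < b) (t : T) :
    theta γ p (γ (e m a * e m b) t) = -γ (e m a * e m b) (theta γ p t) := by
  rw [theta_apply, theta_apply, map_smul, ← γ_mul, ← γ_mul, ← mul_assoc, vol_mul_e_of_le ha,
    smul_mul_assoc, mul_assoc, vol_mul_e_of_lt hb, pow_succ, pow_mul]
  simp [mul_assoc]

/-- The eigenspace of `θ_{2p}` for the eigenvalue `ε`. -/
def thetaEig (γ : Cl m →ₐ[ℝ] Module.End ℂ T) (p : ℕ) (ε : ℤˣ) : Submodule ℂ T :=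
  LinearMap.ker (theta γ p - algebraMap ℂ (Module.End ℂ T) ((ε : ℤ) : ℂ))

theorem mem_thetaEig {p : ℕ} {ε : ℤˣ} {t : T} :
    t ∈ thetaEig γ p ε ↔ theta γ p t = ((ε : ℤ) : ℂ) • t := by
  rw [thetaEig, LinearMap.mem_ker, LinearMap.sub_apply, Module.algebraMap_end_apply, sub_eq_zero]

theorem evenInv_thetaEig {p : ℕ} (ε : ℤˣ) : EvenInv γ (2 * p) (thetaEig γ p ε) := by
  intro a ha b hb x hx
  rw [mem_thetaEig] at hx ⊢
  rw [theta_commute ha hb, hx, map_smul]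

theorem EvenInv.theta_mem {p r : ℕ} (hp : 2 * p ≤ r) {R : Submodule ℂ T} (hR : EvenInv γ r R)
    {t : T} (ht : t ∈ R) : theta γ p t ∈ R :=
  R.smul_mem _ (hR.apply_mem (vol_even_mem hp) ht)

theorem units_int_sq (ε : ℤˣ) : ((ε : ℤ) : ℂ) * ((ε : ℤ) : ℂ) = 1 := by
  rcases Int.units_eq_one_or ε with rfl | rfl <;> simp

/-- The involution θ has eigenprojections (1 ± θ)/2, and these preserve `R` because θ lies in the
complexified even algebra. -/
theorem EvenInv.eq_sup_thetaEig {p r : ℕ} (hp : 2 * p ≤ r) (hr : r ≤ m) {R : Submodule ℂ T}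
    (hR : EvenInv γ r R) : R = ⨆ ε : ℤˣ, R ⊓ thetaEig γ p ε := by
  apply le_antisymm
  · intro t ht
    have h : ∀ ε : ℤˣ, (1 / 2 : ℂ) • (t + ((ε : ℤ) : ℂ) • theta γ p t) ∈ R ⊓ thetaEig γ p ε := by
      intro ε
      refine ⟨R.smul_mem _ (R.add_mem ht (R.smul_mem _ (hR.theta_mem hp ht))), ?_⟩
      refine mem_thetaEig.2 ?_
      rw [map_smul, map_add, map_smul, theta_theta (hp.trans hr)]
      rw [smul_comm ((ε : ℤ) : ℂ), smul_add ((ε : ℤ) : ℂ), smul_smul ((ε : ℤ) : ℂ), units_int_sq,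
        one_smul, add_comm]
    have h1 : t = (1 / 2 : ℂ) • (t + (((1 : ℤˣ) : ℤ) : ℂ) • theta γ p t) +
        (1 / 2 : ℂ) • (t + (((-1 : ℤˣ) : ℤ) : ℂ) • theta γ p t) := by
      push_cast
      module
    rw [h1]
    exact Submodule.add_mem _ (Submodule.mem_iSup_of_mem 1 (h 1))
      (Submodule.mem_iSup_of_mem (-1) (h (-1)))
  · exact iSup_le fun ε => inf_le_left

theorem disjoint_thetaEig {p : ℕ} {ε δ : ℤˣ} (h : ε ≠ δ) :
    Disjoint (thetaEig γ p ε) (thetaEig γ p δ) := by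
  rw [Submodule.disjoint_def]
  intro x hx hx'
  rw [mem_thetaEig] at hx hx'
  rw [hx, ← sub_eq_zero, ← sub_smul] at hx'
  refine (smul_eq_zero.1 hx').resolve_left fun h0 => h ?_
  rw [sub_eq_zero] at h0
  exact Units.ext (by exact_mod_cast h0)

theorem e_one_mul_sq {b : ℕ} (h1 : 1 < b) (hb : b ≤ m) :
    (e m 1 * e m b) * (e m 1 * e m b) = -1 := by
  calc _ = -((e m 1 * e m 1) * (e m b * e m b)) := by
        rw [mul_assoc, ← mul_assoc (e m b), e_anticomm (show b ≠ 1 by omega)]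
        simp [mul_assoc]
    _ = _ := by rw [e_mul_self le_rfl (by omega), e_mul_self (by omega) hb]; simp

/-- Restriction from an even to an odd number of generators stays irreducible. -/
theorem EvenIrr.of_even [FiniteDimensional ℂ T] {p : ℕ} (hp : 2 * p + 2 ≤ m) {R : Submodule ℂ T}
    (hR : EvenIrr γ (2 * p + 2) R) : EvenIrr γ (2 * p + 1) R := by
  refine ⟨hR.1, hR.2.1.mono (by omega), fun W hW hWi hW0 => hR.2.2 W hW ?_ hW0⟩
  -- The full pseudoscalar is central in the even algebra of 2p+2 generators, so it acts on `R` as a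
  -- scalar.
  obtain ⟨c, hc⟩ := hR.exists_scalar (A := γ (vol m (2 * (p + 1))))
    (fun x hx => hR.2.1.apply_mem (vol_even_mem (by omega)) hx)
    (fun a ha b hb t => by rw [← γ_mul, ← γ_mul, vol_commute_of_le (n := 2 * (p + 1)) ha hb])
  obtain ⟨k, hk, hv⟩ := vol_sq (m := m) (n := 2 * p + 1) (by omega)
  have key : ∀ a ≤ 2 * p + 1, ∀ x ∈ W, γ (e m a * e m (2 * p + 2)) x ∈ W := by
    intro a ha x hx
    -- Up to sign, a bivector with the last generator is an even element of the first 2p+1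
    -- generators times the pseudoscalar; since the latter is a scalar on `R`, invariance under 2p+1
    -- generators already suffices.
    have h1 : e m a * e m (2 * p + 2) = k • (e m a * vol m (2 * p + 1) * vol m (2 * (p + 1))) := by
      rw [show 2 * (p + 1) = 2 * p + 1 + 1 by ring, vol_succ (2 * p + 1), mul_assoc,
        ← mul_assoc (vol m _), hv, ← Algebra.smul_def, mul_smul_comm, smul_smul, hk, one_smul]
    rw [h1, map_smul, LinearMap.smul_apply, γ_mul, hc x (hW hx), map_smul]
    refine W.smul_of_tower_mem k (W.smul_mem c ?_)
    exact hWi.apply_mem (e_mul_vol_odd_mem le_rfl ha) hx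
  intro a ha b hb x hx
  by_cases ha' : a = 2 * p + 2
  · subst ha'
    by_cases hb' : b = 2 * p + 2
    · subst hb'
      rw [e_mul_self (by omega) hp]
      simpa using hx
    · rw [e_anticomm (Ne.symm hb'), map_neg]
      exact W.neg_mem (key b (by omega) x hx)
  · by_cases hb' : b = 2 * p + 2
    · subst hb'
      exact key a (by omega) x hx
    · exact hWi a (by omega) b (by omega) x hx

/-- Restriction from an odd to an even number of generators: the two eigenspaces of the
pseudoscalar are irreducible. -/
theorem EvenIrr.of_odd {p : ℕ} (hp1 : 1 ≤ p) (hp : 2 * p + 1 ≤ m)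
    {R : Submodule ℂ T} (hR : EvenIrr γ (2 * p + 1) R) (ε : ℤˣ) :
    EvenIrr γ (2 * p) (R ⊓ thetaEig γ p ε) := by
  -- τ anticommutes with θ_{2p} and so exchanges its two eigenspaces.
  set τ := e m 1 * e m (2 * p + 1) with hτ
  have hτ2 : ∀ t, γ τ (γ τ t) = -t := by
    intro t
    rw [← γ_mul, e_one_mul_sq (by omega) hp]
    simp
  have hτR : ∀ t ∈ R, γ τ t ∈ R := fun t ht => hR.2.1 _ (by omega) _ le_rfl t ht
  have hτE : ∀ δ : ℤˣ, ∀ t ∈ thetaEig γ p δ, γ τ t ∈ thetaEig γ p (-δ) := by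
    intro δ t ht
    rw [mem_thetaEig] at ht ⊢
    rw [theta_anticommute (by omega) (by omega), ht, map_smul, Units.val_neg,
      Int.cast_neg, neg_smul]
  have hinv : EvenInv γ (2 * p) R := hR.2.1.mono (by omega)
  have hinvE : EvenInv γ (2 * p) (R ⊓ thetaEig γ p ε) := hinv.inf (evenInv_thetaEig ε)
  refine ⟨?_, hinvE, ?_⟩
  · intro h0
    apply hR.1
    have h1 : ∀ δ : ℤˣ, R ⊓ thetaEig γ p δ = ⊥ := by
      intro δ
      by_cases h : δ = ε
      · rw [h, h0]
      · have h' : -δ = ε := by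
          rcases Int.units_eq_one_or δ with rfl | rfl <;>
            rcases Int.units_eq_one_or ε with rfl | rfl <;> simp_all
        rw [eq_bot_iff]
        intro t ht
        have : γ τ t ∈ R ⊓ thetaEig γ p ε := ⟨hτR t ht.1, h' ▸ hτE δ t ht.2⟩
        rw [h0, Submodule.mem_bot] at this
        have h2 := hτ2 t
        rw [this, map_zero] at h2
        simpa using h2.symm
    rw [hR.2.1.eq_sup_thetaEig (p := p) (by omega) hp]
    simp [h1]
  · intro W hW hWi hW0
    have hswap : ∀ a ≤ 2 * p, ∀ x ∈ W, γ (e m a * e m 1) x ∈ W := fun a ha x hx =>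
      hWi a ha 1 (by omega) x hx
    have hgen : ∀ a ≤ 2 * p, e m a * e m (2 * p + 1) = -(e m a * e m 1) * τ := by
      intro a ha
      calc e m a * e m (2 * p + 1) = -(e m a * (e m 1 * e m 1) * e m (2 * p + 1)) := by
            rw [e_mul_self le_rfl (by omega)]; simp
        _ = _ := by simp [mul_assoc, hτ]
    have hcomm : ∀ a ≤ 2 * p, ∀ b ≤ 2 * p, e m a * e m b * τ =
        τ * (-(e m 1 * e m a) * (e m b * e m 1)) := by
      intro a ha b hb
      have h2 := commute_evenAlg (m := m) (i := 2 * p + 1) (by omega)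
        (mul_mem (mul_mem_evenAlg (m := m) (show 1 ≤ 2 * p by omega) ha)
          (mul_mem_evenAlg hb (show 1 ≤ 2 * p by omega)))
      have h3 : τ * (-(e m 1 * e m a) * (e m b * e m 1)) =
          -(e m 1 * (e m (2 * p + 1) * ((e m 1 * e m a) * (e m b * e m 1)))) := by
        simp [hτ, mul_assoc]
      rw [h3, ← h2]
      calc e m a * e m b * τ = -((e m 1 * e m 1) * (e m a * e m b * τ)) := by
            rw [e_mul_self le_rfl (by omega)]; simp
        _ = _ := by simp only [hτ, mul_assoc]
    -- W + τW is invariant under all 2p+1 generators, hence equal to `R`; its part in the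
    -- ε-eigenspace is `W`, since τW lies in the opposite one.
    set W' := W ⊔ W.map (γ τ) with hW'
    have hW'R : W' ≤ R := by
      refine sup_le (hW.trans inf_le_left) ?_
      rintro _ ⟨x, hx, rfl⟩
      exact hτR x (hW hx).1
    have hτW' : ∀ x ∈ W', γ τ x ∈ W' := by
      intro x hx
      obtain ⟨u, hu, _, ⟨w, hw, rfl⟩, rfl⟩ := Submodule.mem_sup.1 hx
      rw [map_add, hτ2, add_comm]
      exact Submodule.add_mem_sup (W.neg_mem hw) ⟨u, hu, rfl⟩
    have hW'i : EvenInv γ (2 * p) W' := by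
      intro a ha b hb x hx
      obtain ⟨u, hu, _, ⟨w, hw, rfl⟩, rfl⟩ := Submodule.mem_sup.1 hx
      rw [map_add]
      refine Submodule.add_mem_sup (hWi a ha b hb u hu) ⟨γ (-(e m 1 * e m a) * (e m b * e m 1)) w,
        ?_, ?_⟩
      · rw [γ_mul, map_neg]
        exact W.neg_mem (hWi _ (by omega) _ ha _ (hWi _ hb _ (by omega) _ hw))
      · rw [← γ_mul, ← γ_mul, hcomm a ha b hb]
    have key : EvenInv γ (2 * p + 1) W' := by
      have key1 : ∀ a ≤ 2 * p, ∀ x ∈ W', γ (e m a * e m (2 * p + 1)) x ∈ W' := by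
        intro a ha x hx
        rw [hgen a ha, γ_mul, map_neg]
        exact W'.neg_mem (hW'i a ha 1 (by omega) _ (hτW' x hx))
      intro a ha b hb x hx
      by_cases ha' : a = 2 * p + 1
      · subst ha'
        by_cases hb' : b = 2 * p + 1
        · subst hb'
          rw [e_mul_self (by omega) hp]
          simpa using hx
        · rw [e_anticomm (Ne.symm hb'), map_neg]
          exact W'.neg_mem (key1 b (by omega) x hx)
      · by_cases hb' : b = 2 * p + 1
        · subst hb'
          exact key1 a (by omega) x hx
        · exact hW'i a (by omega) b (by omega) x hx
    have hW'eq := hR.2.2 W' hW'R key fun h0 => hW0 (eq_bot_iff.2 (le_sup_left.trans h0.le))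
    refine le_antisymm hW fun x hx => ?_
    have hx' : x ∈ W' := by rw [hW'eq]; exact hx.1
    obtain ⟨u, hu, _, ⟨w, hw, rfl⟩, rfl⟩ := Submodule.mem_sup.1 hx'
    have h1 : γ τ w ∈ thetaEig γ p ε := by
      have := (thetaEig γ p ε).sub_mem hx.2 (hW hu).2
      simpa using this
    have h2 : γ τ w ∈ thetaEig γ p (-ε) := hτE ε w (hW hw).2
    have h3 := Submodule.disjoint_def.1 (disjoint_thetaEig (γ := γ) (p := p)
      (show ε ≠ -ε by rcases Int.units_eq_one_or ε with rfl | rfl <;> decide)) _ h1 h2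
    rw [h3, add_zero]
    exact hu

/-- A module over the even Clifford algebra of the plane is irreducible only if it is a line. -/
theorem EvenIrr.eq_span [FiniteDimensional ℂ T] (hm : 2 ≤ m) {R : Submodule ℂ T}
    (hR : EvenIrr γ 2 R) :
    ∃ ε : ℤˣ, R ≤ thetaEig γ 1 ε ∧ ∀ v ∈ R, v ≠ 0 → R = Submodule.span ℂ {v} := by
  have hcomm : ∀ a ≤ 2, ∀ b ≤ 2, ∀ t, theta γ 1 (γ (e m a * e m b) t) =
      γ (e m a * e m b) (theta γ 1 t) := fun a ha b hb t => theta_commute (by omega) (by omega) t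
  obtain ⟨c, hc⟩ := hR.exists_scalar (A := theta γ 1)
    (fun x hx => hR.2.1.theta_mem le_rfl hx) hcomm
  obtain ⟨v₀, hv₀, hv₀0⟩ := Submodule.exists_mem_ne_zero_of_ne_bot hR.1
  have hc2 : c * c = 1 := by
    have := theta_theta (γ := γ) (p := 1) (by omega) v₀
    rw [hc v₀ hv₀, map_smul, hc v₀ hv₀, smul_smul] at this
    have h2 : (c * c - 1) • v₀ = 0 := by rw [sub_smul, this, one_smul, sub_self]
    exact sub_eq_zero.1 ((smul_eq_zero.1 h2).resolve_right hv₀0)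
  have hcε : ∃ ε : ℤˣ, c = ((ε : ℤ) : ℂ) := by
    rcases mul_self_eq_one_iff.1 hc2 with rfl | rfl
    · exact ⟨1, by simp⟩
    · exact ⟨-1, by simp⟩
  obtain ⟨ε, rfl⟩ := hcε
  refine ⟨ε, fun x hx => mem_thetaEig.2 (hc x hx), fun v hv hv0 => ?_⟩
  -- Apart from real scalars, e_1 e_2 is the only generator of the even algebra of the plane. It
  -- acts on `R` as the scalar iε, so every line in `R` is invariant.
  have h12 : ∀ x ∈ R, ∃ d : ℂ, γ (e m 1 * e m 2) x = d • x := by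
    intro x hx
    refine ⟨Complex.I * ((ε : ℤ) : ℂ), ?_⟩
    have := hc x hx
    rw [theta_apply] at this
    have h2 : vol m (2 * 1) = e m 1 * e m 2 := by
      simp [vol, List.range']
    rw [h2, pow_one] at this
    rw [mul_smul, ← this, smul_smul]
    simp
  refine (hR.2.2 _ ((Submodule.span_singleton_le_iff_mem v R).2 hv) ?_ ?_).symm
  · intro a ha b hb x hx
    obtain ⟨d, hd⟩ := h12 x ((Submodule.span_singleton_le_iff_mem v R).2 hv hx)
    interval_cases a <;> interval_cases b
    · simp [e_zero]
    · simp [e_zero]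
    · simp [e_zero]
    · simp [e_zero]
    · rw [e_mul_self le_rfl (by omega)]; simpa using hx
    · rw [hd]; exact Submodule.smul_mem _ _ hx
    · simp [e_zero]
    · rw [e_anticomm (by decide), map_neg, LinearMap.neg_apply, hd]
      exact Submodule.neg_mem _ (Submodule.smul_mem _ _ hx)
    · rw [e_mul_self (by omega) hm]; simpa using hx
  · rw [Ne, Submodule.span_singleton_eq_bot]; exact hv0

/-- An irreducible representation of `Spin(m)` is an irreducible module over the even Clifford
algebra. -/
theorem evenIrr_of_isIrreducible (S : Subrepresentation (spinRep γ))
    (hS : S.toRepresentation.IsIrreducible) : EvenIrr γ m S.toSubmodule := by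
  have hspin : ∀ W : Submodule ℂ T, EvenInv γ m W → ∀ s : Spin m, ∀ x ∈ W, γ (s : Cl m) x ∈ W :=
    fun W hW s x hx => hW.apply_mem (even_mem_evenAlg (spinGroup.mem_even s.2)) hx
  refine ⟨?_, ?_, ?_⟩
  · intro h0
    obtain ⟨a, b, hab⟩ := hS.toNontrivial
    apply hab
    ext x
    have : x = 0 := by
      have h1 : (x : T) ∈ (⊥ : Submodule ℂ T) := h0 ▸ x.2
      exact Subtype.ext (by simpa using h1)
    subst this
    exact ⟨fun _ => b.toSubmodule.zero_mem, fun _ => a.toSubmodule.zero_mem⟩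
  · intro a ha b hb x hx
    rcases Nat.eq_zero_or_pos a with rfl | ha1
    · simp [e_zero]
    rcases Nat.eq_zero_or_pos b with rfl | hb1
    · simp [e_zero]
    -- The generators e_a e_b of the even algebra are themselves elements of Spin(m), including -1
    -- when a = b.
    exact S.apply_mem_toSubmodule (bvPair m ⟨ha1, ha⟩ ⟨hb1, hb⟩) hx
  · intro W hW hWi hW0
    let τ : Subrepresentation S.toRepresentation :=
      { toSubmodule := W.comap S.toSubmodule.subtype
        apply_mem_toSubmodule := fun s x hx => hspin W hWi s x hx }
    rcases hS.eq_bot_or_eq_top τ with h1 | h1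
    · exfalso
      apply hW0
      rw [eq_bot_iff]
      intro x hx
      have : (⟨x, hW hx⟩ : S.toSubmodule) ∈ τ.toSubmodule := hx
      rw [h1] at this
      have h2 : (⟨x, hW hx⟩ : S.toSubmodule) = 0 := this
      simpa using congrArg Subtype.val h2
    · refine le_antisymm hW fun x hx => ?_
      have : (⟨x, hx⟩ : S.toSubmodule) ∈ τ.toSubmodule := by
        rw [h1]; exact Submodule.mem_top
      exact this

/-! ### Invariant inner products on spinors -/

/-- Pullback of an inner product along an injective linear map. -/
abbrev coreComap {V V' : Type*} [AddCommGroup V] [Module ℂ V] [AddCommGroup V'] [Module ℂ V']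
    (c : InnerProductSpace.Core ℂ V) (f : V' →ₗ[ℂ] V) (hf : Function.Injective f) :
    InnerProductSpace.Core ℂ V' where
  inner x y := c.inner (f x) (f y)
  conj_inner_symm x y := c.conj_inner_symm _ _
  re_inner_nonneg x := c.re_inner_nonneg _
  add_left x y z := by rw [map_add]; exact c.add_left _ _ _
  smul_left x y r := by rw [map_smul]; exact c.smul_left _ _ _
  definite x hx := by
    have := c.definite _ hx
    exact hf (by rw [this, map_zero])

/-- The sum of an inner product and its transform under a linear map. -/
abbrev coreAdd {V : Type*} [AddCommGroup V] [Module ℂ V]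
    (c : InnerProductSpace.Core ℂ V) (f : V →ₗ[ℂ] V) :
    InnerProductSpace.Core ℂ V where
  inner x y := c.inner x y + c.inner (f x) (f y)
  conj_inner_symm x y := by
    rw [map_add]
    exact congrArg₂ (· + ·) (c.conj_inner_symm _ _) (c.conj_inner_symm _ _)
  re_inner_nonneg x := by
    rw [map_add]; exact add_nonneg (c.re_inner_nonneg _) (c.re_inner_nonneg _)
  add_left x y z := by
    rw [map_add, c.add_left, c.add_left]; ring
  smul_left x y r := by
    rw [map_smul, c.smul_left, c.smul_left]; ring
  definite x hx := by
    apply c.definite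
    have h1 := congrArg Complex.re hx
    rw [Complex.add_re] at h1
    have h2 : 0 ≤ (c.inner x x).re := c.re_inner_nonneg x
    have h3 : 0 ≤ (c.inner (f x) (f x)).re := c.re_inner_nonneg (f x)
    have h4 : (c.inner x x).im = 0 := by
      have := congrArg Complex.im (c.conj_inner_symm x x)
      rw [Complex.conj_im] at this
      linarith
    apply Complex.ext
    · simp at h1; simp; linarith
    · simpa using h4

/-- Averaging one generator at a time: adding the transform under e_{n+1} gives invariance under it
because e_{n+1}² = -1, and anticommutation keeps the invariances obtained before. -/
theorem exists_core_e_invariant [FiniteDimensional ℂ T] (γ : Cl m →ₐ[ℝ] Module.End ℂ T) :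
    ∃ c : InnerProductSpace.Core ℂ T, ∀ i, 1 ≤ i → i ≤ m →
      ∀ x y, c.inner (γ (e m i) x) (γ (e m i) y) = c.inner x y := by
  have key : ∀ n ≤ m, ∃ c : InnerProductSpace.Core ℂ T, ∀ i, 1 ≤ i → i ≤ n →
      ∀ x y, c.inner (γ (e m i) x) (γ (e m i) y) = c.inner x y := by
    intro n hn
    induction n with
    | zero =>
      let b := Module.finBasis ℂ T
      let F : T →ₗ[ℂ] EuclideanSpace ℂ (Fin (Module.finrank ℂ T)) :=
        (WithLp.linearEquiv 2 ℂ (Fin (Module.finrank ℂ T) → ℂ)).symm.toLinearMap.comp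
          b.equivFun.toLinearMap
      have hF : Function.Injective F :=
        (WithLp.linearEquiv 2 ℂ (Fin (Module.finrank ℂ T) → ℂ)).symm.injective.comp
          b.equivFun.injective
      let c0 : InnerProductSpace.Core ℂ (EuclideanSpace ℂ (Fin (Module.finrank ℂ T))) :=
        { inner := fun x y => inner ℂ x y
          conj_inner_symm := fun x y => inner_conj_symm _ _
          re_inner_nonneg := fun x => inner_self_nonneg
          add_left := fun x y z => inner_add_left _ _ _
          smul_left := fun x y r => inner_smul_left _ _ _
          definite := fun x hx => inner_self_eq_zero.1 hx }
      exact ⟨coreComap c0 F hF, fun i h1 h2 => absurd h2 (by omega)⟩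
    | succ n ih =>
      obtain ⟨c, hc⟩ := ih (by omega)
      have hneg : ∀ x y, c.inner (-x) (-y) = c.inner x y := by
        intro x y
        have h1 : ∀ x y, c.inner (-x) y = -c.inner x y := by
          intro x y
          have := c.smul_left x y (-1)
          simpa using this
        rw [h1, ← c.conj_inner_symm, h1, map_neg, neg_neg, c.conj_inner_symm]
      refine ⟨coreAdd c (γ (e m (n + 1))), fun i h1 h2 x y => ?_⟩
      change c.inner _ _ + c.inner _ _ = c.inner _ _ + c.inner _ _
      by_cases h : i = n + 1
      · subst h
        rw [← γ_mul, ← γ_mul, e_mul_self h1 hn]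
        simp only [map_neg, map_one, LinearMap.neg_apply, Module.End.one_apply]
        rw [hneg, add_comm]
      · rw [← γ_mul, ← γ_mul, e_anticomm (Ne.symm h), map_neg, LinearMap.neg_apply,
          LinearMap.neg_apply, hneg, γ_mul, γ_mul, hc i h1 (by omega), hc i h1 (by omega)]
  exact key m le_rfl

/-- Invariance under e_i and e_i² = -1 mean that e_i has adjoint -e_i. Hence the adjoint of the
action of any a is the action of `star a`, and spin elements satisfy `star s * s = 1`. -/
theorem exists_core_spin_invariant [FiniteDimensional ℂ T] (γ : Cl m →ₐ[ℝ] Module.End ℂ T) :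
    ∃ c : InnerProductSpace.Core ℂ T, ∀ (s : Spin m) x y,
      c.inner (γ (s : Cl m) x) (γ (s : Cl m) y) = c.inner x y := by
  obtain ⟨c, hc⟩ := exists_core_e_invariant γ
  have hadd : ∀ x y z, c.inner x (y + z) = c.inner x y + c.inner x z := by
    intro x y z
    rw [← c.conj_inner_symm, c.add_left, map_add, c.conj_inner_symm, c.conj_inner_symm]
  have hsmul : ∀ x y (r : ℝ), c.inner x (r • y) = r * c.inner x y := by
    intro x y r
    rw [← c.conj_inner_symm, ← Complex.coe_smul, c.smul_left, map_mul, c.conj_inner_symm]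
    simp
  have hsmul' : ∀ x y (r : ℝ), c.inner (r • x) y = r * c.inner x y := by
    intro x y r
    rw [← Complex.coe_smul, c.smul_left]
    simp
  have hadj : ∀ (a : Cl m) x y, c.inner (γ a x) y = c.inner x (γ (star a) y) := by
    intro a
    induction a using CliffordAlgebra.induction with
    | algebraMap r =>
      intro x y
      rw [star_algebraMap, AlgHom.commutes, Module.algebraMap_end_apply,
        Module.algebraMap_end_apply, hsmul, hsmul']
    | ι v =>
      intro x y
      have hei : ∀ i, 1 ≤ i → i ≤ m → c.inner (γ (e m i) x) y = c.inner x (γ (-e m i) y) := by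
        intro i h1 h2
        rw [← hc i h1 h2 x, ← γ_mul, mul_neg, e_mul_self h1 h2]
        simp
      rw [star_ι, ι_eq_sum, ← Finset.sum_neg_distrib]
      have : ∀ s ⊆ Finset.Icc 1 m, c.inner (γ (∑ i ∈ s, crd i v • e m i) x) y =
          c.inner x (γ (∑ i ∈ s, -(crd i v • e m i)) y) := by
        intro s
        induction s using Finset.induction_on with
        | empty =>
          intro _
          have h1 := hsmul x 0 0
          have h2 := hsmul' 0 y 0
          simp at h1 h2
          simp [h1, h2]
        | insert a s ha ih =>
          intro hs
          have h1 := hs (Finset.mem_insert_self a s)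
          rw [Finset.mem_Icc] at h1
          rw [Finset.sum_insert ha, Finset.sum_insert ha, map_add, map_add, LinearMap.add_apply,
            LinearMap.add_apply, hadd, c.add_left,
            ih ((Finset.subset_insert _ _).trans hs), ← smul_neg, map_smul, map_smul,
            LinearMap.smul_apply, LinearMap.smul_apply, hsmul, hsmul', hei a h1.1 h1.2]
      exact this _ subset_rfl
    | mul a b ha hb =>
      intro x y
      rw [γ_mul, ha, hb, star_mul, γ_mul]
    | add a b ha hb =>
      intro x y
      rw [map_add, LinearMap.add_apply, c.add_left, ha, hb, star_add, map_add,
        LinearMap.add_apply, hadd]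
  refine ⟨c, fun s x y => ?_⟩
  rw [hadj, ← γ_mul, spinGroup.star_mul_self_of_mem s.2]
  simp

theorem exists_isInvariantInner_spinor [FiniteDimensional ℂ T]
    (S : Subrepresentation (spinRep γ)) :
    ∃ b : S.toSubmodule → S.toSubmodule → ℂ, IsInvariantInner S.toRepresentation b := by
  obtain ⟨c, hc⟩ := exists_core_spin_invariant γ
  refine ⟨fun x y => c.inner (x : T) (y : T), ⟨coreComap c S.toSubmodule.subtype
    S.toSubmodule.injective_subtype, fun x y => rfl⟩, fun s x y => hc s x y⟩

end Module


/-! ### Calculus of homogeneous polynomials -/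

section Calculus

variable {m : ℕ} {F : Type*} [NormedAddCommGroup F] [NormedSpace ℝ F]

theorem pd_add {P Q : E m → F} (hP : Differentiable ℝ P) (hQ : Differentiable ℝ Q) (i : ℕ) :
    pd i (P + Q) = pd i P + pd i Q := by
  ext x
  simp [pd, fderiv_add (hP x) (hQ x)]

theorem pd_sub {P Q : E m → F} (hP : Differentiable ℝ P) (hQ : Differentiable ℝ Q) (i : ℕ) :
    pd i (P - Q) = pd i P - pd i Q := by
  ext x
  simp [pd, fderiv_sub (hP x) (hQ x)]

theorem pd_zero (i : ℕ) : pd i (0 : E m → F) = 0 := by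
  ext x; simp [pd]

theorem pd_const (i : ℕ) (s : F) : pd i (fun _ : E m => s) = 0 := by
  ext x; simp [pd]

theorem pd_sum {κ : Type*} (t : Finset κ) {P : κ → E m → F} (hP : ∀ a, Differentiable ℝ (P a))
    (i : ℕ) : pd i (∑ a ∈ t, P a) = ∑ a ∈ t, pd i (P a) := by
  ext x
  simp only [pd, Finset.sum_apply]
  rw [fderiv_sum (fun a _ => hP a x)]
  simp

theorem pd_smul {𝕜 : Type*} [NontriviallyNormedField 𝕜] [NormedAlgebra ℝ 𝕜] [NormedSpace 𝕜 F]
    [IsScalarTower ℝ 𝕜 F] {P : E m → F} (hP : Differentiable ℝ P) (i : ℕ) (c : 𝕜) :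
    pd i (c • P) = c • pd i P := by
  ext x
  simp [pd, fderiv_const_smul (hP x)]

theorem pd_mul_smul {f : E m → ℝ} {P : E m → F} (hf : Differentiable ℝ f)
    (hP : Differentiable ℝ P) (i : ℕ) (x : E m) :
    pd i (fun x => f x • P x) x = f x • pd i P x + pd i f x • P x := by
  simp only [pd]
  rw [fderiv_fun_smul (hf x) (hP x)]
  simp

theorem differentiable_crd (i : ℕ) : Differentiable ℝ (crd i : E m → ℝ) :=
  (innerSL ℝ (bv m i)).differentiable

theorem contDiff_crd {n : WithTop ℕ∞} (i : ℕ) : ContDiff ℝ n (crd i : E m → ℝ) :=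
  (innerSL ℝ (bv m i)).contDiff

theorem pd_crd (i j : ℕ) (x : E m) :
    pd i (crd j) x = if j = i ∧ 1 ≤ j ∧ j ≤ m then 1 else 0 := by
  have : (crd j : E m → ℝ) = innerSL ℝ (bv m j) := rfl
  rw [pd, this, ContinuousLinearMap.fderiv, ← inner_bv]
  rfl

theorem fderiv_eq_sum {P : E m → F} (x v : E m) :
    fderiv ℝ P x v = ∑ i ∈ Finset.Icc 1 m, crd i v • pd i P x := by
  conv_lhs => rw [← sum_crd_smul_bv v]
  simp [pd]

theorem pd_of_lt {i : ℕ} (h : m < i) (P : E m → F) : pd i P = 0 := by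
  ext x; simp [pd, bv_of_lt h]

theorem pd_comm {P : E m → F} (hP : ContDiff ℝ 2 P) (i j : ℕ) :
    pd i (pd j P) = pd j (pd i P) := by
  ext x
  have h1 : Differentiable ℝ (fderiv ℝ P) :=
    (hP.fderiv_right (m := 1) (by norm_num)).differentiable (by norm_num)
  have h2 : ∀ i j, pd i (pd j P) x = fderiv ℝ (fderiv ℝ P) x (bv m i) (bv m j) := by
    intro i j
    change fderiv ℝ (fun y => fderiv ℝ P y (bv m j)) x (bv m i) = _
    rw [fderiv_clm_apply (h1 x) (differentiableAt_const _)]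
    simp
  rw [h2, h2]
  exact (hP.contDiffAt.isSymmSndFDerivAt (by simp [minSmoothness_of_isRCLikeNormedField])) _ _

/-- A function whose derivatives in the directions `e_{r+1}, …, e_m` vanish depends only on the
first `r` variables. -/
theorem eq_of_crd_eq {P : E m → F} (hP : Differentiable ℝ P) {r : ℕ}
    (h : ∀ i, r < i → pd i P = 0) {x y : E m} (hxy : ∀ i, 1 ≤ i → i ≤ r → crd i x = crd i y) :
    P x = P y := by
  have hd : ∀ t : ℝ, HasDerivAt (fun t : ℝ => P (x + t • (y - x))) 0 t := by
    intro t
    have h1 : HasDerivAt (fun t : ℝ => x + t • (y - x)) (y - x) t := by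
      simpa using ((hasDerivAt_id t).smul_const (y - x)).const_add x
    have h2 := (hP (x + t • (y - x))).hasFDerivAt.comp_hasDerivAt t h1
    have h3 : fderiv ℝ P (x + t • (y - x)) (y - x) = 0 := by
      rw [fderiv_eq_sum]
      refine Finset.sum_eq_zero fun i hi => ?_
      rw [Finset.mem_Icc] at hi
      by_cases hir : i ≤ r
      · have : crd i (y - x) = 0 := by
          simp only [crd, inner_sub_right]
          have := hxy i hi.1 hir
          simp only [crd] at this
          rw [this, sub_self]
        rw [this, zero_smul]
      · rw [h i (not_le.1 hir)]; simp
    rwa [h3] at h2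
  have := is_const_of_deriv_eq_zero (fun t => (hd t).differentiableAt) (fun t => (hd t).deriv) 0 1
  simpa using this

end Calculus

/-! ### Homogeneous polynomials: induction on the degree, derivatives, Euler's identity. -/

section HomogPoly

variable {m : ℕ} {T : Type*} [NormedAddCommGroup T] [NormedSpace ℂ T]

theorem pd_linear [FiniteDimensional ℂ T] {P : E m → T} (hP : Differentiable ℝ P) (A : T →ₗ[ℂ] T)
    (i : ℕ) (x : E m) : pd i (fun x => A (P x)) x = A (pd i P x) := by
  have h4 := ((LinearMap.toContinuousLinearMap A).restrictScalars ℝ).hasFDerivAt (x := P x)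
  have h5 := h4.comp x (hP x).hasFDerivAt
  have h6 : (fun x => A (P x)) =
      ((LinearMap.toContinuousLinearMap A).restrictScalars ℝ) ∘ P := rfl
  rw [pd, h6, h5.fderiv]
  rfl

theorem differentiable_linear [FiniteDimensional ℂ T] {P : E m → T} (hP : Differentiable ℝ P)
    (A : T →ₗ[ℂ] T) : Differentiable ℝ fun x => A (P x) :=
  ((LinearMap.toContinuousLinearMap A).restrictScalars ℝ).differentiable.comp hP

/-- Polynomials are built by one coordinate factor at a time with the degree visible to the
predicate, which replaces multi-index computations in what follows. -/
theorem homogPoly_induction {R : Submodule ℂ T} {p : ℕ → (E m → T) → Prop}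
    (const : ∀ s ∈ R, p 0 fun _ => s)
    (mul : ∀ k P (i : ℕ), 1 ≤ i → i ≤ m → P ∈ homogPoly m R k → p k P →
      p (k + 1) fun x => crd i x • P x)
    (zero : ∀ k, p k 0)
    (add : ∀ k P Q, P ∈ homogPoly m R k → Q ∈ homogPoly m R k → p k P → p k Q → p k (P + Q))
    (smul : ∀ k (c : ℂ) P, P ∈ homogPoly m R k → p k P → p k (c • P))
    {k : ℕ} {P : E m → T} (hP : P ∈ homogPoly m R k) : p k P := by
  induction hP using Submodule.span_induction with
  | mem P h =>
    obtain ⟨α, hα, s, hs, rfl⟩ := h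
    induction k generalizing α with
    | zero =>
      have h0 : ∀ i, α i = 0 := by simpa using hα
      simpa [h0] using const s hs
    | succ k ih =>
      have : ∃ i, 0 < α i := by
        by_contra! hcon
        have : ∑ i, α i = 0 := Finset.sum_eq_zero fun i _ => Nat.le_zero.1 (hcon i)
        omega
      obtain ⟨i, hi⟩ := this
      have hα' : α = Function.update α i (α i - 1) + Pi.single i 1 := by
        ext j
        by_cases hj : j = i
        · subst hj; simp; omega
        · simp [hj]
      set β := Function.update α i (α i - 1) with hβ
      have hβk : ∑ i, β i = k := by
        have h1 : ∑ j, α j = ∑ j, β j + 1 := by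
          conv_lhs => rw [hα']
          simp [Finset.sum_add_distrib]
        omega
      have h2 := mul k _ (i + 1) (by omega) (by omega)
        (Submodule.subset_span ⟨β, hβk, s, hs, rfl⟩) (ih β hβk)
      convert h2 using 1
      ext x
      rw [crd_succ, ← Complex.coe_smul, smul_smul, ← Complex.ofReal_mul]
      congr 2
      conv_lhs => rw [hα']
      simp only [Pi.add_apply, pow_add, Finset.prod_mul_distrib]
      rw [mul_comm]
      congr 1
      rw [Finset.prod_eq_single i] <;> simp +contextual
  | zero => exact zero k
  | add P Q hP hQ h1 h2 => exact add k P Q hP hQ h1 h2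
  | smul c P hP h => exact smul k c P hP h

theorem homogPoly_crd_smul {R : Submodule ℂ T} {k : ℕ} {P : E m → T} (hP : P ∈ homogPoly m R k)
    (i : ℕ) : (fun x => crd i x • P x) ∈ homogPoly m R (k + 1) := by
  by_cases h : 1 ≤ i ∧ i ≤ m
  · have := homogPoly_coord_smul hP ⟨i - 1, by omega⟩
    convert this using 1
    ext x
    rw [Complex.coe_smul, ← crd_succ]
    simp [show i - 1 + 1 = i by omega]
  · have h0 : ∀ x : E m, crd i x = 0 := by
      intro x
      rcases Nat.eq_zero_or_pos i with rfl | hi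
      · simp [crd, bv_zero]
      · simp [crd, bv_of_lt (show m < i by omega)]
    simp only [h0, zero_smul]
    exact Submodule.zero_mem _

theorem homogPoly_const {R : Submodule ℂ T} {s : T} (hs : s ∈ R) :
    (fun _ => s) ∈ homogPoly m R 0 :=
  Submodule.subset_span ⟨0, by simp, s, hs, by simp⟩

theorem homogPoly_mono {R R' : Submodule ℂ T} (h : R ≤ R') (k : ℕ) :
    homogPoly m R k ≤ homogPoly m R' k :=
  Submodule.span_mono fun _ ⟨α, hα, s, hs, hP⟩ => ⟨α, hα, s, h hs, hP⟩

theorem homogPoly_contDiff {R : Submodule ℂ T} {k : ℕ} {n : WithTop ℕ∞} {P : E m → T}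
    (hP : P ∈ homogPoly m R k) : ContDiff ℝ n P := by
  refine homogPoly_induction (p := fun _ P => ContDiff ℝ n P) (fun s _ => contDiff_const)
    (fun k P i _ _ _ h => (contDiff_crd i).smul h) (fun _ => contDiff_const)
    (fun k P Q _ _ h1 h2 => h1.add h2) (fun k c P _ h => h.const_smul c) hP

/-- The second clause is needed because `k - 1` truncates: in degree zero the derivative is not
merely a constant but zero, and the induction step uses this. -/
theorem pd_mem_homogPoly {R : Submodule ℂ T} {k : ℕ} {P : E m → T} (hP : P ∈ homogPoly m R k)
    (i : ℕ) : pd i P ∈ homogPoly m R (k - 1) ∧ (k = 0 → pd i P = 0) := by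
  refine homogPoly_induction (p := fun k P => pd i P ∈ homogPoly m R (k - 1) ∧ (k = 0 → pd i P = 0))
    ?_ ?_ ?_ ?_ ?_ hP
  · intro s hs
    rw [pd_const]
    exact ⟨Submodule.zero_mem _, fun _ => rfl⟩
  · intro k P j hj1 hj2 hP ih
    refine ⟨?_, by simp⟩
    have h1 : pd i (fun x => crd j x • P x) = (fun x => crd j x • pd i P x) +
        if j = i then P else 0 := by
      ext x
      rw [pd_mul_smul (differentiable_crd j) (homogPoly_differentiable hP), pd_crd]
      by_cases h : j = i <;> simp [h]
      intro h; omega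
    rw [h1, Nat.add_sub_cancel]
    refine Submodule.add_mem _ ?_ ?_
    · rcases Nat.eq_zero_or_pos k with h | h
      · simp only [ih.2 h, Pi.zero_apply, smul_zero]; exact Submodule.zero_mem _
      · have := homogPoly_crd_smul ih.1 j
        rwa [Nat.sub_add_cancel h] at this
    · split_ifs
      · exact hP
      · exact Submodule.zero_mem _
  · intro k
    rw [pd_zero]
    exact ⟨Submodule.zero_mem _, fun _ => rfl⟩
  · intro k P Q hP hQ h1 h2
    rw [pd_add (homogPoly_differentiable hP) (homogPoly_differentiable hQ)]
    exact ⟨Submodule.add_mem _ h1.1 h2.1, fun h => by rw [h1.2 h, h2.2 h, add_zero]⟩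
  · intro k c P hP h1
    rw [pd_smul (homogPoly_differentiable hP)]
    exact ⟨Submodule.smul_mem _ _ h1.1, fun h => by rw [h1.2 h, smul_zero]⟩

/-- Euler's identity. -/
theorem homogPoly_euler {R : Submodule ℂ T} {k : ℕ} {P : E m → T} (hP : P ∈ homogPoly m R k)
    (x : E m) : ∑ i ∈ Finset.Icc 1 m, crd i x • pd i P x = (k : ℝ) • P x := by
  refine homogPoly_induction
    (p := fun k P => ∑ i ∈ Finset.Icc 1 m, crd i x • pd i P x = (k : ℝ) • P x) ?_ ?_ ?_ ?_ ?_ hP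
  · intro s hs
    simp [pd_const]
  · intro k P j hj1 hj2 hP ih
    have h1 : ∀ i, pd i (fun x => crd j x • P x) x = crd j x • pd i P x +
        (if j = i then 1 else 0 : ℝ) • P x := by
      intro i
      rw [pd_mul_smul (differentiable_crd j) (homogPoly_differentiable hP), pd_crd]
      simp [hj1, hj2]
    simp only [h1, smul_add, Finset.sum_add_distrib]
    simp only [smul_comm (crd _ x) (crd j x), ← Finset.smul_sum]
    rw [ih]
    simp only [ite_smul, one_smul, zero_smul, smul_ite, smul_zero]
    rw [Finset.sum_ite_eq, if_pos (Finset.mem_Icc.2 ⟨hj1, hj2⟩)]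
    push_cast
    rw [add_smul, one_smul, smul_comm]
  · intro k
    simp [pd_zero]
  · intro k P Q hP hQ h1 h2
    simp only [pd_add (homogPoly_differentiable hP) (homogPoly_differentiable hQ), Pi.add_apply,
      smul_add, Finset.sum_add_distrib, h1, h2]
  · intro k c P hP h1
    simp only [pd_smul (homogPoly_differentiable hP), Pi.smul_apply]
    simp only [smul_comm _ c, ← Finset.smul_sum, h1]

theorem homogPoly_smul_arg {R : Submodule ℂ T} {k : ℕ} {P : E m → T} (hP : P ∈ homogPoly m R k)
    (c : ℝ) (x : E m) : P (c • x) = c ^ k • P x := by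
  refine homogPoly_induction (p := fun k P => P (c • x) = c ^ k • P x) ?_ ?_ ?_ ?_ ?_ hP
  · intro s hs; simp
  · intro k P j hj1 hj2 hP ih
    change crd j (c • x) • P (c • x) = _
    rw [ih, smul_smul, smul_smul]
    congr 1
    simp only [crd, inner_smul_right]
    ring
  · intro k; simp
  · intro k P Q _ _ h1 h2; simp [h1, h2]
  · intro k a P _ h1
    change a • P (c • x) = _ • (a • P x)
    rw [h1, smul_comm]

theorem eq_zero_of_pd_eq_zero {R : Submodule ℂ T} {k : ℕ} (hk : k ≠ 0) {P : E m → T}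
    (hP : P ∈ homogPoly m R k) (h : ∀ i, 1 ≤ i → i ≤ m → pd i P = 0) : P = 0 := by
  ext x
  have h1 := homogPoly_euler hP x
  rw [Finset.sum_eq_zero (fun i hi => by
    rw [Finset.mem_Icc] at hi
    rw [h i hi.1 hi.2]; simp)] at h1
  exact (smul_eq_zero.1 h1.symm).resolve_left (by exact_mod_cast hk)

instance finiteDimensional_homogPoly [FiniteDimensional ℂ T] (R : Submodule ℂ T) (k : ℕ) :
    FiniteDimensional ℂ (homogPoly m R k) := by
  classical
  let f : (Fin m → ℕ) → T →ₗ[ℂ] (E m → T) := fun α =>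
    { toFun := fun s x => ((∏ i, x i ^ α i : ℝ) : ℂ) • s
      map_add' := fun s t => by ext x; simp
      map_smul' := fun c s => by ext x; exact smul_comm _ _ _ }
  have hle : homogPoly m R k ≤ ⨆ α : Finset.piAntidiag (Finset.univ : Finset (Fin m)) k,
      LinearMap.range (f α) := by
    rw [homogPoly, Submodule.span_le]
    rintro _ ⟨α, hα, s, -, rfl⟩
    exact Submodule.mem_iSup_of_mem (⟨α, by simp [Finset.mem_piAntidiag, hα]⟩) ⟨s, rfl⟩
  exact Submodule.finiteDimensional_of_le hle

instance finiteDimensional_monogenic [FiniteDimensional ℂ T] (γ : Cl m →ₐ[ℝ] Module.End ℂ T)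
    (R : Submodule ℂ T) (k : ℕ) : FiniteDimensional ℂ (monogenic γ R k) :=
  Submodule.finiteDimensional_of_le (show monogenic γ R k ≤ homogPoly m R k from fun _ h => h.1)

theorem dirac_eq_sum (γ : Cl m →ₐ[ℝ] Module.End ℂ T) (P : E m → T) (x : E m) :
    dirac γ P x = ∑ i ∈ Finset.Icc 1 m, γ (e m i) (pd i P x) := by
  rw [dirac, sum_Icc_eq_sum_fin (fun i => γ (e m i) (pd i P x))]

end HomogPoly


/-! ### Gegenbauer polynomials -/

section Gegenbauer

/-- The coefficient of `(2t)^{l-2i} q^i` in the homogenized Gegenbauer polynomial. -/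
def gegCoeff (ν : ℝ) (l i : ℕ) : ℝ :=
  if 2 * i ≤ l then
    (-1) ^ i * (ascPochhammer ℝ (l - i)).eval ν / ((i.factorial : ℝ) * ((l - 2 * i).factorial : ℝ))
  else 0

/-- The coefficients vanish beyond l/2, so polynomials of different degrees can be written as sums
over one range and compared term by term. -/
theorem homGegenbauer_eq_sum (ν : ℝ) (l : ℕ) (t q : ℝ) {N : ℕ} (hN : l / 2 + 1 ≤ N) :
    homGegenbauer ν l t q = ∑ i ∈ Finset.range N, gegCoeff ν l i * (2 * t) ^ (l - 2 * i) * q ^ i := by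
  rw [homGegenbauer, ← Finset.sum_subset (Finset.range_mono hN)]
  · refine Finset.sum_congr rfl fun i hi => ?_
    rw [Finset.mem_range] at hi
    rw [gegCoeff, if_pos (by omega)]
  · intro i _ hi
    rw [Finset.mem_range] at hi
    rw [gegCoeff, if_neg (by omega)]
    simp

theorem ascPochhammer_eval_succ_left (n : ℕ) (x : ℝ) :
    (ascPochhammer ℝ (n + 1)).eval x = x * (ascPochhammer ℝ n).eval (x + 1) := by
  rw [ascPochhammer_succ_left]
  simp [Polynomial.eval_comp]

theorem gegCoeff_dt (ν : ℝ) (l i : ℕ) :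
    gegCoeff ν (l + 1) i * ((l + 1 - 2 * i : ℕ) : ℝ) = ν * gegCoeff (ν + 1) l i := by
  by_cases h : 2 * i ≤ l
  · rw [gegCoeff, gegCoeff, if_pos (by omega), if_pos h, show l + 1 - i = (l - i) + 1 by omega,
      show l + 1 - 2 * i = (l - 2 * i) + 1 by omega, ascPochhammer_eval_succ_left,
      Nat.factorial_succ]
    have h1 : ((l - 2 * i + 1 : ℕ) : ℝ) ≠ 0 := by positivity
    push_cast at h1 ⊢
    field_simp
  · rw [show l + 1 - 2 * i = 0 by omega, gegCoeff, gegCoeff, if_neg h]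
    simp

theorem gegCoeff_dq (ν : ℝ) (l i : ℕ) :
    gegCoeff ν (l + 2) (i + 1) * ((i + 1 : ℕ) : ℝ) = -ν * gegCoeff (ν + 1) l i := by
  by_cases h : 2 * i ≤ l
  · rw [gegCoeff, gegCoeff, if_pos (by omega), if_pos h,
      show l + 2 - (i + 1) = (l - i) + 1 by omega,
      show l + 2 - 2 * (i + 1) = l - 2 * i by omega, ascPochhammer_eval_succ_left,
      Nat.factorial_succ]
    push_cast
    field_simp
    ring
  · rw [gegCoeff, gegCoeff, if_neg h, if_neg (by omega)]
    simp

theorem gegCoeff_contiguous (ν : ℝ) (l i : ℕ) (t : ℝ) :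
    (2 * ν + l + 1) * (gegCoeff ν (l + 1) i * (2 * t) ^ (l + 1 - 2 * i)) =
      2 * ν * (gegCoeff (ν + 1) (l + 1) i * (2 * t) ^ (l + 1 - 2 * i) -
        t * (gegCoeff (ν + 1) l i * (2 * t) ^ (l - 2 * i))) := by
  by_cases h : 2 * i ≤ l
  · rw [gegCoeff, gegCoeff, gegCoeff, if_pos (by omega), if_pos h, if_pos (by omega),
      show l + 1 - i = (l - i) + 1 by omega,
      show l + 1 - 2 * i = (l - 2 * i) + 1 by omega, ascPochhammer_eval_succ_left,
      ascPochhammer_succ_eval, Nat.factorial_succ]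
    have h1 : ((l - i : ℕ) : ℝ) = (l - 2 * i : ℕ) + i := by
      rw [← Nat.cast_add]; congr 1; omega
    have h2 : (l : ℝ) = (l - 2 * i : ℕ) + 2 * i := by
      have : l = (l - 2 * i) + 2 * i := by omega
      exact_mod_cast this
    rw [h1]
    generalize hn : l - 2 * i = n at *
    rw [h2]
    have h3 : ((n : ℝ) + 1) ≠ 0 := by positivity
    push_cast
    field_simp
    ring
  -- The remaining nontrivial coefficient is that of the pure power of q, where the polynomial of
  -- degree `l` contributes nothing.
  · by_cases h' : 2 * i = l + 1
    · rw [gegCoeff, gegCoeff, gegCoeff, if_pos (by omega), if_neg h, if_pos (by omega),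
        show l + 1 - i = i by omega, show l + 1 - 2 * i = 0 by omega]
      have h1 : (l : ℝ) + 1 = 2 * i := by exact_mod_cast h'.symm
      have h2 : (ascPochhammer ℝ i).eval ν * (ν + i) = ν * (ascPochhammer ℝ i).eval (ν + 1) := by
        rw [← ascPochhammer_succ_eval, ascPochhammer_eval_succ_left]
      have h3 : 2 * ν + l + 1 = 2 * (ν + i) := by linarith
      rw [h3]
      simp only [pow_zero, mul_one, zero_mul, mul_zero, sub_zero, Nat.factorial_zero, Nat.cast_one]
      rw [mul_div_assoc', mul_div_assoc']
      congr 1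
      linear_combination (-1) ^ i * 2 * h2
    · rw [gegCoeff, gegCoeff, gegCoeff, if_neg (by omega), if_neg h, if_neg (by omega)]
      simp

/-- The partial derivative of the homogenized Gegenbauer polynomial with respect to `t`. -/
def gegDt (ν : ℝ) (l : ℕ) (t q : ℝ) : ℝ :=
  if l = 0 then 0 else 2 * ν * homGegenbauer (ν + 1) (l - 1) t q

/-- The partial derivative of the homogenized Gegenbauer polynomial with respect to `q`. -/
def gegDq (ν : ℝ) (l : ℕ) (t q : ℝ) : ℝ :=
  if l < 2 then 0 else -ν * homGegenbauer (ν + 1) (l - 2) t q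

theorem gegDt_eq_sum (ν : ℝ) (l : ℕ) (t q : ℝ) {N : ℕ} (hN : l / 2 + 1 ≤ N) :
    gegDt ν l t q = ∑ i ∈ Finset.range N,
      gegCoeff ν l i * (((l - 2 * i : ℕ) : ℝ) * (2 * t) ^ (l - 2 * i - 1) * 2) * q ^ i := by
  cases l with
  | zero => simp [gegDt]
  | succ l =>
    rw [gegDt, if_neg (by omega), Nat.add_sub_cancel,
      homGegenbauer_eq_sum _ _ _ _ (show l / 2 + 1 ≤ N by omega), Finset.mul_sum]
    refine Finset.sum_congr rfl fun i _ => ?_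
    rw [show l + 1 - 2 * i - 1 = l - 2 * i by omega]
    linear_combination (-2) * (2 * t) ^ (l - 2 * i) * q ^ i * gegCoeff_dt ν l i

theorem gegDq_eq_sum (ν : ℝ) (l : ℕ) (t q : ℝ) {N : ℕ} (hN : l / 2 + 1 ≤ N) :
    gegDq ν l t q = ∑ i ∈ Finset.range N,
      gegCoeff ν l i * (2 * t) ^ (l - 2 * i) * ((i : ℝ) * q ^ (i - 1)) := by
  obtain ⟨N, rfl⟩ : ∃ n, N = n + 1 := ⟨N - 1, by omega⟩
  rw [Finset.sum_range_succ']
  rw [gegDq]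
  split_ifs with h
  · symm
    simp only [Nat.cast_zero, zero_mul, mul_zero, add_zero]
    refine Finset.sum_eq_zero fun i _ => ?_
    rw [gegCoeff, if_neg (by omega)]
    simp
  · obtain ⟨l, rfl⟩ : ∃ n, l = n + 2 := ⟨l - 2, by omega⟩
    rw [Nat.add_sub_cancel, homGegenbauer_eq_sum _ _ _ _ (show l / 2 + 1 ≤ N by omega),
      Finset.mul_sum]
    simp only [Nat.cast_zero, zero_mul, mul_zero, add_zero]
    refine Finset.sum_congr rfl fun i _ => ?_
    rw [show l + 2 - 2 * (i + 1) = l - 2 * i by omega, Nat.add_sub_cancel]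
    linear_combination (-1) * (2 * t) ^ (l - 2 * i) * q ^ i * gegCoeff_dq ν l i

theorem hasDerivAt_homGegenbauer (ν : ℝ) (l : ℕ) {t q : ℝ → ℝ} {t' q' s : ℝ}
    (ht : HasDerivAt t t' s) (hq : HasDerivAt q q' s) :
    HasDerivAt (fun s => homGegenbauer ν l (t s) (q s))
      (gegDt ν l (t s) (q s) * t' + gegDq ν l (t s) (q s) * q') s := by
  have h1 := HasDerivAt.fun_sum (u := Finset.range (l / 2 + 1)) fun i _ =>
    (((ht.const_mul 2).fun_pow (l - 2 * i)).const_mul (gegCoeff ν l i)).fun_mul (hq.fun_pow i)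
  have h2 : (fun s => homGegenbauer ν l (t s) (q s)) = fun y => ∑ i ∈ Finset.range (l / 2 + 1),
      gegCoeff ν l i * (2 * t y) ^ (l - 2 * i) * q y ^ i :=
    funext fun s => homGegenbauer_eq_sum ν l _ _ le_rfl
  rw [h2]
  refine h1.congr_deriv (Eq.symm ?_)
  · rw [gegDt_eq_sum ν l _ _ le_rfl, gegDq_eq_sum ν l _ _ le_rfl, Finset.sum_mul, Finset.sum_mul,
      ← Finset.sum_add_distrib]
    refine Finset.sum_congr rfl fun i _ => ?_
    ring

/-- Euler's identity for the homogenized Gegenbauer polynomial. -/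
theorem geg_euler (ν : ℝ) (l : ℕ) (t q : ℝ) :
    l * homGegenbauer ν l t q = t * gegDt ν l t q + 2 * q * gegDq ν l t q := by
  rw [homGegenbauer_eq_sum ν l t q le_rfl, gegDt_eq_sum ν l t q le_rfl,
    gegDq_eq_sum ν l t q le_rfl, Finset.mul_sum, Finset.mul_sum, Finset.mul_sum,
    ← Finset.sum_add_distrib]
  refine Finset.sum_congr rfl fun i hi => ?_
  rw [Finset.mem_range] at hi
  have h2 : (l : ℝ) = (l - 2 * i : ℕ) + 2 * i := by
    have : l = (l - 2 * i) + 2 * i := by omega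
    exact_mod_cast this
  rw [h2]
  generalize l - 2 * i = n
  have e1 : t * ((n : ℝ) * (2 * t) ^ (n - 1) * 2) = n * (2 * t) ^ n := by
    cases n with
    | zero => simp
    | succ n => rw [Nat.add_sub_cancel]; ring
  have e2 : q * ((i : ℝ) * q ^ (i - 1)) = i * q ^ i := by
    cases i with
    | zero => simp
    | succ n => rw [Nat.add_sub_cancel]; ring
  linear_combination (-gegCoeff ν l i * q ^ i) * e1 - 2 * gegCoeff ν l i * (2 * t) ^ n * e2

/-- Homogeneous form of the classical relation (2ν+n) C^ν_n = 2ν (C^{ν+1}_n - z C^{ν+1}_{n-1}),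
verified coefficientwise. -/
theorem geg_contiguous (ν : ℝ) (l : ℕ) (t q : ℝ) :
    (2 * ν + l + 1) * homGegenbauer ν (l + 1) t q =
      2 * ν * (homGegenbauer (ν + 1) (l + 1) t q - t * homGegenbauer (ν + 1) l t q) := by
  rw [homGegenbauer_eq_sum ν (l + 1) t q (N := l + 2) (by omega),
    homGegenbauer_eq_sum (ν + 1) (l + 1) t q (N := l + 2) (by omega),
    homGegenbauer_eq_sum (ν + 1) l t q (N := l + 2) (by omega), Finset.mul_sum, Finset.mul_sum,
    ← Finset.sum_sub_distrib, Finset.mul_sum]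
  refine Finset.sum_congr rfl fun i hi => ?_
  linear_combination q ^ i * gegCoeff_contiguous ν l i t

theorem homGegenbauer_zero (ν t q : ℝ) : homGegenbauer ν 0 t q = 1 := by
  simp [homGegenbauer]

/-- The total derivative of `G(t, t² + ρ²)` with respect to `t`. -/
theorem geg_total_deriv (ν : ℝ) (l : ℕ) (t q : ℝ) :
    gegDt ν (l + 1) t q + gegDq ν (l + 1) t q * (2 * t) =
      (2 * ν + l) * homGegenbauer ν l t q := by
  rw [gegDt, if_neg (by omega), gegDq]
  cases l with
  | zero => simp [homGegenbauer_zero]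
  | succ l =>
    rw [if_neg (by omega), Nat.add_sub_cancel, show l + 1 + 1 - 2 = l by omega]
    -- Both partial derivatives raise ν by one, and their combination is precisely the right-hand
    -- side of the contiguous relation.
    have := geg_contiguous ν l t q
    push_cast
    linear_combination (-1) * this

end Gegenbauer


/-! ### The embedding factors -/

section Factors

variable {m : ℕ}

/-- The quotient of Pochhammer symbols in front of the Gegenbauer polynomial in `F^{(l)}_{r,j}`. -/
def harmCoeff (r j l : ℕ) : ℝ :=
  (ascPochhammer ℝ l).eval ((j : ℝ) + 1) / (ascPochhammer ℝ l).eval ((r : ℝ) + 2 * j - 2)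

theorem harmFactor_eq (r j l : ℕ) (x : E m) :
    harmFactor r j l x = harmCoeff r j l *
      homGegenbauer ((r : ℝ) / 2 + j - 1) l (crd r x) (∑ i ∈ Finset.Icc 1 r, crd i x ^ 2) := rfl

/-- The scalar factor of the bivector part of `X^{(l)}_{r,j}`. -/
def bivFactor (r j l : ℕ) (x : E m) : ℝ :=
  ((j : ℝ) + 1) / ((r : ℝ) + 2 * j - 1) * (if l = 0 then 0 else harmFactor r (j + 1) (l - 1) x)

theorem hasDerivAt_crd (i j : ℕ) (x : E m) :
    HasDerivAt (fun s : ℝ => crd j (x + s • bv m i)) (if j = i ∧ 1 ≤ j ∧ j ≤ m then 1 else 0) 0 := by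
  have h : (fun s : ℝ => crd j (x + s • bv m i)) =
      fun s => crd j x + s * (if j = i ∧ 1 ≤ j ∧ j ≤ m then 1 else 0) := by
    ext s
    rw [crd, inner_add_right, inner_smul_right, inner_bv]
    rfl
  rw [h]
  simpa using ((hasDerivAt_id (0 : ℝ)).mul_const
    (if j = i ∧ 1 ≤ j ∧ j ≤ m then (1 : ℝ) else 0)).const_add (crd j x)

theorem pd_eq_of_hasDerivAt {f : E m → ℝ} (hf : Differentiable ℝ f) {i : ℕ} {x : E m} {c : ℝ}
    (h : HasDerivAt (fun s : ℝ => f (x + s • bv m i)) c 0) : pd i f x = c := by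
  have h1 : HasDerivAt (fun s : ℝ => x + s • bv m i) (bv m i) 0 := by
    simpa using ((hasDerivAt_id (0 : ℝ)).smul_const (bv m i)).const_add x
  have h2 := (hf (x + (0 : ℝ) • bv m i)).hasFDerivAt.comp_hasDerivAt (0 : ℝ) h1
  have h3 := h2.unique h
  rw [← h3]
  simp [pd]

theorem contDiff_rsq {n : WithTop ℕ∞} (r : ℕ) :
    ContDiff ℝ n fun x : E m => ∑ i ∈ Finset.Icc 1 r, crd i x ^ 2 :=
  ContDiff.sum fun i _ => (contDiff_crd i).pow 2

theorem contDiff_harmFactor {n : WithTop ℕ∞} (r j l : ℕ) :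
    ContDiff ℝ n (harmFactor r j l : E m → ℝ) := by
  refine contDiff_const.mul (ContDiff.sum fun i _ => ?_)
  exact (contDiff_const.mul ((contDiff_const.mul (contDiff_crd r)).pow _)).mul
    ((contDiff_rsq r).pow _)

theorem differentiable_harmFactor (r j l : ℕ) : Differentiable ℝ (harmFactor r j l : E m → ℝ) :=
  (contDiff_harmFactor (n := 1) r j l).differentiable (by norm_num)

theorem contDiff_bivFactor {n : WithTop ℕ∞} (r j l : ℕ) :
    ContDiff ℝ n (bivFactor r j l : E m → ℝ) := by
  refine contDiff_const.mul ?_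
  split_ifs
  · exact contDiff_const
  · exact contDiff_harmFactor _ _ _

theorem differentiable_bivFactor (r j l : ℕ) : Differentiable ℝ (bivFactor r j l : E m → ℝ) :=
  (contDiff_bivFactor (n := 1) r j l).differentiable (by norm_num)

theorem pd_harmFactor {r : ℕ} (h1 : 1 ≤ r) (hr : r ≤ m) (j l i : ℕ) (x : E m) :
    pd i (harmFactor r j l) x = harmCoeff r j l *
      (gegDt ((r : ℝ) / 2 + j - 1) l (crd r x) (∑ i ∈ Finset.Icc 1 r, crd i x ^ 2) *
        (if i = r then 1 else 0) +
      gegDq ((r : ℝ) / 2 + j - 1) l (crd r x) (∑ i ∈ Finset.Icc 1 r, crd i x ^ 2) *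
        (if 1 ≤ i ∧ i ≤ r then 2 * crd i x else 0)) := by
  apply pd_eq_of_hasDerivAt (differentiable_harmFactor r j l)
  have ht := hasDerivAt_crd i r x
  have hq : HasDerivAt (fun s : ℝ => ∑ k ∈ Finset.Icc 1 r, crd k (x + s • bv m i) ^ 2)
      (if 1 ≤ i ∧ i ≤ r then 2 * crd i x else 0) 0 := by
    have := HasDerivAt.fun_sum (u := Finset.Icc 1 r) fun k _ => (hasDerivAt_crd i k x).fun_pow 2
    refine this.congr_deriv ?_
    simp only [zero_smul, add_zero]
    rw [Finset.sum_congr rfl (g := fun k => if i = k then 2 * crd k x else 0)]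
    · rw [Finset.sum_ite_eq]
      simp
    · intro k hk
      rw [Finset.mem_Icc] at hk
      by_cases h : i = k
      · subst h
        simp [hk.1, hk.2.trans hr]
      · simp [h, Ne.symm h]
  have := (hasDerivAt_homGegenbauer ((r : ℝ) / 2 + j - 1) l ht hq).const_mul (harmCoeff r j l)
  refine this.congr_deriv ?_
  have h2 : (if r = i ∧ 1 ≤ r ∧ r ≤ m then (1 : ℝ) else 0) = if i = r then 1 else 0 := by
    by_cases h : i = r
    · subst h; simp [h1, hr]
    · simp [h, Ne.symm h]
  simp only [zero_smul, add_zero, h2]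

theorem dim_pos {r : ℕ} (h : 3 ≤ r) (j : ℕ) : 0 < (r : ℝ) + 2 * j - 2 := by
  have h1 : (3 : ℝ) ≤ r := by exact_mod_cast h
  have h2 : (0 : ℝ) ≤ j := by positivity
  linarith

theorem harmCoeff_zero (r j : ℕ) : harmCoeff r j 0 = 1 := by simp [harmCoeff]

/-- The last Pochhammer factors. The denominator cancels the 2ν + l of `geg_total_deriv`, the
numerator leaves the Appell factor j + l + 1. -/
theorem harmCoeff_succ {r : ℕ} (h : 3 ≤ r) (j l : ℕ) :
    harmCoeff r j (l + 1) * ((r : ℝ) + 2 * j - 2 + l) = harmCoeff r j l * (j + l + 1) := by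
  have h1 := dim_pos h j
  have h2 := (ascPochhammer_pos l _ h1).ne'
  have h3 : (r : ℝ) + 2 * j - 2 + l ≠ 0 := by positivity
  rw [harmCoeff, harmCoeff, ascPochhammer_succ_eval, ascPochhammer_succ_eval]
  rw [div_mul_eq_mul_div, div_mul_eq_mul_div, div_eq_div_iff (mul_ne_zero h2 h3) h2]
  ring

/-- The two parts of X use the parameters j and j+1. Numerators are compared through (j+1)_{l+1} =
(j+1)(j+2)_l, denominators through (y)_{l+2} = y(y+1)(y+2)_l with y = r+2j-2. -/
theorem harmCoeff_shift {r : ℕ} (h : 3 ≤ r) (j l : ℕ) :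
    harmCoeff r j (l + 1) * ((r : ℝ) + 2 * j - 2) * ((r : ℝ) + 2 * j - 1) =
      ((j : ℝ) + 1) * harmCoeff r (j + 1) l * ((r : ℝ) + 2 * j - 1 + l) := by
  have h1 := dim_pos h j
  have h1' := dim_pos h (j + 1)
  have h2 := (ascPochhammer_pos l _ h1').ne'
  have h2' := (ascPochhammer_pos (l + 1) _ h1).ne'
  have h2'' := (ascPochhammer_pos (l + 2) _ h1).ne'
  have h3 : (r : ℝ) + 2 * j - 1 + l > 0 := by
    have : (0 : ℝ) ≤ l := by positivity
    linarith
  have e1 : (ascPochhammer ℝ (l + 1)).eval ((r : ℝ) + 2 * j - 2) * ((r : ℝ) + 2 * j - 1 + l) =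
      ((r : ℝ) + 2 * j - 2) * (((r : ℝ) + 2 * j - 1) *
        (ascPochhammer ℝ l).eval ((r : ℝ) + 2 * (j + 1 : ℕ) - 2)) := by
    have e2 : (ascPochhammer ℝ (l + 2)).eval ((r : ℝ) + 2 * j - 2) =
        (ascPochhammer ℝ (l + 1)).eval ((r : ℝ) + 2 * j - 2) * ((r : ℝ) + 2 * j - 1 + l) := by
      rw [ascPochhammer_succ_eval]
      push_cast
      ring
    rw [← e2, ascPochhammer_eval_succ_left, ascPochhammer_eval_succ_left]
    push_cast
    ring_nf
  have e3 : (ascPochhammer ℝ (l + 1)).eval ((j : ℝ) + 1) = ((j : ℝ) + 1) *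
      (ascPochhammer ℝ l).eval (((j + 1 : ℕ) : ℝ) + 1) := by
    rw [ascPochhammer_eval_succ_left]
    push_cast
    rfl
  rw [harmCoeff, harmCoeff, e3]
  rw [div_mul_eq_mul_div, div_mul_eq_mul_div, mul_div_assoc', div_mul_eq_mul_div,
    div_eq_div_iff h2' h2]
  linear_combination (-((j : ℝ) + 1)) * (ascPochhammer ℝ l).eval (((j + 1 : ℕ) : ℝ) + 1) * e1

theorem pd_harmFactor_self {r : ℕ} (h : 3 ≤ r) (hr : r ≤ m) (j l : ℕ) (x : E m) :
    pd r (harmFactor r j (l + 1)) x = ((j : ℝ) + l + 1) * harmFactor r j l x := by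
  rw [pd_harmFactor (by omega) hr, if_pos rfl, if_pos ⟨by omega, le_rfl⟩, mul_one,
    geg_total_deriv, harmFactor_eq]
  have := harmCoeff_succ h j l
  linear_combination homGegenbauer ((r : ℝ) / 2 + j - 1) l (crd r x)
    (∑ i ∈ Finset.Icc 1 r, crd i x ^ 2) * this

theorem harmFactor_zero (r j : ℕ) : (harmFactor r j 0 : E m → ℝ) = fun _ => 1 := by
  ext x
  rw [harmFactor_eq, harmCoeff_zero, homGegenbauer_zero, one_mul]

theorem bivFactor_zero (r j : ℕ) : (bivFactor r j 0 : E m → ℝ) = 0 := by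
  ext x; simp [bivFactor]

theorem bivFactor_succ (r j l : ℕ) : (bivFactor r j (l + 1) : E m → ℝ) =
    (((j : ℝ) + 1) / ((r : ℝ) + 2 * j - 1)) • harmFactor r (j + 1) l := by
  ext x; simp [bivFactor]

theorem pd_bivFactor_self {r : ℕ} (h : 3 ≤ r) (hr : r ≤ m) (j l : ℕ) (x : E m) :
    pd r (bivFactor r j (l + 1)) x = ((j : ℝ) + l + 1) * bivFactor r j l x := by
  rw [bivFactor_succ, pd_smul (differentiable_harmFactor _ _ _), Pi.smul_apply]
  cases l with
  | zero =>
    rw [bivFactor_zero, harmFactor_zero, pd_const]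
    simp
  | succ l =>
    rw [pd_harmFactor_self h hr, bivFactor_succ]
    simp
    ring

theorem pd_harmFactor_of_lt {r : ℕ} (h1 : 1 ≤ r) (hr : r ≤ m) (j l : ℕ) {i : ℕ} (hi : r < i) :
    pd i (harmFactor r j l : E m → ℝ) = 0 := by
  ext x
  rw [pd_harmFactor h1 hr, if_neg (by omega), if_neg (by omega)]
  simp

theorem pd_bivFactor_of_lt {r : ℕ} (h1 : 1 ≤ r) (hr : r ≤ m) (j l : ℕ) {i : ℕ} (hi : r < i) :
    pd i (bivFactor r j l : E m → ℝ) = 0 := by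
  cases l with
  | zero => rw [bivFactor_zero, pd_zero]
  | succ l =>
    rw [bivFactor_succ, pd_smul (differentiable_harmFactor _ _ _),
      pd_harmFactor_of_lt h1 hr _ _ hi, smul_zero]

/-- The radial derivatives of the two scalar factors, and the two identities that make
`X^{(l)}_{r,j}` preserve monogenicity. -/
theorem exists_radial {r : ℕ} (h : 3 ≤ r) (hr : r ≤ m) (j l : ℕ) (x : E m) :
    ∃ H K : ℝ, (∀ i, 1 ≤ i → i < r → pd i (harmFactor r j l) x = crd i x * H) ∧
      (∀ i, 1 ≤ i → i < r → pd i (bivFactor r j l) x = crd i x * K) ∧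
      H + pd r (bivFactor r j l) x = 0 ∧
      pd r (harmFactor r j l) x - (∑ i ∈ Finset.Icc 1 (r - 1), crd i x ^ 2) * K
        - ((r : ℝ) + 2 * j - 1) * bivFactor r j l x = 0 := by
  set t := crd r x with ht
  set q := ∑ i ∈ Finset.Icc 1 r, crd i x ^ 2 with hq
  set ν : ℝ := (r : ℝ) / 2 + j - 1 with hν
  have hν1 : (r : ℝ) / 2 + ((j + 1 : ℕ) : ℝ) - 1 = ν + 1 := by rw [hν]; push_cast; ring
  have hρ : ∑ i ∈ Finset.Icc 1 (r - 1), crd i x ^ 2 = q - t ^ 2 := by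
    obtain ⟨n, rfl⟩ : ∃ n, r = n + 1 := ⟨r - 1, by omega⟩
    rw [hq, Finset.sum_Icc_succ_top (by omega), Nat.add_sub_cancel, ht]
    ring
  have hy := dim_pos h j
  have hy2 : (r : ℝ) + 2 * j - 2 = 2 * ν := by rw [hν]; ring
  have hy1 : (r : ℝ) + 2 * j - 1 = 2 * ν + 1 := by rw [hν]; ring
  have hν0 : 0 < ν := by linarith
  rw [hy1]
  cases l with
  | zero =>
    refine ⟨0, 0, ?_, ?_, ?_, ?_⟩
    · intro i _ _; rw [harmFactor_zero, pd_const]; simp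
    · intro i _ _; rw [bivFactor_zero, pd_zero]; simp
    · rw [bivFactor_zero, pd_zero]; simp
    · rw [harmFactor_zero, pd_const, bivFactor_zero]; simp
  | succ l =>
    -- For i < r the variable x_i enters only through q = |x|_r², so each derivative is 2x_i times
    -- the q-derivative.
    refine ⟨harmCoeff r j (l + 1) * gegDq ν (l + 1) t q * 2,
      ((j : ℝ) + 1) / (2 * ν + 1) * (harmCoeff r (j + 1) l * gegDq (ν + 1) l t q * 2),
      ?_, ?_, ?_, ?_⟩
    · intro i h1 h2
      rw [pd_harmFactor (by omega) hr, if_neg (by omega), if_pos ⟨h1, h2.le⟩]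
      ring
    · intro i h1 h2
      rw [bivFactor_succ, pd_smul (differentiable_harmFactor _ _ _), Pi.smul_apply,
        pd_harmFactor (by omega) hr, if_neg (by omega), if_pos ⟨h1, h2.le⟩, hν1, hy1, smul_eq_mul]
      ring
    -- The q-derivative lowers the degree by two and raises ν by one, which is the index of the
    -- bivector factor; both terms are multiples of one polynomial and only the constants have to
    -- match.
    · rw [pd_bivFactor_self h hr]
      cases l with
      | zero => rw [bivFactor_zero]; simp [gegDq]
      | succ l =>
        rw [bivFactor_succ, Pi.smul_apply, harmFactor_eq, hν1, hy1, smul_eq_mul, gegDq,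
          if_neg (by omega), show l + 1 + 1 - 2 = l by omega]
        have e1 := harmCoeff_succ h j (l + 1)
        have e2 := harmCoeff_shift h j l
        rw [hy2] at e1 e2
        rw [hy1] at e2
        have e3 : harmCoeff r j (l + 1 + 1) * (2 * ν) = ((j : ℝ) + 1) / (2 * ν + 1) *
            harmCoeff r (j + 1) l * (j + l + 2) := by
          have h3 : 2 * ν + 1 + l ≠ 0 := by positivity
          have h4 : 2 * ν + 1 ≠ 0 := by positivity
          rw [div_mul_eq_mul_div, div_mul_eq_mul_div, eq_div_iff h4]
          apply mul_right_cancel₀ h3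
          push_cast at e1
          linear_combination (2 * ν) * (2 * ν + 1) * e1 + (j + l + 2) * e2
        push_cast
        linear_combination (-homGegenbauer (ν + 1) l t q) * e3
    · rw [pd_harmFactor_self h hr, bivFactor_succ, Pi.smul_apply, harmFactor_eq, harmFactor_eq, hν1,
        hy1, smul_eq_mul, hρ]
      have h4 : 2 * ν + 1 ≠ 0 := by positivity
      cases l with
      | zero =>
        simp only [gegDq, harmCoeff_zero, homGegenbauer_zero]
        field_simp
        simp
      | succ l =>
        have e1 := harmCoeff_succ h j (l + 1)
        have e2 := harmCoeff_shift h j (l + 1)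
        rw [hy2] at e1 e2
        rw [hy1] at e2
        have g1 := geg_euler (ν + 1) (l + 1) t q
        have g2 := geg_total_deriv (ν + 1) l t q
        have g3 := geg_contiguous ν l t q
        have e3 : (j + l + 2) * harmCoeff r j (l + 1) * (2 * ν) = ((j : ℝ) + 1) / (2 * ν + 1) *
            harmCoeff r (j + 1) (l + 1) * (2 * ν + l + 2) * (2 * ν + l + 1) := by
          have h3 : 2 * ν + 1 + l ≠ 0 := by positivity
          rw [div_mul_eq_mul_div, div_mul_eq_mul_div, div_mul_eq_mul_div, eq_div_iff h4]
          push_cast at e1 e2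
          linear_combination (-(2 * ν) * (2 * ν + 1)) * e1 + (2 * ν + l + 1) * e2
        have h5 : 2 * ν ≠ 0 := by positivity
        -- Writing |x|_{r-1}² as q - t², Euler's identity and the total derivative turn the two
        -- bivector terms into a multiple of G_{l+1} - tG_l with parameter ν+1, where the contiguous
        -- relation applies.
        have key : ((j : ℝ) + ((l + 1 : ℕ) : ℝ) + 1) * (harmCoeff r j (l + 1) *
            homGegenbauer ν (l + 1) t q) = ((j : ℝ) + 1) / (2 * ν + 1) *
            harmCoeff r (j + 1) (l + 1) * (2 * ν + l + 2) *
            (homGegenbauer (ν + 1) (l + 1) t q - t * homGegenbauer (ν + 1) l t q) := by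
          apply mul_left_cancel₀ h5
          push_cast
          linear_combination homGegenbauer ν (l + 1) t q * e3 + ((j : ℝ) + 1) / (2 * ν + 1) *
            harmCoeff r (j + 1) (l + 1) * (2 * ν + l + 2) * g3
        push_cast at key g1 ⊢
        rw [← ht, ← hq] at *
        linear_combination key + ((j : ℝ) + 1) / (2 * ν + 1) * harmCoeff r (j + 1) (l + 1) *
          (g1 + t * g2)

end Factors


/-! ### The embedding operators -/

section Operators

variable {m : ℕ} {T : Type*} [NormedAddCommGroup T] [NormedSpace ℂ T]
  {γ : Cl m →ₐ[ℝ] Module.End ℂ T}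

/-- The Clifford vector `x_1 e_1 + ⋯ + x_n e_n`. -/
def vec (n : ℕ) (x : E m) : Cl m := ∑ i ∈ Finset.Icc 1 n, crd i x • e m i

theorem γ_smul (c : ℝ) (a : Cl m) (t : T) : γ (c • a) t = c • γ a t := by
  rw [map_smul]; rfl

theorem map_real_smul (f : Module.End ℂ T) (c : ℝ) (t : T) : f (c • t) = c • f t :=
  LinearMap.map_smul_of_tower f c t

/-- Multiplication of a spinor-valued function by `X^{(l)}_{r,j}`. -/
def mulX (γ : Cl m →ₐ[ℝ] Module.End ℂ T) (r j l : ℕ) : (E m → T) →ₗ[ℂ] (E m → T) where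
  toFun Q x := γ (monFactor r j l x) (Q x)
  map_add' P Q := by ext x; simp
  map_smul' c P := by ext x; simp

theorem mulX_apply (r j l : ℕ) (Q : E m → T) (x : E m) :
    mulX γ r j l Q x = γ (monFactor r j l x) (Q x) := rfl

theorem mulX_eq (r j l : ℕ) (Q : E m → T) (x : E m) :
    mulX γ r j l Q x = harmFactor r j l x • Q x +
      bivFactor r j l x • γ (vec (r - 1) x * e m r) (Q x) := by
  rw [mulX_apply, monFactor, map_add, LinearMap.add_apply, AlgHom.commutes,
    Module.algebraMap_end_apply, γ_smul]
  rfl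

theorem γ_vec_mul (n : ℕ) (x : E m) (a : Cl m) (t : T) :
    γ (vec n x * a) t = ∑ i ∈ Finset.Icc 1 n, crd i x • γ (e m i * a) t := by
  rw [vec, Finset.sum_mul, map_sum, LinearMap.sum_apply]
  refine Finset.sum_congr rfl fun i _ => ?_
  rw [smul_mul_assoc, γ_smul]

theorem differentiable_vec [FiniteDimensional ℂ T] {Q : E m → T} (hQ : Differentiable ℝ Q) (n : ℕ)
    (a : Cl m) : Differentiable ℝ fun x => γ (vec n x * a) (Q x) := by
  simp only [γ_vec_mul]
  exact Differentiable.fun_sum fun i _ => (differentiable_crd i).smul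
    (differentiable_linear hQ (γ (e m i * a)))

theorem pd_vec [FiniteDimensional ℂ T] {Q : E m → T} (hQ : Differentiable ℝ Q) {n : ℕ}
    (hn : n ≤ m) (a : Cl m) (i : ℕ) (x : E m) :
    pd i (fun x => γ (vec n x * a) (Q x)) x = γ (vec n x * a) (pd i Q x) +
      if 1 ≤ i ∧ i ≤ n then γ (e m i * a) (Q x) else 0 := by
  have h : (fun x => γ (vec n x * a) (Q x)) =
      ∑ k ∈ Finset.Icc 1 n, fun x => crd k x • γ (e m k * a) (Q x) := by
    ext x
    rw [γ_vec_mul, Finset.sum_apply]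
  have hd : ∀ k, Differentiable ℝ fun x => γ (e m k * a) (Q x) :=
    fun k => differentiable_linear hQ (γ (e m k * a))
  have hd' : ∀ k, Differentiable ℝ fun x => crd k x • γ (e m k * a) (Q x) :=
    fun k => (differentiable_crd k).smul (hd k)
  rw [h, pd_sum _ hd', Finset.sum_apply, γ_vec_mul]
  have h2 : ∀ k ∈ Finset.Icc 1 n, pd i (fun x => crd k x • γ (e m k * a) (Q x)) x =
      crd k x • γ (e m k * a) (pd i Q x) + if i = k then γ (e m k * a) (Q x) else 0 := by
    intro k hk
    rw [Finset.mem_Icc] at hk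
    rw [pd_mul_smul (differentiable_crd k) (hd k), pd_linear hQ, pd_crd]
    by_cases hik : i = k
    · subst hik; simp [hk.1, hk.2.trans hn]
    · simp [hik, Ne.symm hik]
  rw [Finset.sum_congr rfl h2, Finset.sum_add_distrib, Finset.sum_ite_eq]
  simp only [Finset.mem_Icc]

theorem differentiable_mulX [FiniteDimensional ℂ T] {Q : E m → T} (hQ : Differentiable ℝ Q)
    (r j l : ℕ) : Differentiable ℝ (mulX γ r j l Q) := by
  have : mulX γ r j l Q = fun x => harmFactor r j l x • Q x +
      bivFactor r j l x • γ (vec (r - 1) x * e m r) (Q x) := funext fun x => mulX_eq r j l Q x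
  rw [this]
  exact ((differentiable_harmFactor r j l).smul hQ).add
    ((differentiable_bivFactor r j l).smul (differentiable_vec hQ _ _))

theorem pd_mulX [FiniteDimensional ℂ T] {Q : E m → T} (hQ : Differentiable ℝ Q) {r : ℕ}
    (hr : r ≤ m) (j l i : ℕ) (x : E m) :
    pd i (mulX γ r j l Q) x = mulX γ r j l (pd i Q) x + pd i (harmFactor r j l) x • Q x +
      pd i (bivFactor r j l) x • γ (vec (r - 1) x * e m r) (Q x) +
      if 1 ≤ i ∧ i ≤ r - 1 then bivFactor r j l x • γ (e m i * e m r) (Q x) else 0 := by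
  have : mulX γ r j l Q = (fun x => harmFactor r j l x • Q x) +
      fun x => bivFactor r j l x • γ (vec (r - 1) x * e m r) (Q x) :=
    funext fun x => mulX_eq r j l Q x
  have hA : Differentiable ℝ fun x => harmFactor r j l x • Q x :=
    (differentiable_harmFactor r j l).smul hQ
  have hB : Differentiable ℝ fun x => bivFactor r j l x • γ (vec (r - 1) x * e m r) (Q x) :=
    (differentiable_bivFactor r j l).smul (differentiable_vec hQ _ _)
  rw [this, pd_add hA hB, Pi.add_apply,
    pd_mul_smul (differentiable_harmFactor r j l) hQ,
    pd_mul_smul (differentiable_bivFactor r j l) (differentiable_vec hQ _ _), mulX_eq,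
    pd_vec hQ (by omega), smul_add, smul_ite, smul_zero]
  abel

theorem mulX_zero_right (r j : ℕ) (Q : E m → T) : mulX γ r j 0 Q = Q := by
  ext x
  rw [mulX_eq, harmFactor_zero, bivFactor_zero]
  simp

/-- The Appell property of the embedding operators. -/
theorem pd_mulX_succ [FiniteDimensional ℂ T] {Q : E m → T} (hQ : Differentiable ℝ Q) {r : ℕ}
    (h3 : 3 ≤ r) (hr : r ≤ m) (h0 : pd r Q = 0) (j l : ℕ) :
    pd r (mulX γ r j (l + 1) Q) = ((j : ℝ) + l + 1) • mulX γ r j l Q := by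
  ext x
  -- Neither `Q` nor the vector x_1 e_1 + ... + x_{r-1} e_{r-1} involves x_r, so only the two scalar
  -- factors are differentiated, and both have the same Appell factor.
  rw [pd_mulX hQ hr, h0, map_zero, if_neg (by omega), pd_harmFactor_self h3 hr,
    pd_bivFactor_self h3 hr, Pi.smul_apply, mulX_eq]
  simp [mul_smul]

theorem pd_mulX_of_lt [FiniteDimensional ℂ T] {Q : E m → T} (hQ : Differentiable ℝ Q) {r : ℕ}
    (h1 : 1 ≤ r) (hr : r ≤ m) {i : ℕ} (hi : r < i) (h0 : pd i Q = 0) (j l : ℕ) :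
    pd i (mulX γ r j l Q) = 0 := by
  ext x
  rw [pd_mulX hQ hr, h0, map_zero, if_neg (by omega), pd_harmFactor_of_lt h1 hr j l hi,
    pd_bivFactor_of_lt h1 hr j l hi]
  simp

theorem homogPoly_harmFactor {R : Submodule ℂ T} {k : ℕ} {Q : E m → T} (hQ : Q ∈ homogPoly m R k)
    (r j l : ℕ) : (fun x => harmFactor r j l x • Q x) ∈ homogPoly m R (k + l) := by
  have hpow : ∀ (n i : ℕ) {k : ℕ} {Q : E m → T}, Q ∈ homogPoly m R k →
      (fun x => crd i x ^ n • Q x) ∈ homogPoly m R (k + n) := by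
    intro n i
    induction n with
    | zero => intro k Q hQ; simpa using hQ
    | succ n ih =>
      intro k Q hQ
      have := homogPoly_crd_smul (ih hQ) i
      rw [← add_assoc]
      convert this using 1
      ext x
      rw [smul_smul, pow_succ']
  have hsum : ∀ {k : ℕ} {Q : E m → T}, Q ∈ homogPoly m R k →
      (fun x => (∑ i ∈ Finset.Icc 1 r, crd i x ^ 2) • Q x) ∈ homogPoly m R (k + 2) := by
    intro k Q hQ
    have : (fun x => (∑ i ∈ Finset.Icc 1 r, crd i x ^ 2) • Q x) =
        ∑ i ∈ Finset.Icc 1 r, fun x => crd i x ^ 2 • Q x := by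
      ext x; rw [Finset.sum_smul, Finset.sum_apply]
    rw [this]
    exact Submodule.sum_mem _ fun i _ => hpow 2 i hQ
  have hsum' : ∀ (n : ℕ) {k : ℕ} {Q : E m → T}, Q ∈ homogPoly m R k →
      (fun x => (∑ i ∈ Finset.Icc 1 r, crd i x ^ 2) ^ n • Q x) ∈ homogPoly m R (k + 2 * n) := by
    intro n
    induction n with
    | zero => intro k Q hQ; simpa using hQ
    | succ n ih =>
      intro k Q hQ
      have := hsum (ih hQ)
      rw [show k + 2 * (n + 1) = k + 2 * n + 2 by ring]
      convert this using 1
      ext x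
      rw [smul_smul, pow_succ']
  have : (fun x => harmFactor r j l x • Q x) = ∑ i ∈ Finset.range (l / 2 + 1), fun x =>
      ((harmCoeff r j l * gegCoeff ((r : ℝ) / 2 + j - 1) l i * 2 ^ (l - 2 * i) : ℝ) : ℂ) •
        (crd r x ^ (l - 2 * i) • (∑ i ∈ Finset.Icc 1 r, crd i x ^ 2) ^ i • Q x) := by
    ext x
    rw [harmFactor_eq, homGegenbauer_eq_sum _ _ _ _ le_rfl, Finset.mul_sum, Finset.sum_smul,
      Finset.sum_apply]
    refine Finset.sum_congr rfl fun i _ => ?_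
    rw [Complex.coe_smul, smul_smul, smul_smul]
    congr 1
    ring
  rw [this]
  refine Submodule.sum_mem _ fun i hi => Submodule.smul_mem _ _ ?_
  rw [Finset.mem_range] at hi
  have := hpow (l - 2 * i) r (hsum' i hQ)
  rwa [show k + 2 * i + (l - 2 * i) = k + l by omega] at this

theorem homogPoly_linear_map {R R' : Submodule ℂ T} {k : ℕ} {Q : E m → T}
    (hQ : Q ∈ homogPoly m R k) (A : T →ₗ[ℂ] T) (hA : ∀ t ∈ R, A t ∈ R') :
    (fun x => A (Q x)) ∈ homogPoly m R' k := by
  refine homogPoly_induction (p := fun k Q => (fun x => A (Q x)) ∈ homogPoly m R' k)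
    ?_ ?_ ?_ ?_ ?_ hQ
  · intro s hs; exact homogPoly_const (hA s hs)
  · intro k P i _ _ _ ih
    have := homogPoly_crd_smul ih i
    convert this using 1
    ext x
    exact map_real_smul A _ _
  · intro k; simp only [Pi.zero_apply, map_zero]; exact Submodule.zero_mem _
  · intro k P Q _ _ h1 h2
    have := Submodule.add_mem _ h1 h2
    convert this using 1
    ext x; simp
  · intro k c P _ h1
    have := Submodule.smul_mem _ c h1
    convert this using 1
    ext x; simp

theorem homogPoly_mulX {R : Submodule ℂ T} {r : ℕ} (hR : EvenInv γ r R) {k : ℕ} {Q : E m → T}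
    (hQ : Q ∈ homogPoly m R k) (j l : ℕ) : mulX γ r j l Q ∈ homogPoly m R (k + l) := by
  have : mulX γ r j l Q = (fun x => harmFactor r j l x • Q x) +
      fun x => bivFactor r j l x • γ (vec (r - 1) x * e m r) (Q x) :=
    funext fun x => mulX_eq r j l Q x
  rw [this]
  refine Submodule.add_mem _ (homogPoly_harmFactor hQ r j l) ?_
  cases l with
  | zero => simp only [bivFactor_zero, Pi.zero_apply, zero_smul]; exact Submodule.zero_mem _
  | succ l =>
    have h1 : (fun x => γ (vec (r - 1) x * e m r) (Q x)) ∈ homogPoly m R (k + 1) := by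
      have : (fun x => γ (vec (r - 1) x * e m r) (Q x)) =
          ∑ i ∈ Finset.Icc 1 (r - 1), fun x => crd i x • γ (e m i * e m r) (Q x) := by
        ext x; rw [γ_vec_mul, Finset.sum_apply]
      rw [this]
      refine Submodule.sum_mem _ fun i hi => homogPoly_crd_smul ?_ i
      rw [Finset.mem_Icc] at hi
      exact homogPoly_linear_map hQ _ fun t ht => hR i (by omega) r le_rfl t ht
    have h2 := Submodule.smul_mem _ ((((j : ℝ) + 1) / ((r : ℝ) + 2 * j - 1) : ℝ) : ℂ)
      (homogPoly_harmFactor h1 r (j + 1) l)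
    rw [show k + (l + 1) = k + 1 + l by ring]
    convert h2 using 1
    ext x
    rw [bivFactor_succ, Pi.smul_apply, Pi.smul_apply, smul_eq_mul, mul_smul, Complex.coe_smul]

theorem vec_mul_vec {n : ℕ} (hn : n ≤ m) (x : E m) :
    vec n x * vec n x = algebraMap ℝ (Cl m) (-∑ i ∈ Finset.Icc 1 n, crd i x ^ 2) := by
  have h : vec n x = ι (negNormSq m) (∑ i ∈ Finset.Icc 1 n, crd i x • bv m i) := by
    simp [vec, e]
  rw [h, ι_sq_scalar, negNormSq_apply, ← real_inner_self_eq_norm_sq]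
  congr 2
  simp only [sum_inner, inner_sum, inner_smul_left, inner_smul_right, inner_bv]
  refine Finset.sum_congr rfl fun i hi => ?_
  rw [Finset.mem_Icc] at hi
  rw [Finset.sum_eq_single i]
  · simp [hi.1, hi.2.trans hn]; ring
  · intro b _ hb
    simp [hb]
  · intro h; exact absurd (Finset.mem_Icc.2 hi) h

theorem e_mul_vec_of_lt {n r : ℕ} (h : n < r) (x : E m) : e m r * vec n x = -(vec n x * e m r) := by
  rw [vec, Finset.mul_sum, Finset.sum_mul, ← Finset.sum_neg_distrib]
  refine Finset.sum_congr rfl fun i hi => ?_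
  rw [Finset.mem_Icc] at hi
  rw [mul_smul_comm, e_anticomm (show r ≠ i by omega), smul_mul_assoc, smul_neg]

theorem e_mul_vec_of_le {n i : ℕ} (h1 : 1 ≤ i) (h : i ≤ n) (hn : n ≤ m) (x : E m) :
    e m i * vec n x = -(vec n x * e m i) - algebraMap ℝ (Cl m) (2 * crd i x) := by
  rw [vec, Finset.mul_sum, Finset.sum_mul, ← Finset.sum_neg_distrib, eq_sub_iff_add_eq]
  have hk : ∀ k ∈ Finset.Icc 1 n, -(crd k x • e m k * e m i) = e m i * (crd k x • e m k) +
      if i = k then algebraMap ℝ (Cl m) (2 * crd k x) else 0 := by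
    intro k hk
    by_cases hki : i = k
    · subst hki
      rw [if_pos rfl, mul_smul_comm, smul_mul_assoc, e_mul_self h1 (h.trans hn),
        Algebra.algebraMap_eq_smul_one]
      module
    · rw [if_neg hki, mul_smul_comm, e_anticomm hki, smul_mul_assoc, smul_neg, add_zero]
  rw [Finset.sum_congr rfl hk, Finset.sum_add_distrib, Finset.sum_ite_eq,
    if_pos (Finset.mem_Icc.2 ⟨h1, h⟩)]

theorem sum_Icc_split {M : Type*} [AddCommMonoid M] {r : ℕ} (h1 : 1 ≤ r) (hr : r ≤ m) (f : ℕ → M)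
    (h0 : ∀ i, r < i → f i = 0) :
    ∑ i ∈ Finset.Icc 1 m, f i = ∑ i ∈ Finset.Icc 1 (r - 1), f i + f r := by
  obtain ⟨n, rfl⟩ : ∃ n, r = n + 1 := ⟨r - 1, by omega⟩
  rw [Nat.add_sub_cancel, ← Finset.sum_Icc_succ_top (by omega)]
  symm
  apply Finset.sum_subset (Finset.Icc_subset_Icc_right hr)
  intro i hi hi'
  rw [Finset.mem_Icc] at hi hi'
  exact h0 i (by omega)

/-- The embedding operators preserve monogenicity. -/
theorem dirac_mulX [FiniteDimensional ℂ T] {R : Submodule ℂ T} {r : ℕ} (h3 : 3 ≤ r) (hr : r ≤ m)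
    {j : ℕ} {Q : E m → T} (hQ : Q ∈ homogPoly m R j) (hD : ∀ x, dirac γ Q x = 0)
    (h0 : ∀ i, r ≤ i → pd i Q = 0) (l : ℕ) (x : E m) : dirac γ (mulX γ r j l Q) x = 0 := by
  have hQd := homogPoly_differentiable hQ
  obtain ⟨H, K, hH, hK, hR1, hR2⟩ := exists_radial h3 hr j l x
  have hD0 : ∑ i ∈ Finset.Icc 1 (r - 1), γ (e m i) (pd i Q x) = 0 := by
    have := hD x
    rw [dirac_eq_sum, sum_Icc_split (by omega) hr _ (fun i hi => by rw [h0 i hi.le]; simp),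
      h0 r le_rfl] at this
    simpa using this
  have hE0 : ∑ i ∈ Finset.Icc 1 (r - 1), crd i x • pd i Q x = (j : ℝ) • Q x := by
    have := homogPoly_euler hQ x
    rw [sum_Icc_split (by omega) hr _ (fun i hi => by rw [h0 i hi.le]; simp), h0 r le_rfl] at this
    simpa using this
  rw [dirac_eq_sum, sum_Icc_split (by omega) hr _
    (fun i hi => by rw [pd_mulX_of_lt hQd (by omega) hr hi (h0 i hi.le)]; simp)]
  have hr' : r - 1 ≤ m := by omega
  set X := vec (r - 1) x with hX
  set A := harmFactor r j l x
  set B := bivFactor r j l x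
  -- Moving e_i past the vector X produces -2x_i e_r, which sums to -2j e_r Q by Euler's identity;
  -- differentiating X itself contributes -(r-1) e_r Q. This is the origin of r+2j-1 in the
  -- definition of X.
  have hi : ∀ i ∈ Finset.Icc 1 (r - 1), γ (e m i) (pd i (mulX γ r j l Q) x) =
      A • γ (e m i) (pd i Q x) + B • (γ (X * e m r) (γ (e m i) (pd i Q x)) -
        (2 : ℝ) • γ (e m r) (crd i x • pd i Q x)) +
      H • γ (crd i x • e m i) (Q x) + K • γ (crd i x • e m i) (γ (X * e m r) (Q x)) -
      B • γ (e m r) (Q x) := by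
    intro i hi
    rw [Finset.mem_Icc] at hi
    rw [pd_mulX hQd hr, mulX_eq, hH i hi.1 (by omega), hK i hi.1 (by omega), if_pos hi, ← hX]
    simp only [map_add, map_real_smul, γ_smul, mul_smul]
    have e1 : γ (e m i) (γ (X * e m r) (pd i Q x)) = γ (X * e m r) (γ (e m i) (pd i Q x)) -
        (2 : ℝ) • crd i x • γ (e m r) (pd i Q x) := by
      rw [← γ_mul, ← γ_mul, ← mul_assoc, e_mul_vec_of_le hi.1 hi.2 hr', sub_mul, neg_mul, mul_assoc,
        e_anticomm (show i ≠ r by omega), mul_neg, neg_neg, ← mul_assoc, map_sub,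
        LinearMap.sub_apply, ← Algebra.smul_def, γ_smul, mul_smul]
    have e2 : γ (e m i) (γ (e m i * e m r) (Q x)) = -γ (e m r) (Q x) := by
      rw [← γ_mul, ← mul_assoc, e_mul_self hi.1 (by omega)]
      simp
    rw [e1, e2, smul_neg, smul_comm H (crd i x), smul_comm K (crd i x)]
    abel
  rw [Finset.sum_congr rfl hi]
  simp only [Finset.sum_add_distrib, Finset.sum_sub_distrib, ← Finset.smul_sum]
  have s1 : ∑ i ∈ Finset.Icc 1 (r - 1), γ (crd i x • e m i) (Q x) = γ X (Q x) := by
    rw [hX, vec, map_sum, LinearMap.sum_apply]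
  have s2 : ∑ i ∈ Finset.Icc 1 (r - 1), γ (crd i x • e m i) (γ (X * e m r) (Q x)) =
      -((∑ i ∈ Finset.Icc 1 (r - 1), crd i x ^ 2) • γ (e m r) (Q x)) := by
    rw [← LinearMap.sum_apply, ← map_sum, ← vec, ← hX, ← γ_mul, ← mul_assoc, vec_mul_vec hr',
      ← Algebra.smul_def, γ_smul, neg_smul]
  rw [hD0, ← map_sum (γ (X * e m r)), hD0, ← map_sum (γ (e m r)), hE0, s1, s2, map_zero, smul_zero,
    Finset.sum_const, Nat.card_Icc, pd_mulX hQd hr, h0 r le_rfl, map_zero, if_neg (by omega), ← hX]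
  have e3 : γ (e m r) (γ (X * e m r) (Q x)) = γ X (Q x) := by
    rw [← γ_mul, ← mul_assoc, e_mul_vec_of_lt (by omega), neg_mul, mul_assoc,
      e_mul_self (by omega) hr]
    simp [hX]
  have e4 : (r - 1 + 1 - 1 : ℕ) • γ (e m r) (Q x) = ((r : ℝ) - 1) • γ (e m r) (Q x) := by
    rw [← Nat.cast_smul_eq_nsmul ℝ]
    congr 1
    rw [Nat.add_sub_cancel, Nat.cast_sub (by omega)]
    simp
  rw [e4]
  simp only [map_add, map_real_smul, e3, Pi.zero_apply, zero_add, zero_sub, add_zero]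
  set u := γ (e m r) (Q x)
  set w := γ X (Q x)
  -- What remains is a combination of XQ and e_r Q, and its two coefficients are the radial
  -- identities.
  have f1 : (H + pd r (bivFactor r j l) x) • w = 0 := by rw [hR1, zero_smul]
  have f2 : (pd r (harmFactor r j l) x - (∑ i ∈ Finset.Icc 1 (r - 1), crd i x ^ 2) * K
        - ((r : ℝ) + 2 * j - 1) * B) • u = 0 := by rw [hR2, zero_smul]
  calc _ = (H + pd r (bivFactor r j l) x) • w + (pd r (harmFactor r j l) x -
        (∑ i ∈ Finset.Icc 1 (r - 1), crd i x ^ 2) * K - ((r : ℝ) + 2 * j - 1) * B) • u := by module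
    _ = 0 := by rw [f1, f2, add_zero]

theorem sum_Icc_append {M : Type*} [AddCommMonoid M] {r : ℕ} (hr : r ≤ m) (f : ℕ → M) :
    ∑ i ∈ Finset.Icc 1 m, f i =
      ∑ i ∈ Finset.Icc 1 r, f i + ∑ i ∈ Finset.Icc (r + 1) m, f i := by
  rw [← Finset.sum_union]
  · congr 1
    ext i
    simp only [Finset.mem_union, Finset.mem_Icc]
    omega
  · rw [Finset.disjoint_left]
    intro i hi hi'
    rw [Finset.mem_Icc] at hi hi'
    omega

/-- Covariance holds for the full vector x; the coordinates beyond n are fixed by s and their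
generators commute with it, so that part can be subtracted. -/
theorem vec_rot {n : ℕ} (hn : n ≤ m) {s : Spin m} (hs : s ∈ subSpin m n) (x : E m) :
    (s : Cl m) * vec n (rot s⁻¹ x) = vec n x * (s : Cl m) := by
  have h5 : (s : Cl m) * ι (negNormSq m) (rot s⁻¹ x) = ι (negNormSq m) x * (s : Cl m) := by
    rw [ι_rot, inv_inv, ← mul_assoc, ← mul_assoc, spin_mul_inv, one_mul]
  rw [ι_eq_sum, ι_eq_sum x, sum_Icc_append hn, sum_Icc_append hn fun i => crd i x • e m i, mul_add,
    add_mul] at h5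
  have h6 : (s : Cl m) * ∑ i ∈ Finset.Icc (n + 1) m, crd i (rot s⁻¹ x) • e m i =
      (∑ i ∈ Finset.Icc (n + 1) m, crd i x • e m i) * (s : Cl m) := by
    rw [Finset.mul_sum, Finset.sum_mul]
    refine Finset.sum_congr rfl fun i hi => ?_
    rw [Finset.mem_Icc] at hi
    rw [crd_rot (inv_mem hs) (by omega), mul_smul_comm, spin_commute_e hs (by omega),
      smul_mul_assoc]
  rw [h6] at h5
  exact add_right_cancel h5

/-- Spin(r-1) preserves x_r and |x|_r, hence the scalar factors; the bivector is covariant because s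
also commutes with e_r. -/
theorem monFactor_rot {r : ℕ} (h1 : 1 ≤ r) (hr : r ≤ m) {s : Spin m} (hs : s ∈ subSpin m (r - 1))
    (j l : ℕ) (x : E m) :
    (s : Cl m) * monFactor r j l (rot s⁻¹ x) = monFactor r j l x * (s : Cl m) := by
  have hc : ∀ i, r ≤ i → crd i (rot s⁻¹ x) = crd i x :=
    fun i hi => crd_rot (inv_mem hs) (by omega) x
  have hq : ∑ i ∈ Finset.Icc 1 r, crd i (rot s⁻¹ x) ^ 2 = ∑ i ∈ Finset.Icc 1 r, crd i x ^ 2 := by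
    have h2 : ∀ y : E m, ∑ i ∈ Finset.Icc 1 m, crd i y ^ 2 =
        ∑ i ∈ Finset.Icc 1 r, crd i y ^ 2 + ∑ i ∈ Finset.Icc (r + 1) m, crd i y ^ 2 :=
      fun y => sum_Icc_append hr _
    have h3 := h2 (rot s⁻¹ x)
    rw [sum_crd_sq, norm_rot, ← sum_crd_sq, h2 x] at h3
    have h4 : ∑ i ∈ Finset.Icc (r + 1) m, crd i (rot s⁻¹ x) ^ 2 =
        ∑ i ∈ Finset.Icc (r + 1) m, crd i x ^ 2 := by
      refine Finset.sum_congr rfl fun i hi => ?_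
      rw [Finset.mem_Icc] at hi
      rw [hc i (by omega)]
    linarith
  have hh : ∀ j l, harmFactor r j l (rot s⁻¹ x) = harmFactor r j l x := by
    intro j l
    rw [harmFactor, harmFactor, hq, hc r le_rfl]
  rw [monFactor, monFactor, hh, hh, mul_add, add_mul, Algebra.commutes, mul_smul_comm,
    smul_mul_assoc]
  congr 2
  change (s : Cl m) * (vec (r - 1) (rot s⁻¹ x) * e m r) = vec (r - 1) x * e m r * (s : Cl m)
  rw [← mul_assoc, vec_rot (by omega) hs, mul_assoc, mul_assoc, spin_commute_e hs (by omega)]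

/-- The embedding operators are equivariant. -/
theorem lAction_mulX {r : ℕ} (h1 : 1 ≤ r) (hr : r ≤ m) {s : Spin m} (hs : s ∈ subSpin m (r - 1))
    (j l : ℕ) (Q : E m → T) :
    lAction γ s (mulX γ r j l Q) = mulX γ r j l (lAction γ s Q) := by
  ext x
  change γ (s : Cl m) (γ (monFactor r j l (rot s⁻¹ x)) (Q (rot s⁻¹ x))) =
    γ (monFactor r j l x) (γ (s : Cl m) (Q (rot s⁻¹ x)))
  rw [← γ_mul, ← γ_mul, monFactor_rot h1 hr hs]

end Operators


/-! ### Monogenic polynomials in the first variables -/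

section Branching

variable {m : ℕ} {T : Type*} [NormedAddCommGroup T] [NormedSpace ℂ T]
  {γ : Cl m →ₐ[ℝ] Module.End ℂ T}

/-- The space of `k`-homogeneous `R`-valued monogenic polynomials in the first `r` variables. -/
def monoVar (γ : Cl m →ₐ[ℝ] Module.End ℂ T) (r : ℕ) (R : Submodule ℂ T) (k : ℕ) :
    Submodule ℂ (E m → T) where
  carrier := {P | P ∈ monogenic γ R k ∧ ∀ i, r < i → pd i P = 0}
  zero_mem' := ⟨Submodule.zero_mem _, fun i _ => pd_zero i⟩
  add_mem' := by
    rintro P Q ⟨hP, hP'⟩ ⟨hQ, hQ'⟩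
    refine ⟨Submodule.add_mem _ hP hQ, fun i hi => ?_⟩
    rw [pd_add (homogPoly_differentiable hP.1) (homogPoly_differentiable hQ.1), hP' i hi, hQ' i hi,
      add_zero]
  smul_mem' := by
    rintro c P ⟨hP, hP'⟩
    refine ⟨Submodule.smul_mem _ c hP, fun i hi => ?_⟩
    rw [pd_smul (homogPoly_differentiable hP.1), hP' i hi, smul_zero]

theorem monoVar_le_monogenic (r : ℕ) (R : Submodule ℂ T) (k : ℕ) :
    monoVar γ r R k ≤ monogenic γ R k := fun _ hP => hP.1

theorem monoVar_top (R : Submodule ℂ T) (k : ℕ) : monoVar γ m R k = monogenic γ R k :=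
  le_antisymm (monoVar_le_monogenic _ _ _) fun _ hP => ⟨hP, fun _ hi => pd_of_lt hi _⟩

theorem monoVar_mono {r r' : ℕ} (hr : r ≤ r') {R R' : Submodule ℂ T} (h : R ≤ R') (k : ℕ) :
    monoVar γ r R k ≤ monoVar γ r' R' k := fun _ hP =>
  ⟨⟨homogPoly_mono h k hP.1.1, hP.1.2⟩, fun i hi => hP.2 i (hr.trans_lt hi)⟩

theorem monoVar_differentiable {r : ℕ} {R : Submodule ℂ T} {k : ℕ} {P : E m → T}
    (hP : P ∈ monoVar γ r R k) : Differentiable ℝ P := homogPoly_differentiable hP.1.1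

theorem mulX_mem_monoVar [FiniteDimensional ℂ T] {R : Submodule ℂ T} {r : ℕ} (h3 : 3 ≤ r)
    (hr : r ≤ m) (hR : EvenInv γ r R) {j : ℕ} {Q : E m → T} (hQ : Q ∈ monoVar γ (r - 1) R j)
    (l : ℕ) : mulX γ r j l Q ∈ monoVar γ r R (j + l) :=
  ⟨⟨homogPoly_mulX hR hQ.1.1 j l,
    dirac_mulX h3 hr hQ.1.1 hQ.1.2 (fun i hi => hQ.2 i (by omega)) l⟩,
    fun i hi => pd_mulX_of_lt (monoVar_differentiable hQ) (by omega) hr hi (hQ.2 i (by omega)) _ _⟩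

theorem pd_mem_monoVar [FiniteDimensional ℂ T] {R : Submodule ℂ T} {r k : ℕ} {P : E m → T}
    (hP : P ∈ monoVar γ r R k) (i : ℕ) : pd i P ∈ monoVar γ r R (k - 1) := by
  have hc : ∀ a b, pd a (pd b P) = pd b (pd a P) := pd_comm (homogPoly_contDiff hP.1.1)
  have hmem : ∀ a, pd a P ∈ homogPoly m R (k - 1) := fun a => (pd_mem_homogPoly hP.1.1 a).1
  have hd : ∀ a, Differentiable ℝ (pd a P) := fun a => homogPoly_differentiable (hmem a)
  refine ⟨⟨hmem i, fun x => ?_⟩, fun a ha => by rw [hc, hP.2 a ha, pd_zero]⟩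
  have h0 : ∑ a ∈ Finset.Icc 1 m, (fun x => γ (e m a) (pd a P x)) = 0 := by
    ext x
    rw [Finset.sum_apply, ← dirac_eq_sum, hP.1.2 x]
    rfl
  have h1 : ∀ a, Differentiable ℝ fun x => γ (e m a) (pd a P x) :=
    fun a => differentiable_linear (hd a) (γ (e m a))
  have h2 := congrFun (pd_sum (Finset.Icc 1 m) h1 i) x
  rw [h0, pd_zero, Finset.sum_apply] at h2
  rw [dirac_eq_sum, ← Pi.zero_apply (M := fun _ => T) x, h2]
  refine Finset.sum_congr rfl fun a _ => ?_
  rw [pd_linear (hd a), hc]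

/-- Differentiating in x_r lowers l with a nonzero factor until l = 0, where the operator is the
identity. -/
theorem mulX_eq_zero [FiniteDimensional ℂ T] {r : ℕ} (h3 : 3 ≤ r) (hr : r ≤ m) {R : Submodule ℂ T}
    {j i : ℕ} {Q : E m → T} (hQ : Q ∈ monoVar γ (r - 1) R i) {l : ℕ} (h : mulX γ r j l Q = 0) :
    Q = 0 := by
  induction l with
  | zero => rwa [mulX_zero_right] at h
  | succ l ih =>
    apply ih
    have h1 := pd_mulX_succ (γ := γ) (monoVar_differentiable hQ) h3 hr (hQ.2 r (by omega)) j l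
    rw [h, pd_zero] at h1
    exact (smul_eq_zero.1 h1.symm).resolve_left (by positivity)

theorem monoVar_zero_eq_const {r : ℕ} {R : Submodule ℂ T} {P : E m → T}
    (hP : P ∈ monoVar γ r R 0) : ∃ t ∈ R, P = fun _ => t := by
  refine ⟨P 0, homogPoly_apply_mem hP.1.1 0, funext fun x => ?_⟩
  have := homogPoly_smul_arg hP.1.1 0 x
  rw [zero_smul, pow_zero, one_smul] at this
  exact this.symm

theorem monoVar_apply_zero {r : ℕ} {R : Submodule ℂ T} {k : ℕ} (hk : k ≠ 0) {P : E m → T}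
    (hP : P ∈ monoVar γ r R k) : P 0 = 0 := by
  have := homogPoly_smul_arg hP.1.1 0 0
  rwa [zero_smul, zero_pow hk, zero_smul] at this

theorem const_mem_monoVar (r : ℕ) {R : Submodule ℂ T} {t : T} (ht : t ∈ R) :
    (fun _ => t) ∈ monoVar γ r R 0 := by
  refine ⟨⟨homogPoly_const ht, fun x => ?_⟩, fun i _ => pd_const i t⟩
  rw [dirac_eq_sum]
  simp [pd_const]

/-- The branching law for spherical monogenics. -/
theorem monoVar_eq_iSup [FiniteDimensional ℂ T] {R : Submodule ℂ T} {r : ℕ} (h3 : 3 ≤ r)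
    (hr : r ≤ m) (hR : EvenInv γ r R) (k : ℕ) : monoVar γ r R k =
      ⨆ j : Fin (k + 1), (monoVar γ (r - 1) R j).map (mulX γ r j (k - j)) := by
  have hle : ∀ k, ⨆ j : Fin (k + 1), (monoVar γ (r - 1) R j).map (mulX γ r j (k - j)) ≤
      monoVar γ r R k := by
    intro k
    refine iSup_le fun j => ?_
    rintro _ ⟨Q, hQ, rfl⟩
    have := mulX_mem_monoVar h3 hr hR hQ (k - j)
    rwa [Nat.add_sub_cancel' (by omega : (j : ℕ) ≤ k)] at this
  -- The kernel of ∂_{x_r} is the summand j = k, on which X^{(0)} is the identity.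
  have hbase : ∀ k, ∀ P ∈ monoVar γ r R k, pd r P = 0 →
      P ∈ ⨆ j : Fin (k + 1), (monoVar γ (r - 1) R j).map (mulX γ r j (k - j)) := by
    intro k P hP h0
    refine Submodule.mem_iSup_of_mem (Fin.last k) ⟨P, ⟨hP.1, fun i hi => ?_⟩, ?_⟩
    · rcases (by omega : i = r ∨ r < i) with rfl | h
      · exact h0
      · exact hP.2 i h
    · rw [Fin.val_last, Nat.sub_self, mulX_zero_right]
  refine le_antisymm ?_ (hle k)
  induction k with
  | zero =>
    intro P hP
    exact hbase 0 P hP ((pd_mem_homogPoly hP.1.1 r).2 rfl)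
  | succ k ih =>
    intro P hP
    have hD : pd r P ∈ ⨆ j : Fin (k + 1), (monoVar γ (r - 1) R j).map (mulX γ r j (k - j)) :=
      ih (pd_mem_monoVar hP r)
    -- By the Appell property the summand with index j has a primitive with the same j. The factor
    -- is j + (k-j) + 1 = k + 1 for every j.
    have hlift : ∀ D ∈ ⨆ j : Fin (k + 1), (monoVar γ (r - 1) R j).map (mulX γ r j (k - j)),
        ∃ P' ∈ ⨆ j : Fin (k + 1 + 1), (monoVar γ (r - 1) R j).map (mulX γ r j (k + 1 - j)),
          pd r P' = D := by
      intro D hD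
      induction hD using Submodule.iSup_induction' with
      | mem j D hD =>
        obtain ⟨Q, hQ, rfl⟩ := hD
        have hj : (j : ℕ) ≤ k := by omega
        have hQd := monoVar_differentiable hQ
        refine ⟨((k : ℝ) + 1)⁻¹ • mulX γ r j (k + 1 - j) Q, ?_, ?_⟩
        · rw [← Complex.coe_smul]
          refine Submodule.smul_mem _ _ (Submodule.mem_iSup_of_mem j.castSucc ⟨Q, ?_, ?_⟩)
          · simpa using hQ
          · simp
        · rw [pd_smul (differentiable_mulX hQd _ _ _), Nat.succ_sub hj,
            pd_mulX_succ hQd h3 hr (hQ.2 r (by omega)), smul_smul]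
          have : ((k : ℝ) + 1)⁻¹ * ((j : ℕ) + ((k - j : ℕ) : ℝ) + 1) = 1 := by
            rw [Nat.cast_sub hj]
            field_simp
            ring
          rw [this, one_smul]
      | zero => exact ⟨0, Submodule.zero_mem _, pd_zero r⟩
      | add D D' _ _ h1 h2 =>
        obtain ⟨P, hP, rfl⟩ := h1
        obtain ⟨P', hP', rfl⟩ := h2
        exact ⟨P + P', Submodule.add_mem _ hP hP',
          pd_add (monoVar_differentiable (hle _ hP)) (monoVar_differentiable (hle _ hP')) r⟩
    obtain ⟨P', hP', h1⟩ := hlift _ hD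
    have h2 := hbase (k + 1) (P - P') (Submodule.sub_mem _ hP (hle _ hP')) (by
      rw [pd_sub (monoVar_differentiable hP) (monoVar_differentiable (hle _ hP')), h1, sub_self])
    have := Submodule.add_mem _ h2 hP'
    rwa [sub_add_cancel] at this

/-! ### Two variables -/

/-- The Clifford algebra valued coordinate `x_1 - e_1 e_2 x_2`. -/
def zeta (x : E m) : Cl m := algebraMap ℝ (Cl m) (crd 1 x) - crd 2 x • (e m 1 * e m 2)

/-- The function `x ↦ (x_1 - e_1 e_2 x_2)^k t`. -/
def zPow (γ : Cl m →ₐ[ℝ] Module.End ℂ T) (k : ℕ) (t : T) : E m → T := fun x => γ (zeta x ^ k) t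

theorem zeta_commute (x : E m) : zeta x * (e m 1 * e m 2) = (e m 1 * e m 2) * zeta x := by
  rw [zeta, sub_mul, mul_sub, Algebra.commutes, smul_mul_assoc, mul_smul_comm]

theorem zPow_zero (t : T) : zPow γ 0 t = fun _ => t := by
  ext x; simp [zPow]

theorem zPow_succ (k : ℕ) (t : T) (x : E m) : zPow γ (k + 1) t x =
    crd 1 x • zPow γ k t x - crd 2 x • zPow γ k (γ (e m 1 * e m 2) t) x := by
  rw [zPow, pow_succ, γ_mul, zeta, map_sub, LinearMap.sub_apply, AlgHom.commutes,
    Module.algebraMap_end_apply, γ_smul, map_sub, map_real_smul, map_real_smul]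
  rfl

theorem zPow_biv (k : ℕ) (t : T) (x : E m) :
    zPow γ k (γ (e m 1 * e m 2) t) x = γ (e m 1 * e m 2) (zPow γ k t x) := by
  rw [zPow, zPow, ← γ_mul, ← γ_mul]
  congr 2
  exact (show Commute (zeta x) (e m 1 * e m 2) from zeta_commute x).pow_left k

theorem zPow_mem_homogPoly {R : Submodule ℂ T} (hR : EvenInv γ 2 R) (k : ℕ) {t : T} (ht : t ∈ R) :
    zPow γ k t ∈ homogPoly m R k := by
  induction k generalizing t with
  | zero => rw [zPow_zero]; exact homogPoly_const ht
  | succ k ih =>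
    have : zPow γ (k + 1) t = (fun x => crd 1 x • zPow γ k t x) -
        fun x => crd 2 x • zPow γ k (γ (e m 1 * e m 2) t) x := funext fun x => zPow_succ k t x
    rw [this]
    exact Submodule.sub_mem _ (homogPoly_crd_smul (ih ht) 1)
      (homogPoly_crd_smul (ih (hR 1 (by norm_num) 2 le_rfl t ht)) 2)

theorem evenInv_top (r : ℕ) : EvenInv γ r (⊤ : Submodule ℂ T) := fun _ _ _ _ _ _ => trivial

theorem differentiable_zPow (k : ℕ) (t : T) : Differentiable ℝ (zPow γ k t) :=
  homogPoly_differentiable (zPow_mem_homogPoly (evenInv_top 2) k (Submodule.mem_top (x := t)))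

/-- Since ζ = x_1 - e_1 e_2 x_2 commutes with e_1 e_2, its powers are differentiated as in the
commutative case. -/
theorem pd_zPow_succ (hm : 2 ≤ m) (i k : ℕ) (t : T) (x : E m) : pd i (zPow γ (k + 1) t) x =
    ((k : ℝ) + 1) • ((if i = 1 then zPow γ k t x else 0) -
      if i = 2 then zPow γ k (γ (e m 1 * e m 2) t) x else 0) := by
  have hz : ∀ k t, zPow γ (k + 1) t = (fun x => crd 1 x • zPow γ k t x) -
      fun x => crd 2 x • zPow γ k (γ (e m 1 * e m 2) t) x :=
    fun k t => funext fun x => zPow_succ k t x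
  have h1 : ∀ (i k : ℕ) (t : T), Differentiable ℝ fun x : E m => crd i x • zPow γ k t x :=
    fun i k t => (differentiable_crd i).smul (differentiable_zPow k t)
  have hp : ∀ k t, pd i (zPow γ (k + 1) t) x = crd 1 x • pd i (zPow γ k t) x -
      crd 2 x • pd i (zPow γ k (γ (e m 1 * e m 2) t)) x + ((if i = 1 then zPow γ k t x else 0) -
      if i = 2 then zPow γ k (γ (e m 1 * e m 2) t) x else 0) := by
    intro k t
    rw [hz, pd_sub (h1 _ _ _) (h1 _ _ _), Pi.sub_apply,
      pd_mul_smul (differentiable_crd 1) (differentiable_zPow _ _),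
      pd_mul_smul (differentiable_crd 2) (differentiable_zPow _ _), pd_crd, pd_crd]
    have a1 : (1 = i ∧ 1 ≤ 1 ∧ 1 ≤ m) ↔ i = 1 := by omega
    have a2 : (2 = i ∧ 1 ≤ 2 ∧ 2 ≤ m) ↔ i = 2 := by omega
    simp only [a1, a2, ite_smul, one_smul, zero_smul]
    abel
  induction k generalizing t with
  | zero => rw [hp, zPow_zero, zPow_zero, pd_const, pd_const]; simp
  | succ k ih =>
    rw [hp, ih, ih]
    by_cases i1 : i = 1
    · subst i1
      simp only [if_true, if_neg (show ¬ (1 = 2) by norm_num), sub_zero]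
      rw [zPow_succ k t]
      push_cast
      module
    · by_cases i2 : i = 2
      · subst i2
        simp only [if_true, if_neg (show ¬ (2 = 1) by norm_num), zero_sub]
        rw [zPow_succ k (γ (e m 1 * e m 2) t)]
        push_cast
        module
      · simp [i1, i2]

/-- The two Dirac terms cancel because e_2 (e_1 e_2) = e_1. -/
theorem zPow_mem_monoVar (hm : 2 ≤ m) {R : Submodule ℂ T} (hR : EvenInv γ 2 R) (k : ℕ) {t : T}
    (ht : t ∈ R) : zPow γ k t ∈ monoVar γ 2 R k := by
  cases k with
  | zero => rw [zPow_zero]; exact const_mem_monoVar 2 ht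
  | succ k =>
    refine ⟨⟨zPow_mem_homogPoly hR _ ht, fun x => ?_⟩, fun i hi => ?_⟩
    · rw [dirac_eq_sum, sum_Icc_split (r := 2) (by omega) hm]
      · rw [show (2 - 1 : ℕ) = 1 from rfl, Finset.Icc_self, Finset.sum_singleton,
          pd_zPow_succ hm, pd_zPow_succ hm]
        simp only [if_true, if_neg (show ¬ (1 = 2) by norm_num),
          if_neg (show ¬ (2 = 1) by norm_num), zero_sub, sub_zero]
        rw [zPow_biv, map_real_smul, map_real_smul, map_neg, ← γ_mul,
          show e m 2 * (e m 1 * e m 2) = e m 1 by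
            rw [← mul_assoc, e_anticomm (by norm_num), neg_mul, mul_assoc,
              e_mul_self (by norm_num) hm]
            simp]
        simp
      · intro i hi
        rw [pd_zPow_succ hm, if_neg (by omega), if_neg (by omega)]
        simp
    · ext x
      rw [pd_zPow_succ hm, if_neg (by omega), if_neg (by omega)]
      simp

/-- By induction ∂_{x_1}P is a power of ζ, and has a primitive of the same kind. The difference has
zero x_1-derivative, hence zero x_2-derivative by the Dirac equation, and vanishes by Euler's
identity. -/
theorem exists_eq_zPow [FiniteDimensional ℂ T] (hm : 2 ≤ m) {R : Submodule ℂ T}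
    (hR : EvenInv γ 2 R) {k : ℕ} {P : E m → T} (hP : P ∈ monoVar γ 2 R k) :
    ∃ t ∈ R, P = zPow γ k t := by
  induction k generalizing P with
  | zero =>
    obtain ⟨t, ht, rfl⟩ := monoVar_zero_eq_const hP
    exact ⟨t, ht, (zPow_zero t).symm⟩
  | succ k ih =>
    obtain ⟨t, ht, h1⟩ := ih (pd_mem_monoVar hP 1)
    have hct : (((k : ℝ) + 1)⁻¹ : ℝ) • t ∈ R := by
      rw [← Complex.coe_smul]; exact R.smul_mem _ ht
    refine ⟨(((k : ℝ) + 1)⁻¹ : ℝ) • t, hct, ?_⟩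
    set Z := zPow γ (k + 1) ((((k : ℝ) + 1)⁻¹ : ℝ) • t) with hZ
    have hZm : Z ∈ monoVar γ 2 R (k + 1) := zPow_mem_monoVar hm hR _ hct
    have hQ : P - Z ∈ monoVar γ 2 R (k + 1) := Submodule.sub_mem _ hP hZm
    have h2 : pd 1 (P - Z) = 0 := by
      rw [pd_sub (monoVar_differentiable hP) (monoVar_differentiable hZm), h1, sub_eq_zero]
      ext x
      rw [hZ, pd_zPow_succ hm, if_pos rfl, if_neg (by norm_num), sub_zero, zPow, zPow,
        map_real_smul, smul_smul, mul_inv_cancel₀ (by positivity), one_smul]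
    have h3 : pd 2 (P - Z) = 0 := by
      ext x
      have h4 := hQ.1.2 x
      rw [dirac_eq_sum, sum_Icc_split (r := 2) (by omega) hm _
        (fun i hi => by rw [hQ.2 i hi]; simp), show (2 - 1 : ℕ) = 1 from rfl, Finset.Icc_self,
        Finset.sum_singleton, h2, Pi.zero_apply, map_zero, zero_add] at h4
      have h5 := congrArg (γ (e m 2)) h4
      rw [← γ_mul, e_mul_self (by norm_num) hm, map_zero] at h5
      simpa using h5
    have h6 : P - Z = 0 := by
      refine eq_zero_of_pd_eq_zero (Nat.succ_ne_zero k) hQ.1.1 fun i hi _ => ?_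
      rcases (by omega : i = 1 ∨ i = 2 ∨ 2 < i) with rfl | rfl | h
      · exact h2
      · exact h3
      · exact hQ.2 i h
    exact sub_eq_zero.1 h6

/-! ### The action of the spin groups -/

theorem pd_lAction [FiniteDimensional ℂ T] {r i : ℕ} (hi : r < i) {s : Spin m}
    (hs : s ∈ subSpin m r) {P : E m → T} (hP : Differentiable ℝ P) :
    pd i (lAction γ s P) = lAction γ s (pd i P) := by
  by_cases him : i ≤ m
  · ext x
    have h2 : HasFDerivAt (fun y => rot s⁻¹ y) (rot (s⁻¹)).toContinuousLinearMap x :=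
      (rot (s⁻¹)).toContinuousLinearMap.hasFDerivAt
    have h3 : HasFDerivAt (fun y => P (rot s⁻¹ y)) _ x := (hP (rot s⁻¹ x)).hasFDerivAt.comp x h2
    have h4 : Differentiable ℝ fun y => P (rot s⁻¹ y) :=
      hP.comp (rot (s⁻¹)).toContinuousLinearMap.differentiable
    have h5 := pd_linear h4 (γ (s : Cl m)) i x
    refine h5.trans ?_
    change γ (s : Cl m) (fderiv ℝ (fun y => P (rot s⁻¹ y)) x (bv m i)) =
      γ (s : Cl m) (fderiv ℝ P (rot s⁻¹ x) (bv m i))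
    rw [h3.fderiv]
    congr 1
    change fderiv ℝ P (rot s⁻¹ x) (rot s⁻¹ (bv m i)) = _
    rw [inv_mem hs i hi him]
  · rw [pd_of_lt (by omega), pd_of_lt (by omega), map_zero]

/-- The whole module as a subrepresentation. -/
def topSub (γ : Cl m →ₐ[ℝ] Module.End ℂ T) : Subrepresentation (spinRep γ) where
  toSubmodule := ⊤
  apply_mem_toSubmodule _ _ _ := trivial

theorem inv_monoVar [FiniteDimensional ℂ T] {r : ℕ} (h1 : 1 ≤ r) (hr : r ≤ m) {R : Submodule ℂ T}
    (hR : EvenInv γ r R) (k : ℕ) : Inv (lAction γ) (subSpin m r) (monoVar γ r R k) := by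
  intro s hs P hP
  refine ⟨⟨homogPoly_comp hP.1.1 (rot s⁻¹) (γ (s : Cl m)) fun t ht =>
    hR.apply_mem (subSpin_mem_evenAlg h1 hr hs) ht, ?_⟩, fun i hi => ?_⟩
  -- `R` is invariant only under Spin(r), so invariance of the Dirac equation is taken from the
  -- whole module.
  · have : P ∈ monogenic γ (topSub γ).toSubmodule k := ⟨homogPoly_mono le_top k hP.1.1, hP.1.2⟩
    exact ((monogenicSub γ (topSub γ) k).apply_mem_toSubmodule s this).2
  · rw [pd_lAction hi hs (monoVar_differentiable hP), hP.2 i hi, map_zero]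

end Branching


/-! ### Weights -/

section Weights

variable {m : ℕ} {T : Type*} [NormedAddCommGroup T] [NormedSpace ℂ T]
  {γ : Cl m →ₐ[ℝ] Module.End ℂ T}

/-- The element `cos 1 + sin 1 e_1 e_2` of `Spin(2)`. -/
theorem exists_torus (hm : 2 ≤ m) : ∃ g ∈ subSpin m 2,
    (g : Cl m) = algebraMap ℝ (Cl m) (Real.cos 1) + Real.sin 1 • (e m 1 * e m 2) := by
  -- The torus element is e_1 times this unit vector; the minus sign compensates e_1² = -1.
  have hn : ‖(-Real.cos 1) • bv m 1 + Real.sin 1 • bv m 2‖ = 1 := by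
    have h : ‖(-Real.cos 1) • bv m 1 + Real.sin 1 • bv m 2‖ ^ 2 = 1 := by
      rw [norm_add_sq_real, norm_smul, norm_smul, norm_bv (by norm_num) (by omega),
        norm_bv (by norm_num) hm, inner_smul_left, inner_smul_right, inner_bv]
      simp
    exact (pow_eq_one_iff_of_nonneg (norm_nonneg _) two_ne_zero).1 h
  refine ⟨unitPair (bv m 1) _ (norm_bv (by norm_num) (by omega)) hn, ?_, ?_⟩
  · intro i hi him
    refine rot_unitPair_of_orthogonal _ _ ?_ ?_
    · rw [inner_bv, if_neg (by omega)]
    · rw [inner_add_left, inner_smul_left, inner_smul_left, inner_bv, inner_bv, if_neg (by omega),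
        if_neg (by omega)]
      simp
  · rw [coe_unitPair, map_add, map_smul, map_smul, mul_add, mul_smul_comm, mul_smul_comm]
    change (-Real.cos 1) • (e m 1 * e m 1) + Real.sin 1 • (e m 1 * e m 2) = _
    rw [e_mul_self le_rfl (by omega), Algebra.algebraMap_eq_smul_one]
    simp

/-- A generator of a dense subgroup of the torus `Spin(2)`. -/
def torus (hm : 2 ≤ m) : Spin m := (exists_torus hm).choose

theorem torus_mem (hm : 2 ≤ m) : torus hm ∈ subSpin m 2 := (exists_torus hm).choose_spec.1

theorem coe_torus (hm : 2 ≤ m) : (torus hm : Cl m) =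
    algebraMap ℝ (Cl m) (Real.cos 1) + Real.sin 1 • (e m 1 * e m 2) :=
  (exists_torus hm).choose_spec.2

theorem zeta_eq (hm : 2 ≤ m) (x : E m) : zeta x = -(e m 1 * vec 2 x) := by
  rw [vec, show Finset.Icc 1 2 = {1, 2} by rfl, Finset.sum_pair (by norm_num), mul_add,
    mul_smul_comm, mul_smul_comm, e_mul_self le_rfl (by omega), zeta,
    Algebra.algebraMap_eq_smul_one]
  module

/-- Here ζ = -e_1 (x_1 e_1 + x_2 e_2). Conjugation by the inverse of g and e_1 g⁻¹ = g e_1 turn ζ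
into g ζ g, and g commutes with ζ. -/
theorem zeta_torus (hm : 2 ≤ m) (x : E m) :
    zeta (rot (torus hm)⁻¹ x) = (torus hm : Cl m) ^ 2 * zeta x := by
  set J := e m 1 * e m 2 with hJ
  set g := torus hm with hg
  have hgJ : (g : Cl m) = Real.cos 1 • (1 : Cl m) + Real.sin 1 • J := by
    rw [hg, coe_torus hm, Algebra.algebraMap_eq_smul_one]
  set g' : Cl m := Real.cos 1 • (1 : Cl m) - Real.sin 1 • J with hg'
  have hJJ : J * J = -1 := e_one_mul_sq (by norm_num) hm
  have h1 : g' * (g : Cl m) = 1 := by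
    have h7 : Real.cos 1 * Real.cos 1 + Real.sin 1 * Real.sin 1 = 1 := by
      have := Real.cos_sq_add_sin_sq 1; nlinarith
    rw [hg', hgJ, sub_mul, mul_add, mul_add]
    simp only [smul_mul_assoc, mul_smul_comm, one_mul, mul_one, hJJ]
    calc _ = (Real.cos 1 * Real.cos 1 + Real.sin 1 * Real.sin 1) • (1 : Cl m) := by module
      _ = 1 := by rw [h7, one_smul]
  have h2 : e m 1 * g' = (g : Cl m) * e m 1 := by
    have : e m 1 * J = -(J * e m 1) := by
      rw [hJ, mul_assoc, e_anticomm (show 2 ≠ 1 by norm_num), mul_neg, neg_neg]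
    rw [hg', hgJ, mul_sub, add_mul, mul_smul_comm, mul_smul_comm, this, smul_mul_assoc,
      smul_mul_assoc, one_mul, mul_one]
    module
  have h3 : zeta x * (g : Cl m) = (g : Cl m) * zeta x := by
    rw [hgJ, mul_add, add_mul, mul_smul_comm, mul_smul_comm, zeta_commute, smul_mul_assoc,
      smul_mul_assoc, one_mul, mul_one]
  have h4 : vec 2 (rot g⁻¹ x) = g' * (vec 2 x * (g : Cl m)) := by
    rw [← vec_rot hm (torus_mem hm) x, ← hg, ← mul_assoc, h1, one_mul]
  rw [zeta_eq hm, h4, ← mul_assoc, h2, mul_assoc, ← mul_assoc (e m 1), ← mul_neg, ← neg_mul,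
    ← zeta_eq hm, h3, pow_two, mul_assoc]

theorem torus_apply (hm : 2 ≤ m) {ε : ℤˣ} {t : T} (ht : t ∈ thetaEig γ 1 ε) :
    γ (torus hm : Cl m) t = Complex.exp ((ε : ℤ) * Complex.I) • t := by
  rw [mem_thetaEig, theta_apply, pow_one] at ht
  have hv : vol m (2 * 1) = e m 1 * e m 2 := by
    rw [show 2 * 1 = 0 + 1 + 1 from rfl, vol_succ, vol_succ, vol_zero, one_mul]
  rw [hv] at ht
  have h1 : γ (e m 1 * e m 2) t = (((ε : ℤ) : ℂ) * Complex.I) • t := by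
    have := congrArg (Complex.I • ·) ht
    simp only [smul_smul] at this
    rw [mul_neg, Complex.I_mul_I, neg_neg, one_smul] at this
    rw [this, mul_comm]
  rw [coe_torus hm, map_add, LinearMap.add_apply, AlgHom.commutes, Module.algebraMap_end_apply,
    γ_smul, h1, ← Complex.coe_smul, ← Complex.coe_smul, smul_smul, ← add_smul]
  congr 1
  rw [Complex.exp_mul_I]
  rcases Int.units_eq_one_or ε with rfl | rfl <;> simp

/-- The eigenspace of the torus element for the weight `n`. -/
def weightSpace (γ : Cl m →ₐ[ℝ] Module.End ℂ T) (hm : 2 ≤ m) (n : ℤ) : Submodule ℂ (E m → T) :=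
  Module.End.eigenspace (lAction γ (torus hm)) (Complex.exp (n * Complex.I))

theorem mem_weightSpace {hm : 2 ≤ m} {n : ℤ} {P : E m → T} : P ∈ weightSpace γ hm n ↔
    lAction γ (torus hm) P = Complex.exp (n * Complex.I) • P := Module.End.mem_eigenspace_iff

/-- By irrationality of π, a single rotation with parameter 1 separates all integer weights, so the
whole torus is not needed. -/
theorem exp_int_mul_I_injective : Function.Injective fun n : ℤ => Complex.exp (n * Complex.I) := by
  intro a b h
  obtain ⟨n, hn⟩ := Complex.exp_eq_exp_iff_exists_int.1 h
  have h1 : (a : ℂ) = b + n * (2 * Real.pi) := by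
    apply mul_right_cancel₀ Complex.I_ne_zero
    rw [hn]; ring
  have h2 : (a : ℝ) = b + n * (2 * Real.pi) := by exact_mod_cast h1
  by_cases h0 : n = 0
  · subst h0
    simpa using h2
  · exfalso
    have h3 : Real.pi = ((a - b : ℤ) : ℝ) / ((2 * n : ℤ) : ℝ) := by
      have : (n : ℝ) ≠ 0 := by exact_mod_cast h0
      push_cast
      field_simp
      linarith
    apply irrational_pi
    exact ⟨((a - b : ℤ) : ℚ) / ((2 * n : ℤ) : ℚ), by rw [h3]; push_cast; rfl⟩

theorem weightSpace_iSupIndep (hm : 2 ≤ m) : iSupIndep (weightSpace γ hm) :=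
  (Module.End.eigenspaces_iSupIndep (lAction γ (torus hm))).comp exp_int_mul_I_injective

/-- The torus acts once on the value and twice on each of the k factors ζ, which gives 2k+1. -/
theorem zPow_mem_weightSpace (hm : 2 ≤ m) (k : ℕ) {ε : ℤˣ} {t : T} (ht : t ∈ thetaEig γ 1 ε) :
    zPow γ k t ∈ weightSpace γ hm (ε * (2 * k + 1)) := by
  rw [mem_weightSpace]
  ext x
  change γ (torus hm : Cl m) (γ (zeta (rot (torus hm)⁻¹ x) ^ k) t) =
    Complex.exp (((ε : ℤ) * (2 * k + 1) : ℤ) * Complex.I) • γ (zeta x ^ k) t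
  have h1 : Commute (zeta x) (torus hm : Cl m) := by
    rw [coe_torus hm]
    exact ((Algebra.commute_algebraMap_right _ _).add_right
      (Commute.smul_right (zeta_commute x) _))
  rw [zeta_torus, ((h1.symm.pow_left 2).mul_pow k), ← γ_mul, ← mul_assoc, ← pow_mul, ← pow_succ',
    (h1.symm.pow_pow (2 * k + 1) k).eq, γ_mul]
  have h2 : ∀ n : ℕ, γ ((torus hm : Cl m) ^ n) t = Complex.exp ((ε : ℤ) * Complex.I) ^ n • t := by
    intro n
    induction n with
    | zero => simp
    | succ n ih => rw [pow_succ', γ_mul, ih, map_smul, torus_apply hm ht, smul_smul, pow_succ]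
  rw [h2, map_smul, ← Complex.exp_nat_mul]
  congr 2
  push_cast
  ring

/-- The weights of `k`-homogeneous monogenic polynomials. -/
theorem monoVar_le_weightSpace [FiniteDimensional ℂ T] (hm : 2 ≤ m) {r : ℕ} (h2 : 2 ≤ r)
    (hr : r ≤ m) {R : Submodule ℂ T} (hR : EvenInv γ r R) (k : ℕ) :
    monoVar γ r R k ≤ ⨆ n ∈ {n : ℤ | |n| ≤ 2 * k + 1}, weightSpace γ hm n := by
  induction r, h2 using Nat.le_induction generalizing R k with
  | base =>
    intro P hP
    obtain ⟨t, ht, rfl⟩ := exists_eq_zPow hm hR hP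
    have key : R ≤ (⨆ n ∈ {n : ℤ | |n| ≤ 2 * k + 1}, weightSpace γ hm n).comap
        { toFun := zPow γ k
          map_add' := fun s t => by ext x; simp [zPow]
          map_smul' := fun c t => by ext x; exact map_smul _ c t : T →ₗ[ℂ] (E m → T) } := by
      rw [hR.eq_sup_thetaEig (p := 1) (by norm_num) hr]
      refine iSup_le fun ε => ?_
      rintro t ⟨-, ht⟩
      refine Submodule.mem_iSup_of_mem _ (Submodule.mem_iSup_of_mem ?_ (zPow_mem_weightSpace hm k ht))
      rw [Set.mem_ofPred_eq, abs_mul]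
      rcases Int.units_eq_one_or ε with rfl | rfl <;>
        simp [abs_of_nonneg (by positivity : (0 : ℤ) ≤ 2 * k + 1)]
    exact key ht
  | succ r h2 ih =>
    -- The embedding operators commute with the torus, so weights are inherited from degrees j ≤ k
    -- in fewer variables.
    rw [monoVar_eq_iSup (by omega) hr hR, Nat.add_sub_cancel]
    refine iSup_le fun j => ?_
    rw [Submodule.map_le_iff_le_comap]
    refine (ih (by omega) (hR.mono (Nat.le_succ r)) j).trans ?_
    refine iSup_le fun n => iSup_le fun hn => ?_
    intro P hP
    refine Submodule.mem_iSup_of_mem n (Submodule.mem_iSup_of_mem ?_ ?_)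
    · rw [Set.mem_ofPred_eq] at hn ⊢
      have : (j : ℕ) ≤ k := by omega
      omega
    · rw [mem_weightSpace] at hP ⊢
      rw [lAction_mulX (by omega) hr (subSpin_mono (by omega) (torus_mem hm)), hP, map_smul]

/-- The extreme weight is attained by ζ^k t, with t an eigenvector of θ_2 in `R`. -/
theorem exists_highest [FiniteDimensional ℂ T] (hm : 2 ≤ m) {r : ℕ} (h2 : 2 ≤ r)
    {R : Submodule ℂ T} (hR : EvenInv γ r R) (h0 : R ≠ ⊥) (k : ℕ) :
    ∃ n : ℤ, |n| = 2 * k + 1 ∧ ∃ P ∈ monoVar γ r R k, P ∈ weightSpace γ hm n ∧ P ≠ 0 := by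
  have h1 : ∃ ε : ℤˣ, R ⊓ thetaEig γ 1 ε ≠ ⊥ := by
    by_contra! hcon
    apply h0
    rw [(hR.mono h2).eq_sup_thetaEig (p := 1) (by norm_num) hm]
    simp [hcon]
  obtain ⟨ε, hε⟩ := h1
  obtain ⟨t, ht, ht0⟩ := Submodule.exists_mem_ne_zero_of_ne_bot hε
  refine ⟨ε * (2 * k + 1), ?_, zPow γ k t,
    monoVar_mono h2 le_rfl k (zPow_mem_monoVar hm (hR.mono h2) k ht.1),
    zPow_mem_weightSpace hm k ht.2, ?_⟩
  · rw [abs_mul]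
    rcases Int.units_eq_one_or ε with rfl | rfl <;>
      simp [abs_of_nonneg (by positivity : (0 : ℤ) ≤ 2 * k + 1)]
  · intro h
    have := congrFun h (bv m 1)
    rw [zPow, zeta, crd_bv, crd_bv, if_pos (by omega), if_neg (by omega)] at this
    simp at this
    exact ht0 this

/-- Monogenic polynomials of different degrees are inequivalent. -/
theorem noHom_monoVar_of_lt [FiniteDimensional ℂ T] {r : ℕ} (h2 : 2 ≤ r) (hr : r ≤ m)
    {R R' : Submodule ℂ T} (hR : EvenInv γ r R) (h0 : R ≠ ⊥) (hR' : EvenInv γ r R') {j j' : ℕ}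
    (hj : j' < j) (hU : Irr (lAction γ) (subSpin m r) (monoVar γ r R j)) :
    NoHom (lAction γ) (subSpin m r) (monoVar γ r R j) (monoVar γ r R' j') := by
  intro φ h1 hφ
  have hm : 2 ≤ m := h2.trans hr
  obtain ⟨n, hn, P, hP, hPw, hP0⟩ := exists_highest hm h2 hR h0 j
  have hφP : φ P = 0 := by
    have a1 := monoVar_le_weightSpace hm h2 hr hR' j' (h1 P hP)
    -- The image of the extreme weight vector has a weight absent from degree j' < j, so it is zero;
    -- the invariant kernel is then everything.
    have a2 : φ P ∈ weightSpace γ hm n := by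
      rw [mem_weightSpace] at hPw ⊢
      rw [← hφ _ (subSpin_mono h2 (torus_mem hm)) P hP, hPw, map_smul]
    have a3 := (weightSpace_iSupIndep (γ := γ) hm).disjoint_biSup
      (x := n) (y := {n : ℤ | |n| ≤ 2 * j' + 1}) (by rw [Set.mem_ofPred_eq]; omega)
    exact Submodule.disjoint_def.1 a3 _ a2 a1
  have h3 : monoVar γ r R j ⊓ LinearMap.ker φ = monoVar γ r R j := by
    refine hU.2.2 _ inf_le_left ?_ ?_
    · intro g hg x hx
      refine ⟨hU.2.1 g hg x hx.1, ?_⟩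
      have : φ x = 0 := hx.2
      change φ (lAction γ g x) = 0
      rw [hφ g hg x hx.1, this, map_zero]
    · intro hb
      have : P ∈ monoVar γ r R j ⊓ LinearMap.ker φ := ⟨hP, hφP⟩
      rw [hb] at this
      exact hP0 this
  intro x hx
  rw [← h3] at hx
  exact hx.2

theorem noHom_monoVar_of_ne [FiniteDimensional ℂ T] {r : ℕ} (h2 : 2 ≤ r) (hr : r ≤ m)
    {R R' : Submodule ℂ T} (hR : EvenInv γ r R) (h0 : R ≠ ⊥) (hR' : EvenInv γ r R')
    (h0' : R' ≠ ⊥) {j j' : ℕ} (hj : j ≠ j')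
    (hU : Irr (lAction γ) (subSpin m r) (monoVar γ r R j))
    (hU' : Irr (lAction γ) (subSpin m r) (monoVar γ r R' j')) :
    NoHom (lAction γ) (subSpin m r) (monoVar γ r R j) (monoVar γ r R' j') := by
  rcases lt_or_gt_of_ne hj with h | h
  · exact (noHom_monoVar_of_lt h2 hr hR' h0' hR h hU').symm hU' hU
  · exact noHom_monoVar_of_lt h2 hr hR h0 hR' h hU

/-! ### The central element in even dimensions -/

/-- The element e_1...e_{2p} is a product of half-turns in the coordinate planes, hence acts as -1
on the first 2p coordinates. -/
theorem exists_central {p : ℕ} (hp : 2 * p ≤ m) : ∃ s ∈ subSpin m (2 * p),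
    (s : Cl m) = vol m (2 * p) ∧ ∀ x, ∀ i, 1 ≤ i → i ≤ 2 * p → crd i (rot s x) = -crd i x := by
  induction p with
  | zero => exact ⟨1, one_mem _, by simp [vol_zero], fun x i h1 h2 => by omega⟩
  | succ p ih =>
    obtain ⟨s, hs, hv, hc⟩ := ih (by omega)
    have ha : 1 ≤ 2 * p + 1 ∧ 2 * p + 1 ≤ m := by omega
    have hb : 1 ≤ 2 * p + 2 ∧ 2 * p + 2 ≤ m := by omega
    refine ⟨s * bvPair m ha hb, mul_mem (subSpin_mono (by omega) hs)
      (bvPair_mem ha hb (by omega) (by omega)), ?_, ?_⟩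
    · rw [show 2 * (p + 1) = 2 * p + 1 + 1 by ring, vol_succ, vol_succ, ← hv, mul_assoc]
      rfl
    · intro x i h1 h2
      rw [rot_mul]
      by_cases hi : i ≤ 2 * p
      · rw [hc _ i h1 hi, crd, crd, ← inner_rot (bvPair m ha hb) (bv m i) x,
          rot_bvPair_of_ne ha hb (by omega) (by omega)]
      · rw [crd_rot hs (by omega), crd, crd, ← inner_rot (bvPair m ha hb) (bv m i) x]
        rcases (by omega : i = 2 * p + 1 ∨ i = 2 * p + 2) with rfl | rfl
        · rw [rot_bvPair_left ha hb (by omega), inner_neg_left, neg_neg]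
        · rw [rot_bvPair_right ha hb (by omega), inner_neg_left, neg_neg]

/-- The two signs give inequivalent modules in even dimensions. -/
theorem noHom_monoVar_sign {p : ℕ} (hp : 2 * p ≤ m) {R R' : Submodule ℂ T} {ε δ : ℤˣ}
    (hεδ : ε ≠ δ) (hR : R ≤ thetaEig γ p ε) (hR' : R' ≤ thetaEig γ p δ) (j : ℕ) :
    NoHom (lAction γ) (subSpin m (2 * p)) (monoVar γ (2 * p) R j) (monoVar γ (2 * p) R' j) := by
  obtain ⟨s, hs, hv, hc⟩ := exists_central hp
  have hc' : ∀ x, ∀ i, 1 ≤ i → i ≤ 2 * p → crd i (rot s⁻¹ x) = crd i ((-1 : ℝ) • x) := by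
    intro x i h1 h2
    have := hc (rot s⁻¹ x) i h1 h2
    rw [← rot_mul, mul_inv_cancel, rot_one] at this
    rw [crd, crd, inner_smul_right]
    rw [crd, crd] at this
    rw [this]; ring
  -- The sign (-1)^j comes from homogeneity at -x, and i^p ε from the pseudoscalar on the values;
  -- for equal degrees the scalars differ exactly when the signs do.
  have key : ∀ {R : Submodule ℂ T} {ε : ℤˣ}, R ≤ thetaEig γ p ε → ∀ P ∈ monoVar γ (2 * p) R j,
      lAction γ s P = ((-1) ^ j * Complex.I ^ p * ((ε : ℤ) : ℂ)) • P := by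
    intro R ε hR P hP
    ext x
    change γ (s : Cl m) (P (rot s⁻¹ x)) = ((-1) ^ j * Complex.I ^ p * ((ε : ℤ) : ℂ)) • P x
    rw [eq_of_crd_eq (monoVar_differentiable hP) hP.2 (hc' x), homogPoly_smul_arg hP.1.1,
      map_real_smul, hv]
    have h1 := mem_thetaEig.1 (hR (homogPoly_apply_mem hP.1.1 x))
    rw [theta_apply] at h1
    have h2 : γ (vol m (2 * p)) (P x) = (Complex.I ^ p * ((ε : ℤ) : ℂ)) • P x := by
      have := congrArg (Complex.I ^ p • ·) h1
      simp only [smul_smul] at this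
      rwa [← mul_pow, mul_neg, Complex.I_mul_I, neg_neg, one_pow, one_smul] at this
    rw [h2, ← Complex.coe_smul, smul_smul]
    congr 1
    push_cast
    ring
  intro φ h1 h2 x hx
  have h3 := h2 s hs x hx
  rw [key hR x hx, key hR' _ (h1 x hx), map_smul, ← sub_eq_zero, ← sub_smul, ← mul_sub] at h3
  refine (smul_eq_zero.1 h3).resolve_left (mul_ne_zero (mul_ne_zero ?_ ?_) ?_)
  · exact pow_ne_zero _ (by norm_num)
  · exact pow_ne_zero _ Complex.I_ne_zero
  · rw [sub_ne_zero]
    intro h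
    exact hεδ (Units.ext (by exact_mod_cast h))

end Weights


/-! ### Irreducibility -/

section Irreducibility

variable {m : ℕ} {T : Type*} [NormedAddCommGroup T] [NormedSpace ℂ T]
  {γ : Cl m →ₐ[ℝ] Module.End ℂ T}

theorem theta_e {p a : ℕ} (ha : a ≤ 2 * p) (t : T) :
    γ (e m a) (theta γ p t) = -theta γ p (γ (e m a) t) := by
  have h := vol_mul_e_of_le (m := m) ha
  rw [pow_succ, pow_mul, neg_one_sq, one_pow, one_mul, neg_one_smul] at h
  rw [theta_apply, theta_apply, map_smul, ← γ_mul, ← γ_mul, h, map_neg, LinearMap.neg_apply,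
    smul_neg, neg_neg]

/-- Decomposition of the values into the two eigenspaces of `θ_{2p}`. -/
theorem monoVar_eq_iSup_thetaEig [FiniteDimensional ℂ T] {p : ℕ} (hp : 2 * p ≤ m) {R : Submodule ℂ T}
    (hR : EvenInv γ (2 * p) R) (j : ℕ) :
    monoVar γ (2 * p) R j = ⨆ ε : ℤˣ, monoVar γ (2 * p) (R ⊓ thetaEig γ p ε) j := by
  refine le_antisymm ?_ (iSup_le fun ε => monoVar_mono le_rfl inf_le_left j)
  intro P hP
  have hPd := monoVar_differentiable hP
  set A : ℤˣ → T →ₗ[ℂ] T := fun ε =>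
    (1 / 2 : ℂ) • (LinearMap.id + ((ε : ℤ) : ℂ) • theta γ p) with hA
  have hAa : ∀ ε t, A ε t = (1 / 2 : ℂ) • (t + ((ε : ℤ) : ℂ) • theta γ p t) := fun ε t => rfl
  have hmem : ∀ ε : ℤˣ, (fun x => A ε (P x)) ∈ monoVar γ (2 * p) (R ⊓ thetaEig γ p ε) j := by
    intro ε
    refine ⟨⟨homogPoly_linear_map hP.1.1 (A ε) fun t ht => ⟨?_, mem_thetaEig.2 ?_⟩, fun x => ?_⟩,
      fun i hi => ?_⟩
    · exact R.smul_mem _ (R.add_mem ht (R.smul_mem _ (hR.theta_mem le_rfl ht)))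
    · rw [hAa, map_smul, map_add, map_smul, theta_theta hp, smul_comm, smul_add, smul_add,
        smul_smul ((ε : ℤ) : ℂ), units_int_sq, one_smul, smul_add, add_comm]
    · rw [dirac_eq_sum]
      -- Each e_a with a ≤ 2p anticommutes with θ and so exchanges the projections, while
      -- derivatives beyond 2p vanish. The Dirac operator of one component is therefore the opposite
      -- component of the Dirac operator of P.
      have h1 : ∀ a ∈ Finset.Icc 1 m, γ (e m a) (pd a (fun x => A ε (P x)) x) =
          A (-ε) (γ (e m a) (pd a P x)) := by
        intro a _
        rw [pd_linear hPd]
        by_cases ha : a ≤ 2 * p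
        · rw [hAa, hAa, map_smul, map_add, map_smul, theta_e ha]
          simp
        · rw [hP.2 a (by omega)]
          simp
      rw [Finset.sum_congr rfl h1, ← map_sum, ← dirac_eq_sum, hP.1.2, map_zero]
    · ext x
      rw [pd_linear hPd, hP.2 i hi]
      simp
  have hsum : P = (fun x => A 1 (P x)) + fun x => A (-1) (P x) := by
    ext x
    rw [Pi.add_apply, hAa, hAa]
    simp only [Units.val_one, Units.val_neg, Int.cast_one, Int.cast_neg]
    module
  rw [hsum]
  exact Submodule.add_mem _ (Submodule.mem_iSup_of_mem 1 (hmem 1))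
    (Submodule.mem_iSup_of_mem (-1) (hmem (-1)))

/-- Evaluation at a point. -/
def evalAt (m : ℕ) (T : Type*) [NormedAddCommGroup T] [NormedSpace ℂ T] (x : E m) :
    (E m → T) →ₗ[ℂ] T := LinearMap.proj x

theorem γ_spin_ne_zero (s : Spin m) {t : T} (ht : t ≠ 0) : γ (s : Cl m) t ≠ 0 := by
  intro h
  apply ht
  have := congrArg (γ ((s⁻¹ : Spin m) : Cl m)) h
  rw [← γ_mul, spin_inv_mul, map_zero] at this
  simpa using this

/-- `Spin(r)` acts transitively on the unit sphere of the first `r` coordinates, up to sign. -/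
theorem exists_rot_eq {r : ℕ} (h1 : 1 ≤ r) (hr : r ≤ m) {u : E m} (hu : ‖u‖ = 1)
    (hu0 : ∀ i, r < i → crd i u = 0) (hne : u ≠ -bv m r) :
    ∃ s ∈ subSpin m r, rot s (bv m r) = u := by
  have hbr := norm_bv h1 hr
  have hw : u + bv m r ≠ 0 := fun h => hne (eq_neg_of_add_eq_zero_left h)
  have hw' : ‖u + bv m r‖ ≠ 0 := norm_ne_zero_iff.2 hw
  have hb : ‖(‖u + bv m r‖⁻¹ : ℝ) • (u + bv m r)‖ = 1 := by
    rw [norm_smul, norm_inv, norm_norm, inv_mul_cancel₀ hw']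
  -- The reflection in e_r sends e_r to -e_r, and the reflection along the bisector u + e_r sends
  -- -e_r to u; this fails only when the bisector is zero.
  refine ⟨unitPair _ (bv m r) hb hbr, ?_, ?_⟩
  · intro i hi him
    refine rot_unitPair_of_orthogonal _ _ ?_ ?_
    · rw [inner_smul_left, inner_add_left, inner_bv, if_neg (by omega), real_inner_comm]
      have := hu0 i hi
      rw [crd] at this
      rw [this]; simp
    · rw [inner_bv, if_neg (by omega)]
  · rw [rot_unitPair, real_inner_self_eq_norm_sq, hbr]
    have h2 : bv m r - ((2 : ℝ) * 1 ^ 2) • bv m r = -bv m r := by module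
    rw [h2]
    set c := ‖u + bv m r‖ with hc
    have h3 : c ^ 2 = 2 * inner ℝ (u + bv m r) (bv m r) := by
      rw [hc, norm_add_sq_real, inner_add_left, real_inner_self_eq_norm_sq, hu, hbr]; ring
    rw [inner_smul_left, inner_neg_right, smul_smul]
    have h4 : 2 * ((starRingEnd ℝ) c⁻¹ * -inner ℝ (u + bv m r) (bv m r)) * c⁻¹ = -1 := by
      rw [conj_trivial]
      have : inner ℝ (u + bv m r) (bv m r) = c ^ 2 / 2 := by linarith
      rw [this]
      field_simp
    rw [h4]
    module

/-- Evaluation at `e_r` is onto for nonzero `Spin(r)`-submodules. -/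
theorem map_evalAt_eq [FiniteDimensional ℂ T] {r : ℕ} (h1 : 1 ≤ r) (hr : r ≤ m) {R : Submodule ℂ T}
    (hR : EvenIrr γ r R) {k : ℕ} {W : Submodule ℂ (E m → T)} (hW : W ≤ monoVar γ r R k)
    (hWi : Inv (lAction γ) (subSpin m r) W) (h0 : W ≠ ⊥) :
    W.map (evalAt m T (bv m r)) = R := by
  refine hR.2.2 _ ?_ ?_ ?_
  · rintro _ ⟨P, hP, rfl⟩
    exact homogPoly_apply_mem (hW hP).1.1 _
  · rintro a ha b hb _ ⟨P, hP, rfl⟩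
    change γ (e m a * e m b) (P (bv m r)) ∈ _
    by_cases ha0 : a = 0
    · rw [ha0, e_zero, zero_mul, map_zero]; exact Submodule.zero_mem _
    by_cases hb0 : b = 0
    · rw [hb0, e_zero, mul_zero, map_zero]; exact Submodule.zero_mem _
    have hmem : P (bv m r) ∈ W.map (evalAt m T (bv m r)) := ⟨P, hP, rfl⟩
    by_cases hab : a = b
    · subst hab
      rw [e_mul_self (by omega) (by omega)]
      simpa using hmem
    · have ha' : 1 ≤ a ∧ a ≤ m := by omega
      have hb' : 1 ≤ b ∧ b ≤ m := by omega
      -- The rotation of e_a e_b sends e_r to e_r or -e_r, and homogeneity absorbs the sign, so the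
      -- set of values at e_r is stable under the even algebra.
      have h2 : γ (e m a * e m b) (P (rot (bvPair m ha' hb')⁻¹ (bv m r))) ∈
          W.map (evalAt m T (bv m r)) :=
        ⟨_, hWi _ (bvPair_mem ha' hb' ha hb) P hP, rfl⟩
      rw [bvPair_inv] at h2
      have h3 : P (-bv m r) = (-1 : ℝ) ^ k • P (bv m r) := by
        rw [← homogPoly_smul_arg (hW hP).1.1, neg_one_smul]
      have h4 : γ (e m a * e m b) (P (-bv m r)) ∈ W.map (evalAt m T (bv m r)) →
          γ (e m a * e m b) (P (bv m r)) ∈ W.map (evalAt m T (bv m r)) := by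
        intro h
        rw [h3, map_real_smul] at h
        rcases neg_one_pow_eq_or ℝ k with hk | hk
        · rwa [hk, one_smul] at h
        · rw [hk, neg_one_smul] at h
          exact (Submodule.neg_mem_iff _).1 h
      by_cases har : r = a
      · subst har
        rw [rot_bvPair_right hb' ha' (Ne.symm hab)] at h2
        exact h4 h2
      · by_cases hbr : r = b
        · subst hbr
          rw [rot_bvPair_left hb' ha' (Ne.symm hab)] at h2
          exact h4 h2
        · rwa [rot_bvPair_of_ne hb' ha' hbr har] at h2
  · obtain ⟨P, hP, hP0⟩ := Submodule.exists_mem_ne_zero_of_ne_bot h0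
    -- A point where P does not vanish is projected to the first r coordinates, scaled to the sphere
    -- and rotated to e_r; the antipode of e_r is handled by homogeneity.
    have key : ∃ P ∈ W, P (bv m r) ≠ 0 := by
      obtain ⟨x, hx⟩ := Function.ne_iff.1 hP0
      have hPm := hW hP
      set y : E m := ∑ i ∈ Finset.Icc 1 r, crd i x • bv m i with hy
      have hcy : ∀ i, crd i y = if 1 ≤ i ∧ i ≤ r then crd i x else 0 := by
        intro i
        rw [hy, crd, inner_sum]
        simp only [inner_smul_right, inner_bv]
        by_cases hi : 1 ≤ i ∧ i ≤ r
        · rw [if_pos hi, Finset.sum_eq_single i]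
          · rw [if_pos ⟨rfl, hi.1, hi.2.trans hr⟩, mul_one]
          · intro b _ hb
            rw [if_neg (by tauto), mul_zero]
          · intro h; exact absurd (Finset.mem_Icc.2 hi) h
        · rw [if_neg hi]
          refine Finset.sum_eq_zero fun b hb => ?_
          rw [Finset.mem_Icc] at hb
          rw [if_neg (by rintro ⟨rfl, -⟩; exact hi hb), mul_zero]
      have hxy : P x = P y := eq_of_crd_eq (monoVar_differentiable hPm) hPm.2 fun i h1 h2 => by
        rw [hcy, if_pos ⟨h1, h2⟩]
      rw [hxy] at hx
      by_cases hy0 : y = 0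
      · refine ⟨P, hP, fun h => hx ?_⟩
        rw [hy0, ← zero_smul ℝ (bv m r), homogPoly_smul_arg hPm.1.1, h, smul_zero]
        rfl
      · have hny : ‖y‖ ≠ 0 := norm_ne_zero_iff.2 hy0
        set u : E m := ‖y‖⁻¹ • y with hu
        have hPu : P u ≠ 0 := by
          intro h
          apply hx
          have : y = ‖y‖ • u := by rw [hu, smul_smul, mul_inv_cancel₀ hny, one_smul]
          rw [this, homogPoly_smul_arg hPm.1.1, h, smul_zero]
          rfl
        by_cases hneg : u = -bv m r
        · refine ⟨P, hP, fun h => hPu ?_⟩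
          rw [hneg, ← neg_one_smul ℝ (bv m r), homogPoly_smul_arg hPm.1.1, h, smul_zero]
        · obtain ⟨s, hs, hsu⟩ := exists_rot_eq h1 hr (u := u)
            (by rw [hu, norm_smul, norm_inv, norm_norm, inv_mul_cancel₀ hny])
            (fun i hi => by
              have := hcy i
              rw [if_neg (by omega)] at this
              rw [hu, crd, inner_smul_right]
              rw [crd] at this
              rw [this, mul_zero]) hneg
          refine ⟨lAction γ s⁻¹ P, hWi _ (inv_mem hs) P hP, ?_⟩
          change γ ((s⁻¹ : Spin m) : Cl m) (P (rot s⁻¹⁻¹ (bv m r))) ≠ 0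
          rw [inv_inv, hsu]
          exact γ_spin_ne_zero _ hPu
    obtain ⟨P, hP, hPr⟩ := key
    intro hb
    have : P (bv m r) ∈ W.map (evalAt m T (bv m r)) := ⟨P, hP, rfl⟩
    rw [hb] at this
    exact hPr this

/-- The first r-1 coordinates of e_r vanish, so only the value of `Q` at the origin survives; in
particular pieces of positive degree evaluate to zero. -/
theorem mulX_apply_bv {r : ℕ} (h1 : 1 ≤ r) (j l : ℕ) {R : Submodule ℂ T} {i : ℕ}
    {Q : E m → T} (hQ : Q ∈ monoVar γ (r - 1) R i) :
    mulX γ r j l Q (bv m r) = harmFactor r j l (bv m r) • Q 0 := by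
  have hv : vec (r - 1) (bv m r) = 0 := by
    refine Finset.sum_eq_zero fun i hi => ?_
    rw [Finset.mem_Icc] at hi
    rw [crd_bv, if_neg (by omega), zero_smul]
  have hQ0 : Q (bv m r) = Q 0 := eq_of_crd_eq (monoVar_differentiable hQ) hQ.2 fun i hi hir => by
    rw [crd_bv, if_neg (by omega), crd, inner_zero_right]
  rw [mulX_eq, hv, zero_mul, map_zero, hQ0]
  simp

/-- The type `κ` labels how the values split under restriction: two signs when r-1 is even, a single
piece when it is odd. The branching pieces are pairwise inequivalent, and every nonzero submodule
must contain the degree-zero piece with a fixed label. -/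
theorem irr_monoVar_step [FiniteDimensional ℂ T] {r : ℕ} (h3 : 3 ≤ r) (hr : r ≤ m) {R : Submodule ℂ T}
    (hR : EvenIrr γ r R) {κ : Type*} [Finite κ] [Nonempty κ] {Rf : κ → Submodule ℂ T}
    (hRf : ∀ ε, EvenInv γ (r - 1) (Rf ε)) (hne0 : ∀ ε, Rf ε ≠ ⊥) (hind : iSupIndep Rf)
    (hsplit : ∀ j, monoVar γ (r - 1) R j = ⨆ ε, monoVar γ (r - 1) (Rf ε) j)
    (hirr : ∀ ε j, Irr (lAction γ) (subSpin m (r - 1)) (monoVar γ (r - 1) (Rf ε) j))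
    (hsep : ∀ ε δ, ε ≠ δ → ∀ j, NoHom (lAction γ) (subSpin m (r - 1))
      (monoVar γ (r - 1) (Rf ε) j) (monoVar γ (r - 1) (Rf δ) j))
    {k : ℕ} {N : Submodule ℂ (E m → T)} [FiniteDimensional ℂ N]
    (hN : Complemented (lAction γ) N) (hMN : monoVar γ r R k ≤ N) :
    Irr (lAction γ) (subSpin m r) (monoVar γ r R k) := by
  set U : Fin (k + 1) × κ → Submodule ℂ (E m → T) := fun i =>
    (monoVar γ (r - 1) (Rf i.2) i.1).map (mulX γ r i.1 (k - i.1)) with hU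
  have hUirr : ∀ i, Irr (lAction γ) (subSpin m (r - 1)) (U i) := fun i =>
    (hirr i.2 i.1).map (fun x hx h => mulX_eq_zero h3 hr hx h)
      fun g hg x => (lAction_mulX (by omega) hr hg _ _ x).symm
  have hUne : ∀ i i', i ≠ i' → NoHom (lAction γ) (subSpin m (r - 1)) (U i) (U i') := by
    rintro ⟨j, ε⟩ ⟨j', ε'⟩ hne
    refine NoHom.map (hirr ε' j').2.1 (fun x hx h => mulX_eq_zero h3 hr hx h)
      (fun g hg x => (lAction_mulX (by omega) hr hg _ _ x).symm)
      (fun g hg x => (lAction_mulX (by omega) hr hg _ _ x).symm) ?_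
    by_cases hj : j = j'
    · subst hj
      exact hsep ε ε' (fun h => hne (by rw [h])) j
    · exact noHom_monoVar_of_ne (by omega) (by omega) (hRf ε) (hne0 ε) (hRf ε') (hne0 ε')
        (fun h => hj (Fin.ext h)) (hirr ε j) (hirr ε' j')
  have hUind : iSupIndep U := iSupIndep_of_noHom hUirr hUne
  have hUsup : monoVar γ r R k = ⨆ i, U i := by
    rw [monoVar_eq_iSup h3 hr hR.2.1, iSup_prod]
    refine iSup_congr fun j => ?_
    rw [hsplit, Submodule.map_iSup]
  have hMi : Inv (lAction γ) (subSpin m r) (monoVar γ r R k) :=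
    inv_monoVar (by omega) hr hR.2.1 k
  obtain ⟨ε₀⟩ := ‹Nonempty κ›
  have key : ∀ W ≤ monoVar γ r R k, Inv (lAction γ) (subSpin m r) W → W ≠ ⊥ → U (0, ε₀) ≤ W := by
    intro W hW hWi h0
    by_contra hcon
    have hWi' : Inv (lAction γ) (subSpin m (r - 1)) W :=
      fun g hg => hWi g (subSpin_mono (by omega) hg)
    have h1 := eq_iSup_of_le_iSup hN hUirr hUind hUne hWi' (hW.trans hMN) (hUsup ▸ hW)
    have h2 := map_evalAt_eq (by omega) hr hR hW hWi h0
    -- `W` is a sum of branching pieces. Without the piece (0, ε₀), its values at e_r miss `Rf ε₀`,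
    -- although they must fill `R`.
    have h3 : R ≤ ⨆ ε, ⨆ (_ : ε ≠ ε₀), Rf ε := by
      rw [← h2, h1, Submodule.map_iSup]
      refine iSup_le fun i => ?_
      rw [Submodule.map_iSup]
      refine iSup_le fun hi => ?_
      rintro _ ⟨_, ⟨Q, hQ, rfl⟩, rfl⟩
      change mulX γ r i.1 (k - i.1) Q (bv m r) ∈ _
      rw [mulX_apply_bv (by omega) _ _ hQ]
      by_cases hi0 : i.1 = 0
      · have : i.2 ≠ ε₀ := by
          rintro h
          exact hcon (by rwa [← hi0, ← h])
        rw [← Complex.coe_smul]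
        exact Submodule.smul_mem _ _ (Submodule.mem_iSup_of_mem i.2
          (Submodule.mem_iSup_of_mem this (homogPoly_apply_mem hQ.1.1 0)))
      · rw [monoVar_apply_zero (fun h => hi0 (Fin.ext h)) hQ, smul_zero]
        exact Submodule.zero_mem _
    have h4 : Rf ε₀ ≤ R := by
      intro t ht
      have h5 : (fun _ => t) ∈ monoVar γ (r - 1) R 0 := by
        rw [hsplit]
        exact Submodule.mem_iSup_of_mem ε₀ (const_mem_monoVar _ ht)
      exact homogPoly_apply_mem h5.1.1 0
    exact hne0 ε₀ (eq_bot_iff.2 (hind ε₀ le_rfl (h4.trans h3)))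
  refine ⟨?_, hMi, ?_⟩
  · intro hb
    have : U (0, ε₀) ≤ monoVar γ r R k := hUsup ▸ le_iSup U (0, ε₀)
    rw [hb] at this
    exact (hUirr (0, ε₀)).1 (eq_bot_iff.2 this)
  · intro W hW hWi h0
    obtain ⟨W', hWi', hdis, hsup⟩ := hN (subSpin m r) W (hW.trans hMN) hWi
    -- If the complement met the module nontrivially, both would contain the same degree-zero piece.
    by_cases hb : W' ⊓ monoVar γ r R k = ⊥
    · refine le_antisymm hW fun x hx => ?_
      obtain ⟨a, ha, b, hb', rfl⟩ := Submodule.mem_sup.1 (hsup (hMN hx))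
      have : b ∈ W' ⊓ monoVar γ r R k := by
        refine ⟨hb', ?_⟩
        simpa using Submodule.sub_mem _ hx (hW ha)
      rw [hb, Submodule.mem_bot] at this
      rwa [this, add_zero]
    · have h1 := key W hW hWi h0
      have h2 := key _ inf_le_right (hWi'.inf hMi) hb
      exact absurd (eq_bot_iff.2 (hdis h1 (h2.trans inf_le_left))) (hUirr (0, ε₀)).1

theorem iSupIndep_thetaEig (R : Submodule ℂ T) (p : ℕ) :
    iSupIndep fun ε : ℤˣ => R ⊓ thetaEig γ p ε := by
  intro ε
  have : ⨆ (δ : ℤˣ) (_ : δ ≠ ε), R ⊓ thetaEig γ p δ ≤ thetaEig γ p (-ε) := by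
    refine iSup_le fun δ => iSup_le fun h => ?_
    have : δ = -ε := by
      rcases Int.units_eq_one_or δ with rfl | rfl <;> rcases Int.units_eq_one_or ε with rfl | rfl <;>
        simp_all
    rw [this]
    exact inf_le_right
  refine (disjoint_thetaEig (γ := γ) (p := p) (ε := ε) (δ := -ε) ?_).mono inf_le_right this
  rcases Int.units_eq_one_or ε with rfl | rfl <;> decide

theorem monoVar_two_eq_span [FiniteDimensional ℂ T] (hm : 2 ≤ m) {R : Submodule ℂ T}
    (hR : EvenInv γ 2 R) {v : T} (hv : R = Submodule.span ℂ {v}) (k : ℕ) :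
    monoVar γ 2 R k = Submodule.span ℂ {zPow γ k v} := by
  apply le_antisymm
  · intro P hP
    obtain ⟨t, ht, rfl⟩ := exists_eq_zPow hm hR hP
    rw [hv] at ht
    obtain ⟨c, rfl⟩ := Submodule.mem_span_singleton.1 ht
    refine Submodule.mem_span_singleton.2 ⟨c, ?_⟩
    ext x
    exact (map_smul _ c v).symm
  · rw [Submodule.span_singleton_le_iff_mem]
    exact zPow_mem_monoVar hm hR k (hv ▸ Submodule.mem_span_singleton_self v)

/-- The spaces of spherical monogenics are irreducible. -/
theorem irr_monoVar [FiniteDimensional ℂ T] {S : Submodule ℂ T}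
    (hS : ∀ k, Complemented (lAction γ) (monogenic γ S k)) {r : ℕ} (h2 : 2 ≤ r) (hr : r ≤ m)
    {R : Submodule ℂ T} (hR : EvenIrr γ r R) (hRS : R ≤ S) (k : ℕ) :
    Irr (lAction γ) (subSpin m r) (monoVar γ r R k) := by
  have hsub : ∀ {r : ℕ} {R : Submodule ℂ T} (k : ℕ), R ≤ S → monoVar γ r R k ≤ monogenic γ S k :=
    fun k h => (monoVar_mono le_rfl h k).trans (monoVar_le_monogenic _ _ _)
  induction r, h2 using Nat.le_induction generalizing R k with
  | base =>
    obtain ⟨v, hv, hv0⟩ := Submodule.exists_mem_ne_zero_of_ne_bot hR.1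
    obtain ⟨-, -, h1⟩ := hR.eq_span hr
    have h2 := h1 v hv hv0
    have h3 := monoVar_two_eq_span hr hR.2.1 h2 k
    refine ⟨?_, inv_monoVar (by norm_num) hr hR.2.1 k, fun W hW _ h0 => ?_⟩
    · obtain ⟨-, -, P, hP, -, hP0⟩ := exists_highest hr le_rfl hR.2.1 hR.1 k
      intro hb
      rw [hb] at hP
      exact hP0 hP
    · refine le_antisymm hW ?_
      obtain ⟨P, hP, hP0⟩ := Submodule.exists_mem_ne_zero_of_ne_bot h0
      have h4 := hW hP
      rw [h3] at h4 ⊢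
      obtain ⟨c, rfl⟩ := Submodule.mem_span_singleton.1 h4
      rw [Submodule.span_singleton_le_iff_mem]
      exact (Submodule.smul_mem_iff _ (by rintro rfl; simp at hP0)).1 hP
  | succ r h2 ih =>
    rcases Nat.even_or_odd' r with ⟨p, rfl | rfl⟩
    -- From an odd number of generators down to an even one the values split by θ.
    · have hirr := fun ε => hR.of_odd (by omega) hr ε
      refine irr_monoVar_step (by omega) hr hR (κ := ℤˣ) (Rf := fun ε => R ⊓ thetaEig γ p ε)
        (fun ε => (hirr ε).2.1) (fun ε => (hirr ε).1) (iSupIndep_thetaEig R p)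
        (fun j => monoVar_eq_iSup_thetaEig (by omega) (hR.2.1.mono (Nat.le_succ _)) j)
        (fun ε j => ih (by omega) (hirr ε) (inf_le_left.trans hRS) j)
        (fun ε δ h j => noHom_monoVar_sign (by omega) h inf_le_right inf_le_right j)
        (hS k) (hsub k hRS)
    -- From even to odd the values stay irreducible, so a one-element label set is used.
    · have hirr : EvenIrr γ (2 * p + 1) R := hR.of_even (by omega)
      refine irr_monoVar_step (by omega) hr hR (κ := Unit) (Rf := fun _ => R)
        (fun _ => hirr.2.1) (fun _ => hirr.1) (fun i => by simp)
        (fun j => by simp)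
        (fun _ j => ih (by omega) hirr hRS j)
        (fun ε δ h => absurd rfl h)
        (hS k) (hsub k hRS)

end Irreducibility


/-! ### The Fischer inner product -/

section Fischer

open scoped ContDiff

variable {m : ℕ} {Y : Type*} [NormedAddCommGroup Y] [NormedSpace ℂ Y]

/-- An operator that is linear on smooth functions and preserves them. -/
def SmoothLinear (L : (E m → Y) → (E m → Y)) : Prop :=
  ∀ P, ContDiff ℝ ∞ P → ContDiff ℝ ∞ (L P) ∧ (∀ Q, ContDiff ℝ ∞ Q → L (P + Q) = L P + L Q) ∧
    ∀ c : ℂ, L (c • P) = c • L P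

theorem SmoothLinear.comp {L L' : (E m → Y) → (E m → Y)} (h : SmoothLinear L)
    (h' : SmoothLinear L') : SmoothLinear fun P => L (L' P) := by
  intro P hP
  have h1 := h' P hP
  refine ⟨(h _ h1.1).1, fun Q hQ => ?_, fun c => ?_⟩
  · change L (L' (P + Q)) = _
    rw [h1.2.1 Q hQ, (h _ h1.1).2.1 _ (h' Q hQ).1]
  · change L (L' (c • P)) = _
    rw [h1.2.2 c, (h _ h1.1).2.2 c]

theorem smoothLinear_id : SmoothLinear fun P : E m → Y => P :=
  fun _ hP => ⟨hP, fun _ _ => rfl, fun _ => rfl⟩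

theorem smoothLinear_pd (i : ℕ) : SmoothLinear (pd i : (E m → Y) → (E m → Y)) := by
  intro P hP
  have hd := hP.differentiable (by norm_num)
  refine ⟨?_, fun Q hQ => pd_add hd (hQ.differentiable (by norm_num)) i, fun c => pd_smul hd i c⟩
  exact (hP.fderiv_right (m := ∞) (by norm_num)).clm_apply contDiff_const

theorem SmoothLinear.iterate {L : (E m → Y) → (E m → Y)} (h : SmoothLinear L) (n : ℕ) :
    SmoothLinear (L^[n]) := by
  induction n with
  | zero => exact smoothLinear_id
  | succ n ih => exact ih.comp h

theorem smoothLinear_multiPd (α : Fin m → ℕ) :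
    SmoothLinear (multiPd α : (E m → Y) → (E m → Y)) := by
  unfold multiPd
  induction List.finRange m with
  | nil => exact smoothLinear_id
  | cons i l ih => exact ((smoothLinear_pd _).iterate _).comp ih

/-- The monomial `x^β s`. -/
def monom (β : Fin m → ℕ) (s : Y) : E m → Y := fun x => (∏ j, x j ^ β j : ℝ) • s

theorem pd_monom (i : Fin m) (β : Fin m → ℕ) (s : Y) :
    pd ((i : ℕ) + 1) (monom β s) = (β i : ℝ) • monom (Function.update β i (β i - 1)) s := by
  ext x
  have h1 : ∀ j : Fin m, HasFDerivAt (fun x : E m => x j ^ β j)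
      ((β j • x j ^ (β j - 1)) • (EuclideanSpace.proj j : E m →L[ℝ] ℝ)) x := fun j =>
    (EuclideanSpace.proj j : E m →L[ℝ] ℝ).hasFDerivAt.pow (β j)
  have h2 := (HasFDerivAt.finsetProd (u := Finset.univ) fun j _ => h1 j).smul_const s
  have h3 : fderiv ℝ (monom β s) x = _ := h2.fderiv
  rw [pd, h3, bv_succ]
  simp only [ContinuousLinearMap.smulRight_apply, _root_.sum_apply,
    _root_.smul_apply, Pi.smul_apply, monom]
  rw [Finset.sum_eq_single i]
  · rw [smul_smul (β i : ℝ) _ s]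
    congr 1
    rw [← Finset.mul_prod_erase Finset.univ _ (Finset.mem_univ i)]
    have h3 : ∏ j ∈ Finset.univ.erase i, x j ^ Function.update β i (β i - 1) j =
        ∏ j ∈ Finset.univ.erase i, x j ^ β j := by
      refine Finset.prod_congr rfl fun j hj => ?_
      rw [Function.update_of_ne (Finset.ne_of_mem_erase hj)]
    rw [h3]
    simp
    ring
  · intro j _ hj
    simp [hj]
  · simp

theorem monom_mem {k : ℕ} {β : Fin m → ℕ} (hβ : ∑ i, β i = k) (s : Y) :
    monom β s ∈ homogPoly m (⊤ : Submodule ℂ Y) k :=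
  Submodule.subset_span ⟨β, hβ, s, trivial, by ext x; rw [Complex.coe_smul]; rfl⟩

theorem monom_smul (β : Fin m → ℕ) (c : ℝ) (s : Y) : monom β (c • s) = c • monom β s := by
  ext x
  exact smul_comm _ _ _

theorem contDiff_monom (β : Fin m → ℕ) (s : Y) : ContDiff ℝ ∞ (monom β s) :=
  homogPoly_contDiff (monom_mem rfl s)

theorem pd_iterate_monom (i : Fin m) (n : ℕ) (β : Fin m → ℕ) (s : Y) :
    (pd ((i : ℕ) + 1))^[n] (monom β s) =
      ((β i).descFactorial n : ℝ) • monom (Function.update β i (β i - n)) s := by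
  induction n with
  | zero => simp
  | succ n ih =>
    rw [Function.iterate_succ_apply', ih, pd_smul ((contDiff_monom _ _).differentiable (by norm_num)),
      pd_monom, smul_smul, Function.update_self, Function.update_idem, Nat.sub_sub,
      Nat.descFactorial_succ, Nat.cast_mul, mul_comm]

theorem multiPd_monom_apply_zero {k : ℕ} {α β : Fin m → ℕ} (hα : ∑ i, α i = k)
    (hβ : ∑ i, β i = k) (s : Y) : multiPd α (monom β s) 0 =
      if α = β then ((∏ i, (α i).factorial : ℕ) : ℝ) • s else 0 := by
  have key : ∀ l : List (Fin m), l.Nodup →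
      l.foldr (fun (i : Fin m) Q => (pd ((i : ℕ) + 1))^[α i] Q) (monom β s) =
      ((∏ i ∈ l.toFinset, (β i).descFactorial (α i) : ℕ) : ℝ) •
        monom (fun i => if i ∈ l then β i - α i else β i) s := by
    intro l hl
    induction l with
    | nil => simp
    | cons i l ih =>
      rw [List.nodup_cons] at hl
      rw [List.foldr_cons, ih hl.2, ← Complex.coe_smul,
        ((smoothLinear_pd _).iterate _ _ (contDiff_monom _ _)).2.2, pd_iterate_monom,
        Complex.coe_smul, smul_smul, List.toFinset_cons,
        Finset.prod_insert (by simpa using hl.1), if_neg hl.1, ← Nat.cast_mul, mul_comm]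
      congr 2
      ext j
      by_cases hj : j = i
      · subst hj; simp
      · simp [hj]
  rw [multiPd, key _ (List.nodup_finRange m)]
  have hl : (List.finRange m).toFinset = Finset.univ := by ext; simp
  rw [hl]
  split_ifs with h
  · subst h
    simp [monom, Nat.descFactorial_self]
  -- Distinct exponents of equal total degree exceed each other somewhere, and too many derivatives
  -- in that variable annihilate the monomial.
  · have : ∃ i, β i < α i := by
      by_contra! hcon
      apply h
      have := (Finset.sum_eq_sum_iff_of_le (fun i _ => hcon i)).1 (hα.trans hβ.symm)
      exact funext fun i => this i (Finset.mem_univ i)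
    obtain ⟨i, hi⟩ := this
    rw [Finset.prod_eq_zero (Finset.mem_univ i) (Nat.descFactorial_eq_zero_iff_lt.2 hi)]
    simp

/-- The Taylor coefficients `∂^α P(0)` as linear functions on homogeneous polynomials. -/
def taylor (k : ℕ) (α : Fin m → ℕ) : homogPoly m (⊤ : Submodule ℂ Y) k →ₗ[ℂ] Y where
  toFun P := multiPd α P.1 0
  map_add' P Q := congrFun
    ((smoothLinear_multiPd α _ (homogPoly_contDiff P.2)).2.1 _ (homogPoly_contDiff Q.2)) 0
  map_smul' c P := congrFun ((smoothLinear_multiPd α _ (homogPoly_contDiff P.2)).2.2 c) 0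

theorem homogPoly_eq_sum_multiPd {k : ℕ} {P : E m → Y}
    (hP : P ∈ homogPoly m (⊤ : Submodule ℂ Y) k) :
    P = ∑ α ∈ Finset.piAntidiag (Finset.univ : Finset (Fin m)) k,
      ((∏ i, (α i).factorial : ℕ) : ℝ)⁻¹ • monom α (multiPd α P 0) := by
  induction hP using Submodule.span_induction with
  | mem P h =>
    obtain ⟨β, hβ, s, -, rfl⟩ := h
    have h1 : (fun x : E m => ((∏ i, x i ^ β i : ℝ) : ℂ) • s) = monom β s := by
      ext x; rw [Complex.coe_smul]; rfl
    rw [h1, Finset.sum_eq_single β]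
    · rw [multiPd_monom_apply_zero hβ hβ, if_pos rfl, monom_smul, smul_smul,
        inv_mul_cancel₀, one_smul]
      exact_mod_cast (Finset.prod_pos fun i _ => Nat.factorial_pos _).ne'
    · intro α hα hne
      rw [Finset.mem_piAntidiag] at hα
      rw [multiPd_monom_apply_zero hα.1 hβ, if_neg hne]
      ext x; simp [monom]
    · intro h
      exact absurd (Finset.mem_piAntidiag.2 ⟨hβ, fun i _ => Finset.mem_univ i⟩) h
  | zero =>
    rw [eq_comm]
    refine Finset.sum_eq_zero fun α _ => ?_
    have := (smoothLinear_multiPd α (0 : E m → Y) contDiff_const).2.2 0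
    rw [zero_smul, zero_smul] at this
    rw [this]
    ext x; simp [monom]
  | add P Q hP hQ h1 h2 =>
    conv_lhs => rw [h1, h2]
    rw [← Finset.sum_add_distrib]
    refine Finset.sum_congr rfl fun α _ => ?_
    rw [(smoothLinear_multiPd α P (homogPoly_contDiff hP)).2.1 Q (homogPoly_contDiff hQ), ← smul_add]
    congr 1
    ext x; simp [monom]
  | smul c P hP h1 =>
    conv_lhs => rw [h1]
    rw [Finset.smul_sum]
    refine Finset.sum_congr rfl fun α _ => ?_
    rw [(smoothLinear_multiPd α P (homogPoly_contDiff hP)).2.2 c, smul_comm]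
    congr 1
    ext x
    exact smul_comm _ _ _

theorem homogPoly_eq_sum_taylor {k : ℕ} (P : homogPoly m (⊤ : Submodule ℂ Y) k) :
    (P : E m → Y) = ∑ α ∈ Finset.piAntidiag (Finset.univ : Finset (Fin m)) k,
      ((∏ i, (α i).factorial : ℕ) : ℝ)⁻¹ • monom α (taylor k α P) :=
  homogPoly_eq_sum_multiPd P.2

/-- The Fischer form. -/
def fischer (b : Y → Y → ℂ) (k : ℕ) (P Q : homogPoly m (⊤ : Submodule ℂ Y) k) : ℂ :=
  ∑ α ∈ Finset.piAntidiag (Finset.univ : Finset (Fin m)) k,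
    ((∏ i, (α i).factorial : ℕ) : ℂ)⁻¹ * b (taylor k α P) (taylor k α Q)

/-- The Fischer form of an inner product is an inner product. -/
abbrev coreFischer (c : InnerProductSpace.Core ℂ Y) (k : ℕ) :
    InnerProductSpace.Core ℂ (homogPoly m (⊤ : Submodule ℂ Y) k) where
  inner := fischer c.inner k
  conj_inner_symm P Q := by
    rw [fischer, fischer, map_sum]
    refine Finset.sum_congr rfl fun α _ => ?_
    rw [map_mul, c.conj_inner_symm, map_inv₀, map_natCast]
  re_inner_nonneg P := by
    rw [fischer, map_sum]
    refine Finset.sum_nonneg fun α _ => ?_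
    rw [← Complex.ofReal_natCast, ← Complex.ofReal_inv]
    change 0 ≤ (_ : ℂ).re
    rw [Complex.re_ofReal_mul]
    exact mul_nonneg (by positivity) (c.re_inner_nonneg _)
  add_left P Q R := by
    simp only [fischer, map_add, c.add_left, mul_add, Finset.sum_add_distrib]
  smul_left P Q r := by
    simp only [fischer, map_smul, c.smul_left, Finset.mul_sum]
    refine Finset.sum_congr rfl fun α _ => ?_
    ring
  definite P h := by
    have h1 := congrArg Complex.re h
    rw [fischer, Complex.re_sum, Complex.zero_re] at h1
    have hre : ∀ α : Fin m → ℕ, (((∏ i, (α i).factorial : ℕ) : ℂ)⁻¹ *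
        c.inner (taylor k α P) (taylor k α P)).re = ((∏ i, (α i).factorial : ℕ) : ℝ)⁻¹ *
        (c.inner (taylor k α P) (taylor k α P)).re := by
      intro α
      rw [← Complex.ofReal_natCast, ← Complex.ofReal_inv, Complex.re_ofReal_mul]
    have hpos : ∀ α : Fin m → ℕ, (0 : ℝ) < ((∏ i, (α i).factorial : ℕ) : ℝ)⁻¹ := by
      intro α
      have : 0 < ∏ i, (α i).factorial := Finset.prod_pos fun i _ => Nat.factorial_pos _
      positivity
    rw [Finset.sum_eq_zero_iff_of_nonneg (fun α _ => by
      rw [hre]; exact mul_nonneg (hpos α).le (c.re_inner_nonneg _))] at h1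
    have h2 : ∀ α ∈ Finset.piAntidiag (Finset.univ : Finset (Fin m)) k, taylor k α P = 0 := by
      intro α hα
      apply c.definite
      have h3 := h1 α hα
      rw [hre] at h3
      have h4 := (mul_eq_zero.1 h3).resolve_left (hpos α).ne'
      have h5 : (c.inner (taylor k α P) (taylor k α P)).im = 0 := by
        have := congrArg Complex.im (c.conj_inner_symm (taylor k α P) (taylor k α P))
        rw [Complex.conj_im] at this
        linarith
      exact Complex.ext h4 h5
    apply Subtype.ext
    rw [homogPoly_eq_sum_taylor P]
    refine Finset.sum_eq_zero fun α hα => ?_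
    rw [h2 α hα]
    ext x; simp [monom]

/-- The reproducing kernel `x ↦ ⟨y, x⟩^k s`. -/
def kernel (k : ℕ) (y : E m) (s : Y) : E m → Y := fun x => (inner ℝ y x) ^ k • s

theorem kernel_eq (k : ℕ) (y : E m) (s : Y) : kernel k y s =
    ∑ α ∈ Finset.piAntidiag (Finset.univ : Finset (Fin m)) k,
      ((Nat.multinomial Finset.univ α : ℝ) * ∏ i, y i ^ α i) • monom α s := by
  ext x
  have h : (inner ℝ y x : ℝ) = ∑ i, y i * x i := by
    simp [PiLp.inner_apply, mul_comm]
  rw [kernel, h, Finset.sum_pow_eq_sum_piAntidiag, Finset.sum_smul, Finset.sum_apply]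
  refine Finset.sum_congr rfl fun α _ => ?_
  rw [Pi.smul_apply, monom, smul_smul, mul_assoc, ← Finset.prod_mul_distrib]
  simp only [mul_pow]

theorem kernel_mem (k : ℕ) (y : E m) (s : Y) :
    kernel k y s ∈ homogPoly m (⊤ : Submodule ℂ Y) k := by
  rw [kernel_eq]
  refine Submodule.sum_mem _ fun α hα => ?_
  rw [← Complex.coe_smul]
  exact Submodule.smul_mem _ _ (monom_mem (Finset.mem_piAntidiag.1 hα).1 s)

theorem taylor_kernel {k : ℕ} (y : E m) (s : Y) {α : Fin m → ℕ} (hα : ∑ i, α i = k) :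
    taylor k α ⟨kernel k y s, kernel_mem k y s⟩ = ((k.factorial : ℝ) * ∏ i, y i ^ α i) • s := by
  have h1 : (⟨kernel k y s, kernel_mem k y s⟩ : homogPoly m (⊤ : Submodule ℂ Y) k) =
      ∑ β ∈ (Finset.piAntidiag (Finset.univ : Finset (Fin m)) k).attach,
        (((Nat.multinomial Finset.univ β.1 : ℝ) * ∏ i, y i ^ β.1 i : ℝ) : ℂ) •
          (⟨monom β.1 s, monom_mem (Finset.mem_piAntidiag.1 β.2).1 s⟩ :
            homogPoly m (⊤ : Submodule ℂ Y) k) := by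
    apply Subtype.ext
    rw [AddSubmonoidClass.coe_finsetSum]
    simp only [Submodule.coe_smul, Complex.coe_smul]
    rw [Finset.sum_attach _ fun β : Fin m → ℕ =>
      ((Nat.multinomial Finset.univ β : ℝ) * ∏ i, y i ^ β i : ℝ) • monom β s]
    exact kernel_eq k y s
  have hα' : α ∈ Finset.piAntidiag (Finset.univ : Finset (Fin m)) k :=
    Finset.mem_piAntidiag.2 ⟨hα, fun i _ => Finset.mem_univ i⟩
  have hval : ∀ β : {β // β ∈ Finset.piAntidiag (Finset.univ : Finset (Fin m)) k},
      taylor k α (⟨monom β.1 s, monom_mem (Finset.mem_piAntidiag.1 β.2).1 s⟩ :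
        homogPoly m (⊤ : Submodule ℂ Y) k) =
      if α = β.1 then ((∏ i, (α i).factorial : ℕ) : ℝ) • s else 0 :=
    fun β => multiPd_monom_apply_zero hα (Finset.mem_piAntidiag.1 β.2).1 s
  rw [h1, map_sum, Finset.sum_eq_single ⟨α, hα'⟩]
  · rw [map_smul, hval, if_pos rfl, Complex.coe_smul, smul_smul]
    congr 1
    have h2 := Nat.multinomial_spec Finset.univ α
    rw [hα] at h2
    rw [← h2]
    push_cast
    ring
  · rintro β _ hne
    rw [map_smul, hval, if_neg (fun h => hne (Subtype.ext h.symm)), smul_zero]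
  · intro h; exact absurd (Finset.mem_attach _ _) h

/-- The reproducing property. -/
theorem fischer_kernel (c : InnerProductSpace.Core ℂ Y) {k : ℕ} (y : E m) (s : Y)
    (Q : homogPoly m (⊤ : Submodule ℂ Y) k) :
    fischer c.inner k ⟨kernel k y s, kernel_mem k y s⟩ Q = k.factorial * c.inner s (Q.1 y) := by
  have hr : ∀ (a : ℝ) (t : Y), c.inner s (a • t) = a * c.inner s t := by
    intro a t
    rw [← Complex.coe_smul, ← c.conj_inner_symm, c.smul_left, map_mul, c.conj_inner_symm]
    simp
  have hl : ∀ (a : ℝ) (s t : Y), c.inner (a • s) t = a * c.inner s t := by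
    intro a s t
    rw [← Complex.coe_smul, c.smul_left, Complex.conj_ofReal]
  have hadd : ∀ t t', c.inner s (t + t') = c.inner s t + c.inner s t' := by
    intro t t'
    rw [← c.conj_inner_symm, c.add_left, map_add, c.conj_inner_symm, c.conj_inner_symm]
  have hsum : ∀ (F : Finset (Fin m → ℕ)) (f : (Fin m → ℕ) → Y),
      c.inner s (∑ α ∈ F, f α) = ∑ α ∈ F, c.inner s (f α) := by
    intro F f
    exact map_sum (AddMonoidHom.mk' (fun t => c.inner s t) hadd) f F
  conv_rhs => rw [homogPoly_eq_sum_taylor Q]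
  rw [Finset.sum_apply, hsum, Finset.mul_sum, fischer]
  refine Finset.sum_congr rfl fun α hα => ?_
  rw [taylor_kernel y s (Finset.mem_piAntidiag.1 hα).1, hl, Pi.smul_apply, hr, monom, hr]
  push_cast
  ring

/-- A polynomial Q orthogonal to all kernels vanishes: testing against the kernel at y with vector
Q(y) gives a multiple of the squared length of Q(y). -/
theorem span_kernel [FiniteDimensional ℂ Y] (c : InnerProductSpace.Core ℂ Y) (k : ℕ) :
    Submodule.span ℂ {P : homogPoly m (⊤ : Submodule ℂ Y) k | ∃ y s, P.1 = kernel k y s} = ⊤ := by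
  obtain ⟨U', h1, h2⟩ := exists_orthogonal (coreFischer (m := m) c k)
    (Submodule.span ℂ {P : homogPoly m (⊤ : Submodule ℂ Y) k | ∃ y s, P.1 = kernel k y s})
  have h3 : U' = ⊥ := by
    rw [eq_bot_iff]
    intro Q hQ
    rw [Submodule.mem_bot]
    apply Subtype.ext
    funext y
    apply c.definite
    have h4 := (h1 Q).1 hQ ⟨kernel k y (Q.1 y), kernel_mem k y _⟩
      (Submodule.subset_span ⟨y, _, rfl⟩)
    have h5 := fischer_kernel c y (Q.1 y) Q
    rw [show fischer c.inner k _ Q = 0 from h4] at h5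
    exact (mul_eq_zero.1 h5.symm).resolve_left (by exact_mod_cast k.factorial_ne_zero)
  have := h2.sup_eq_top
  rwa [h3, sup_bot_eq] at this

/-- The Fischer inner product is invariant under isometries. -/
theorem fischer_invariant [FiniteDimensional ℂ Y] (c : InnerProductSpace.Core ℂ Y) {k : ℕ}
    {A A' : E m →ₗ[ℝ] E m} (hA : ∀ x y, inner ℝ (A' x) y = (inner ℝ x (A y) : ℝ))
    (hAA' : ∀ x, A (A' x) = x) {a : Y →ₗ[ℂ] Y} (ha : ∀ x y, c.inner (a x) (a y) = c.inner x y)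
    {P Q P' Q' : homogPoly m (⊤ : Submodule ℂ Y) k} (hP : ∀ x, P'.1 x = a (P.1 (A x)))
    (hQ : ∀ x, Q'.1 x = a (Q.1 (A x))) :
    fischer c.inner k P' Q' = fischer c.inner k P Q := by
  set Λ : homogPoly m (⊤ : Submodule ℂ Y) k →ₗ[ℂ] homogPoly m (⊤ : Submodule ℂ Y) k :=
    { toFun := fun P => ⟨fun x => a (P.1 (A x)), homogPoly_comp P.2 A a fun _ _ => trivial⟩
      map_add' := fun P Q => by ext x; simp
      map_smul' := fun r P => by ext x; simp } with hΛ
  have hP' : P' = Λ P := Subtype.ext (funext hP)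
  have hQ' : Q' = Λ Q := Subtype.ext (funext hQ)
  rw [hP', hQ']
  have hPm : P ∈ Submodule.span ℂ
      {P : homogPoly m (⊤ : Submodule ℂ Y) k | ∃ y s, P.1 = kernel k y s} := by
    rw [span_kernel c]; trivial
  clear hP hP'
  induction hPm using Submodule.span_induction with
  | mem P h =>
    obtain ⟨y, s, h⟩ := h
    have h1 : P = ⟨kernel k y s, kernel_mem k y s⟩ := Subtype.ext h
    -- The transformation maps kernels to kernels, so on them invariance reduces to the reproducing
    -- property and invariance of the inner product on values.
    have h2 : Λ P = ⟨kernel k (A' y) (a s), kernel_mem k _ _⟩ := by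
      rw [h1]
      apply Subtype.ext
      ext x
      change a ((inner ℝ y (A x) : ℝ) ^ k • s) = (inner ℝ (A' y) x : ℝ) ^ k • a s
      rw [hA, LinearMap.map_smul_of_tower]
    rw [h2, h1, fischer_kernel, fischer_kernel]
    change _ * c.inner (a s) (a (Q.1 (A (A' y)))) = _
    rw [hAA', ha]
  | zero =>
    rw [map_zero]
    have h0 : ∀ R, fischer c.inner k (0 : homogPoly m (⊤ : Submodule ℂ Y) k) R = 0 := by
      intro R
      have := (coreFischer (m := m) c k).smul_left 0 R 0
      rwa [zero_smul, map_zero, zero_mul] at this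
    rw [h0, h0]
  | add P P' _ _ h1 h2 =>
    rw [map_add]
    have e1 := (coreFischer (m := m) c k).add_left
    exact (e1 _ _ _).trans ((congrArg₂ (· + ·) h1 h2).trans (e1 _ _ _).symm)
  | smul r P _ h1 =>
    rw [map_smul]
    have e1 := (coreFischer (m := m) c k).smul_left
    exact (e1 _ _ _).trans ((congrArg (_ * ·) h1).trans (e1 _ _ _).symm)

end Fischer


/-! ### Invariant inner products on spherical monogenics -/

section InnerProducts

variable {m : ℕ} {T : Type*} [NormedAddCommGroup T] [NormedSpace ℂ T]
  {γ : Cl m →ₐ[ℝ] Module.End ℂ T}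

theorem toS_mem {S : Submodule ℂ T} {k : ℕ} (P : monogenic γ S k) :
    toS P ∈ homogPoly m (⊤ : Submodule ℂ S) k := by
  have key : ∀ P ∈ homogPoly m S k, ∃ P' ∈ homogPoly m (⊤ : Submodule ℂ S) k,
      ∀ x, (P' x : T) = P x := by
    intro P hP
    induction hP using Submodule.span_induction with
    | mem P h =>
      obtain ⟨α, hα, s, hs, rfl⟩ := h
      exact ⟨_, Submodule.subset_span ⟨α, hα, ⟨s, hs⟩, trivial, rfl⟩, fun x => rfl⟩
    | zero => exact ⟨0, Submodule.zero_mem _, fun x => rfl⟩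
    | add P Q _ _ h1 h2 =>
      obtain ⟨P', hP', h1⟩ := h1
      obtain ⟨Q', hQ', h2⟩ := h2
      exact ⟨P' + Q', Submodule.add_mem _ hP' hQ', fun x => by simp [h1, h2]⟩
    | smul c P _ h1 =>
      obtain ⟨P', hP', h1⟩ := h1
      exact ⟨c • P', Submodule.smul_mem _ c hP', fun x => by simp [h1]⟩
  obtain ⟨P', hP', h⟩ := key P.1 P.2.1
  convert hP'
  funext x
  exact Subtype.ext (h x).symm

/-- `toS` as a linear map. -/
def toSLinear (γ : Cl m →ₐ[ℝ] Module.End ℂ T) (S : Submodule ℂ T) (k : ℕ) :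
    monogenic γ S k →ₗ[ℂ] homogPoly m (⊤ : Submodule ℂ S) k where
  toFun P := ⟨toS P, toS_mem P⟩
  map_add' _ _ := rfl
  map_smul' _ _ := rfl

theorem toSLinear_injective (S : Submodule ℂ T) (k : ℕ) :
    Function.Injective (toSLinear γ S k) := by
  intro P Q h
  apply Subtype.ext
  funext x
  have := congrFun (congrArg Subtype.val h) x
  exact congrArg Subtype.val this

theorem toS_monogenicRep [FiniteDimensional ℂ T] (S : Subrepresentation (spinRep γ)) (k : ℕ)
    (s : Spin m) (P : monogenic γ S.toSubmodule k) (x : E m) :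
    toS (monogenicRep γ S k s P) x = S.toRepresentation s (toS P (rot s⁻¹ x)) := rfl

theorem isInvariantInner_fischerInner [FiniteDimensional ℂ T] (S : Subrepresentation (spinRep γ))
    (k : ℕ) {b : S.toSubmodule → S.toSubmodule → ℂ} (hb : IsInvariantInner S.toRepresentation b) :
    IsInvariantInner (monogenicRep γ S k) (fischerInner b) := by
  obtain ⟨⟨c, hc⟩, hinv⟩ := hb
  obtain rfl : c.inner = b := funext fun x => funext fun y => hc x y
  refine ⟨⟨coreComap (coreFischer c k) (toSLinear γ S.toSubmodule k) (toSLinear_injective _ k),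
    fun P Q => rfl⟩, fun s P Q => ?_⟩
  refine fischer_invariant c (A := rot s⁻¹) (A' := rot s) (a := S.toRepresentation s)
    (P := toSLinear γ S.toSubmodule k P) (Q := toSLinear γ S.toSubmodule k Q)
    (P' := toSLinear γ S.toSubmodule k (monogenicRep γ S k s P))
    (Q' := toSLinear γ S.toSubmodule k (monogenicRep γ S k s Q)) ?_ ?_ (hinv s)
    (toS_monogenicRep S k s P) (toS_monogenicRep S k s Q)
  · intro x y
    rw [← inner_rot s⁻¹ (rot s x) y, ← rot_mul, inv_mul_cancel, rot_one]
  · intro x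
    rw [← rot_mul, inv_mul_cancel, rot_one]

/-- The inner product is not assumed to induce the norm of `Y`; as a real bilinear map in finite
dimension it is continuous anyway. -/
theorem continuous_core_inner {Y : Type*} [NormedAddCommGroup Y] [NormedSpace ℂ Y]
    [FiniteDimensional ℂ Y] (c : InnerProductSpace.Core ℂ Y) {f g : E m → Y} (hf : Continuous f)
    (hg : Continuous g) : Continuous fun x => c.inner (f x) (g x) := by
  have hadd : ∀ s t t', c.inner s (t + t') = c.inner s t + c.inner s t' := by
    intro s t t'
    rw [← c.conj_inner_symm, c.add_left, map_add, c.conj_inner_symm, c.conj_inner_symm]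
  have hsmul : ∀ (r : ℝ) s t, c.inner s (r • t) = r • c.inner s t := by
    intro r s t
    rw [← Complex.coe_smul, ← c.conj_inner_symm, c.smul_left, map_mul, c.conj_inner_symm]
    simp
  have hsmul' : ∀ (r : ℝ) s t, c.inner (r • s) t = r • c.inner s t := by
    intro r s t
    rw [← Complex.coe_smul, c.smul_left, Complex.conj_ofReal]
    simp
  have : FiniteDimensional ℝ Y := FiniteDimensional.complexToReal Y
  let B : Y →ₗ[ℝ] Y →ₗ[ℝ] ℂ := LinearMap.mk₂ ℝ c.inner c.add_left hsmul' hadd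
    (fun r s t => hsmul r s t)
  let B' : Y →ₗ[ℝ] (Y →L[ℝ] ℂ) := LinearMap.toContinuousLinearMap.toLinearMap ∘ₗ B
  have hB' : Continuous B' := B'.continuous_of_finiteDimensional
  exact (hB'.comp hf).clm_apply hg

open MeasureTheory in
theorem isInvariantInner_l2Inner [FiniteDimensional ℂ T] (S : Subrepresentation (spinRep γ))
    (k : ℕ) {b : S.toSubmodule → S.toSubmodule → ℂ} (hb : IsInvariantInner S.toRepresentation b) :
    IsInvariantInner (monogenicRep γ S k) (l2Inner b) := by
  obtain ⟨⟨c, hc⟩, hinv⟩ := hb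
  obtain rfl : c.inner = b := funext fun x => funext fun y => hc x y
  have hcont : ∀ P Q : monogenic γ S.toSubmodule k,
      Continuous fun x => c.inner (toS P x) (toS Q x) := fun P Q =>
    continuous_core_inner c (homogPoly_differentiable (toS_mem P)).continuous
      (homogPoly_differentiable (toS_mem Q)).continuous
  have hint : ∀ P Q : monogenic γ S.toSubmodule k, IntegrableOn
      (fun x => c.inner (toS P x) (toS Q x)) (Metric.ball (0 : E m) 1) := fun P Q =>
    ((hcont P Q).continuousOn.integrableOn_compact (isCompact_closedBall 0 1)).mono_set
      Metric.ball_subset_closedBall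
  have hself : ∀ (P : monogenic γ S.toSubmodule k) x, c.inner (toS P x) (toS P x) =
      ((c.inner (toS P x) (toS P x)).re : ℂ) := by
    intro P x
    have := c.conj_inner_symm (toS P x) (toS P x)
    exact (Complex.conj_eq_iff_re.1 this).symm
  have hnorm : ∀ P : monogenic γ S.toSubmodule k, l2Inner c.inner P P =
      ((∫ x in Metric.ball (0 : E m) 1, (c.inner (toS P x) (toS P x)).re : ℝ) : ℂ) := by
    intro P
    rw [l2Inner, ← integral_complex_ofReal]
    exact integral_congr_ae (Filter.Eventually.of_forall fun x => hself P x)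
  refine ⟨⟨⟨⟨⟨l2Inner c.inner⟩, ?_, ?_, ?_, ?_⟩, ?_⟩, fun _ _ => rfl⟩, ?_⟩
  · intro P Q
    change (starRingEnd ℂ) (l2Inner c.inner Q P) = l2Inner c.inner P Q
    rw [l2Inner, l2Inner, ← integral_conj]
    exact integral_congr_ae (Filter.Eventually.of_forall fun x => c.conj_inner_symm _ _)
  · intro P
    change 0 ≤ (l2Inner c.inner P P).re
    rw [hnorm, Complex.ofReal_re]
    exact integral_nonneg fun x => c.re_inner_nonneg _
  · intro P Q R
    change l2Inner c.inner (P + Q) R = l2Inner c.inner P R + l2Inner c.inner Q R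
    rw [l2Inner, l2Inner, l2Inner, ← integral_add (hint P R) (hint Q R)]
    exact integral_congr_ae (Filter.Eventually.of_forall fun x =>
      c.add_left (toS P x) (toS Q x) (toS R x))
  · intro P Q r
    change l2Inner c.inner (r • P) Q = _ * l2Inner c.inner P Q
    rw [l2Inner, l2Inner, ← integral_const_mul]
    exact integral_congr_ae (Filter.Eventually.of_forall fun x =>
      c.smul_left (toS P x) (toS Q x) r)
  · intro P h
    change l2Inner c.inner P P = 0 at h
    have hre : IntegrableOn (fun x => (c.inner (toS P x) (toS P x)).re) (Metric.ball (0 : E m) 1) :=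
      (hint P P).re
    have hnn : 0 ≤ᵐ[volume.restrict (Metric.ball (0 : E m) 1)]
        fun x => (c.inner (toS P x) (toS P x)).re :=
      Filter.Eventually.of_forall fun x => c.re_inner_nonneg (toS P x)
    rw [hnorm, Complex.ofReal_eq_zero, setIntegral_eq_zero_iff_of_nonneg_ae hnn hre] at h
    -- Vanishing almost everywhere becomes vanishing on the ball by continuity, and then everywhere
    -- by homogeneity.
    have h1 := Measure.eqOn_open_of_ae_eq h Metric.isOpen_ball
      (Complex.continuous_re.comp (hcont P P)).continuousOn continuousOn_const
    have h2 : ∀ x ∈ Metric.ball (0 : E m) 1, toS P x = 0 := by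
      intro x hx
      apply c.definite
      have h3 : (c.inner (toS P x) (toS P x)).re = 0 := h1 hx
      rw [hself, h3, Complex.ofReal_zero]
    apply toSLinear_injective
    rw [map_zero]
    apply Subtype.ext
    funext x
    set r : ℝ := (‖x‖ + 1)⁻¹ with hr
    have hr0 : 0 < ‖x‖ + 1 := by positivity
    have h4 := h2 (r • x) (by
      rw [mem_ball_zero_iff, norm_smul, Real.norm_of_nonneg (by positivity), hr,
        inv_mul_lt_one₀ hr0]
      linarith)
    rw [homogPoly_smul_arg (toS_mem P)] at h4
    exact (smul_eq_zero.1 h4).resolve_left (by positivity)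
  · intro s P Q
    have h1 : ∀ x, c.inner (toS (monogenicRep γ S k s P) x) (toS (monogenicRep γ S k s Q) x) =
        c.inner (toS P (rotIso s⁻¹ x)) (toS Q (rotIso s⁻¹ x)) := by
      intro x
      rw [toS_monogenicRep, toS_monogenicRep]
      exact hinv s _ _
    -- Rotations preserve Lebesgue measure and the unit ball.
    have h2 := ((rotIso s⁻¹).measurePreserving).setIntegral_preimage_emb
      (rotIso s⁻¹).toHomeomorph.measurableEmbedding
      (fun x => c.inner (toS P x) (toS Q x)) (Metric.ball 0 1)
    rw [l2Inner, l2Inner, ← h2]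
    have h3 : (rotIso s⁻¹ : E m → E m) ⁻¹' Metric.ball 0 1 = Metric.ball 0 1 := by
      ext x
      simp
    rw [h3]
    exact integral_congr_ae (Filter.Eventually.of_forall fun x => h1 x)

theorem exists_isInvariantInner [FiniteDimensional ℂ T] (S : Subrepresentation (spinRep γ))
    (k : ℕ) : ∃ B, IsInvariantInner (monogenicRep γ S k) B := by
  obtain ⟨b, hb⟩ := exists_isInvariantInner_spinor S
  exact ⟨_, isInvariantInner_fischerInner S k hb⟩

/-- Complete reducibility of the space of spherical monogenics, for all subgroups. -/
theorem complemented_monogenic [FiniteDimensional ℂ T] (S : Subrepresentation (spinRep γ))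
    (k : ℕ) : Complemented (lAction γ) (monogenic γ S.toSubmodule k) := by
  intro K W hW hWi
  obtain ⟨B, hB⟩ := exists_isInvariantInner S k
  obtain ⟨W', h1, h2⟩ := exists_inv_compl (K := K) hB
    (W.comap (monogenic γ S.toSubmodule k).subtype) fun g hg x hx => hWi g hg _ hx
  have hWmap : (W.comap (monogenic γ S.toSubmodule k).subtype).map
      (monogenic γ S.toSubmodule k).subtype = W := by
    rw [Submodule.map_comap_subtype, inf_eq_right.2 hW]
  refine ⟨W'.map (monogenic γ S.toSubmodule k).subtype, ?_, ?_, ?_⟩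
  · rintro g hg _ ⟨x, hx, rfl⟩
    exact ⟨monogenicRep γ S k g x, h1 g hg x hx, rfl⟩
  · rw [← hWmap]
    exact Submodule.disjoint_map (Submodule.injective_subtype _) h2.disjoint
  · rw [← hWmap, ← Submodule.map_sup, h2.sup_eq_top, Submodule.map_top,
      Submodule.range_subtype]

end InnerProducts


/-! ### The pieces of the spinor space -/

section Pieces

variable {m : ℕ} {T : Type*} [NormedAddCommGroup T] [NormedSpace ℂ T]
  {γ : Cl m →ₐ[ℝ] Module.End ℂ T}

/-- Equality of the signs that belong to `Spin(r)` or larger groups. -/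
def SignRel (r : ℕ) (ν ν' : Signs m) : Prop :=
  ∀ j : Fin (half m - 1), r ≤ 2 * (half m - 1 - j) → ν j = ν' j

/-- The `Spin(r)`-submodule of `S` given by the signs that belong to `Spin(r)` or larger groups. -/
def piece (γ : Cl m →ₐ[ℝ] Module.End ℂ T) (S : Submodule ℂ T) (ν : Signs m) (r : ℕ) :
    Submodule ℂ T :=
  S ⊓ ⨅ j : Fin (half m - 1), ⨅ (_ : r ≤ 2 * (half m - 1 - j)), thetaEig γ (half m - 1 - j) (ν j)

variable {S : Submodule ℂ T}

theorem mem_piece {ν : Signs m} {r : ℕ} {t : T} : t ∈ piece γ S ν r ↔ t ∈ S ∧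
    ∀ j : Fin (half m - 1), r ≤ 2 * (half m - 1 - j) → t ∈ thetaEig γ (half m - 1 - j) (ν j) := by
  simp only [piece, Submodule.mem_inf, Submodule.mem_iInf]

theorem piece_le (ν : Signs m) (r : ℕ) : piece γ S ν r ≤ S := inf_le_left

theorem piece_mono (ν : Signs m) {r r' : ℕ} (h : r ≤ r') : piece γ S ν r ≤ piece γ S ν r' := by
  intro t ht
  rw [mem_piece] at ht ⊢
  exact ⟨ht.1, fun j hj => ht.2 j (h.trans hj)⟩

theorem piece_congr {ν ν' : Signs m} {r : ℕ} (h : SignRel r ν ν') :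
    piece γ S ν r = piece γ S ν' r := by
  ext t
  rw [mem_piece, mem_piece]
  refine and_congr_right fun _ => forall_congr' fun j => forall_congr' fun hj => ?_
  rw [h j hj]

theorem piece_top (ν : Signs m) : piece γ S ν m = S := by
  ext t
  rw [mem_piece]
  refine and_iff_left fun j hj => ?_
  have := j.2
  unfold half at *
  omega

theorem piece_two (ν : Signs m) : piece γ S ν 2 = spinorPiece γ S ν := by
  ext t
  rw [mem_piece, spinorPiece, Submodule.mem_inf, Submodule.mem_iInf]
  refine and_congr_right fun _ => forall_congr' fun j => ?_
  have := j.2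
  exact ⟨fun h => h (by omega), fun h _ => h⟩

/-- Signs are attached to even dimensions only, so no condition is gained between 2p+2 and 2p+1. -/
theorem piece_odd (ν : Signs m) (p : ℕ) : piece γ S ν (2 * p + 1) = piece γ S ν (2 * p + 2) := by
  ext t
  rw [mem_piece, mem_piece]
  refine and_congr_right fun _ => forall_congr' fun j => ?_
  exact ⟨fun h hj => h (by omega), fun h hj => h (by omega)⟩

/-- The position of the sign that belongs to `Spin(2p)`. -/
def signIndex (m p : ℕ) (h1 : 1 ≤ p) (h2 : 2 * p + 1 ≤ m) : Fin (half m - 1) :=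
  ⟨half m - 1 - p, by unfold half; omega⟩

theorem half_sub_signIndex {p : ℕ} (h1 : 1 ≤ p) (h2 : 2 * p + 1 ≤ m) :
    half m - 1 - (signIndex m p h1 h2 : ℕ) = p := by
  simp only [signIndex, half]; omega

theorem eq_signIndex {p : ℕ} (h1 : 1 ≤ p) (h2 : 2 * p + 1 ≤ m) {j : Fin (half m - 1)}
    (hj : half m - 1 - (j : ℕ) = p) : j = signIndex m p h1 h2 := by
  have := j.2
  apply Fin.ext
  simp only [signIndex]; omega

theorem piece_even (ν : Signs m) {p : ℕ} (h1 : 1 ≤ p) (h2 : 2 * p + 1 ≤ m) :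
    piece γ S ν (2 * p) =
      piece γ S ν (2 * p + 1) ⊓ thetaEig γ p (ν (signIndex m p h1 h2)) := by
  ext t
  rw [Submodule.mem_inf, mem_piece, mem_piece, and_assoc]
  refine and_congr_right fun _ => ⟨fun h => ⟨fun j hj => h j (by omega), ?_⟩, fun h j hj => ?_⟩
  · have := h (signIndex m p h1 h2) (by rw [half_sub_signIndex])
    rwa [half_sub_signIndex] at this
  · by_cases hjp : half m - 1 - (j : ℕ) = p
    · have hj' := eq_signIndex h1 h2 hjp
      subst hj'
      rw [half_sub_signIndex]
      exact h.2
    · exact h.1 j (by omega)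

/-- Descent from m, alternating between the two restriction results for even algebras. -/
theorem evenIrr_piece [FiniteDimensional ℂ T] (hS : EvenIrr γ m S) (ν : Signs m) {r : ℕ}
    (h2 : 2 ≤ r) (hr : r ≤ m) : EvenIrr γ r (piece γ S ν r) := by
  induction hr using Nat.decreasingInduction with
  | self => rwa [piece_top]
  | of_succ r hr ih =>
    have ih := ih (by omega)
    rcases Nat.even_or_odd' r with ⟨p, rfl | rfl⟩
    · rw [piece_even ν (by omega) (by omega)]
      exact ih.of_odd (by omega) (by omega) _
    · rw [piece_odd]
      exact ih.of_even (by omega)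

/-- For even r the new sign is free and is realized by updating one entry of ν; for odd r the values
do not split. -/
theorem monoVar_piece [FiniteDimensional ℂ T] (hS : EvenIrr γ m S) (ν : Signs m) {r : ℕ}
    (h2 : 2 ≤ r) (hr : r + 1 ≤ m) (j : ℕ) : monoVar γ r (piece γ S ν (r + 1)) j ≤
      ⨆ (ν' : Signs m) (_ : SignRel (r + 1) ν ν'), monoVar γ r (piece γ S ν' r) j := by
  rcases Nat.even_or_odd' r with ⟨p, rfl | rfl⟩
  · rw [monoVar_eq_iSup_thetaEig (by omega)
      ((evenIrr_piece hS ν (by omega) hr).2.1.mono (Nat.le_succ _))]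
    refine iSup_le fun ε => ?_
    classical
    set i := signIndex m p (by omega) hr with hi
    have hrel : SignRel (2 * p + 1) ν (Function.update ν i ε) := by
      intro j hj
      rw [Function.update_of_ne]
      rintro rfl
      rw [hi, half_sub_signIndex] at hj
      omega
    refine le_iSup_of_le (Function.update ν i ε) (le_iSup_of_le hrel ?_)
    rw [piece_even _ (by omega) hr, ← hi, Function.update_self, piece_congr hrel]
  · refine le_iSup_of_le ν (le_iSup_of_le (fun _ _ => rfl) ?_)
    rw [piece_odd]

end Pieces

/-! ### The branching system -/

section System

variable {m k : ℕ} {T : Type*} [NormedAddCommGroup T] [NormedSpace ℂ T]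
  {γ : Cl m →ₐ[ℝ] Module.End ℂ T}

theorem entry_of_le (μ : J m k) {r : ℕ} (hr : m ≤ r) (h2 : 2 ≤ m) : μ.entry r = k := by
  rw [J.entry, dif_neg (by omega)]

theorem entry_mono (μ : J m k) : Monotone μ.entry := by
  intro a b hab
  unfold J.entry
  split_ifs with h1 h2 h2
  · exact μ.2.1 (by rw [Fin.mk_le_mk]; omega)
  · exact μ.2.2 _
  · omega
  · exact le_rfl

theorem J_ext {μ μ' : J m k} (h : ∀ i, 2 ≤ i → μ.entry i = μ'.entry i) : μ = μ' := by
  apply Subtype.ext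
  funext i
  have := h (i + 2) (by omega)
  rw [J.entry, J.entry, dif_pos (by omega), dif_pos (by omega)] at this
  simpa using this

instance finite_J : Finite (J m k) := by
  refine Finite.of_injective (β := Fin (m - 2) → Fin (k + 1))
    (fun μ i => ⟨μ.1 i, Nat.lt_succ_of_le (μ.2.2 i)⟩) fun μ μ' h => ?_
  apply Subtype.ext
  funext i
  exact congrArg Fin.val (congrFun h i)

instance nonempty_J : Nonempty (J m k) := ⟨⟨0, monotone_const, fun _ => Nat.zero_le k⟩⟩

/-- Change of the lower entries of `μ`. -/
theorem exists_entry (μ : J m k) {d j : ℕ} (hd : d + 3 ≤ m) (hj : j ≤ μ.entry (d + 3)) :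
    ∃ μ' : J m k, μ'.entry (d + 2) = j ∧ ∀ i, d + 3 ≤ i → μ.entry i = μ'.entry i := by
  have hjk : j ≤ k := hj.trans ((entry_mono μ hd).trans (entry_of_le μ le_rfl (by omega)).le)
  -- Only the entry at d+2 is prescribed; filling all lower entries with the same j keeps the
  -- sequence monotone.
  refine ⟨⟨fun i => if (i : ℕ) ≤ d then j else μ.1 i, ?_, ?_⟩, ?_, ?_⟩
  · intro a b hab
    rw [Fin.le_def] at hab
    dsimp only
    split_ifs with h1 h2 h2
    · exact le_rfl
    · have h3 := entry_mono μ (show d + 3 ≤ b + 2 by omega)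
      refine hj.trans (h3.trans ?_)
      rw [J.entry, dif_pos (by have := b.2; omega)]
      simp
    · omega
    · exact μ.2.1 hab
  · intro i
    dsimp only
    split_ifs
    · exact hjk
    · exact μ.2.2 i
  · rw [J.entry, dif_pos (by omega)]
    simp
  · intro i hi
    by_cases h1 : i - 2 < m - 2
    · rw [J.entry, J.entry, dif_pos h1, dif_pos h1]
      change μ.1 ⟨i - 2, h1⟩ = if i - 2 ≤ d then j else μ.1 ⟨i - 2, h1⟩
      rw [if_neg (by omega)]
    · rw [J.entry, J.entry, dif_neg h1, dif_neg h1]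

/-- The composition of the embedding operators from `Spin(d + 2)` to `Spin(d + n + 2)`. -/
def chain (γ : Cl m →ₐ[ℝ] Module.End ℂ T) (κ : ℕ → ℕ) : ℕ → ℕ → (E m → T) →ₗ[ℂ] (E m → T)
  | _, 0 => LinearMap.id
  | d, n + 1 => chain γ κ (d + 1) n ∘ₗ mulX γ (d + 3) (κ (d + 2)) (κ (d + 3) - κ (d + 2))

theorem chain_succ (κ : ℕ → ℕ) (d n : ℕ) : chain γ κ d (n + 1) =
    chain γ κ (d + 1) n ∘ₗ mulX γ (d + 3) (κ (d + 2)) (κ (d + 3) - κ (d + 2)) := rfl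

theorem chain_congr {κ κ' : ℕ → ℕ} {d : ℕ} (h : ∀ i, d + 2 ≤ i → κ i = κ' i) (n : ℕ) :
    chain γ κ d n = chain γ κ' d n := by
  induction n generalizing d with
  | zero => rfl
  | succ n ih =>
    rw [chain_succ, chain_succ, ih fun i hi => h i (by omega), h (d + 2) (by omega),
      h (d + 3) (by omega)]

theorem chain_lAction (κ : ℕ → ℕ) {d n : ℕ} (hn : d + n + 2 ≤ m) {s : Spin m}
    (hs : s ∈ subSpin m (d + 2)) (Q : E m → T) :
    chain γ κ d n (lAction γ s Q) = lAction γ s (chain γ κ d n Q) := by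
  induction n generalizing d Q with
  | zero => rfl
  | succ n ih =>
    rw [chain_succ, LinearMap.comp_apply, ← lAction_mulX (by omega) (by omega) hs,
      ih (by omega) (subSpin_mono (by omega) hs)]
    rfl

theorem mulX_mem_of_mono [FiniteDimensional ℂ T] {κ : ℕ → ℕ} (hκ : Monotone κ) {d : ℕ}
    (hd : d + 3 ≤ m) {R : Submodule ℂ T} (hR : EvenInv γ (d + 3) R) {Q : E m → T}
    (hQ : Q ∈ monoVar γ (d + 2) R (κ (d + 2))) :
    mulX γ (d + 3) (κ (d + 2)) (κ (d + 3) - κ (d + 2)) Q ∈ monoVar γ (d + 3) R (κ (d + 3)) := by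
  have := mulX_mem_monoVar (r := d + 3) (by omega) hd hR hQ (κ (d + 3) - κ (d + 2))
  rwa [Nat.add_sub_cancel' (hκ (by omega))] at this

theorem chain_eq_zero [FiniteDimensional ℂ T] {κ : ℕ → ℕ} (hκ : Monotone κ) {d n : ℕ}
    (hn : d + n + 2 ≤ m) {Q : E m → T} (hQ : Q ∈ monoVar γ (d + 2) ⊤ (κ (d + 2)))
    (h : chain γ κ d n Q = 0) : Q = 0 := by
  induction n generalizing d Q with
  | zero => exact h
  | succ n ih =>
    exact mulX_eq_zero (r := d + 3) (by omega) (by omega) hQ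
      (ih (by omega) (mulX_mem_of_mono hκ (by omega) (evenInv_top _) hQ) h)

/-- Equality of the entries that belong to `Spin(r)` or larger groups. -/
def EntryRel (r : ℕ) (μ μ' : J m k) : Prop := ∀ i, r ≤ i → μ.entry i = μ'.entry i

/-- The equivalence relation for which the classes label the `Spin(d + 2)`-submodules. -/
def gtRel (d : ℕ) (a b : Signs m × J m k) : Prop :=
  EntryRel (d + 2) a.2 b.2 ∧ SignRel (d + 2) a.1 b.1

/-- The `Spin(d + 2)`-submodule of spherical monogenics labelled by `a`. -/
def gtSpace (γ : Cl m →ₐ[ℝ] Module.End ℂ T) (S : Submodule ℂ T) (d : ℕ) (a : Signs m × J m k) :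
    Submodule ℂ (E m → T) :=
  (monoVar γ (d + 2) (piece γ S a.1 (d + 2)) (a.2.entry (d + 2))).map
    (chain γ a.2.entry d (m - 2 - d))

theorem gtSpace_congr {S : Submodule ℂ T} {d : ℕ} {a b : Signs m × J m k} (h : gtRel d a b) :
    gtSpace γ S d a = gtSpace γ S d b := by
  rw [gtSpace, gtSpace, piece_congr h.2, h.1 (d + 2) le_rfl, chain_congr h.1]

theorem gtSpace_top {S : Submodule ℂ T} (hm : 2 ≤ m) (a : Signs m × J m k) :
    gtSpace γ S (m - 2) a = monogenic γ S k := by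
  rw [gtSpace, Nat.sub_self, show m - 2 + 2 = m by omega, piece_top,
    entry_of_le a.2 le_rfl hm, monoVar_top]
  exact Submodule.map_id _

variable [FiniteDimensional ℂ T] {S : Submodule ℂ T}

theorem gtSpace_le_succ (hS : EvenIrr γ m S) {d : ℕ} (hd : d < m - 2) (a : Signs m × J m k) :
    gtSpace γ S d a ≤ gtSpace γ S (d + 1) a := by
  rintro _ ⟨Q, hQ, rfl⟩
  refine ⟨mulX γ (d + 3) (a.2.entry (d + 2)) (a.2.entry (d + 3) - a.2.entry (d + 2)) Q,
    mulX_mem_of_mono (entry_mono a.2) (by omega)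
      (evenIrr_piece hS a.1 (by omega) (by omega)).2.1
      (monoVar_mono le_rfl (piece_mono a.1 (by omega)) _ hQ), ?_⟩
  rw [show m - 2 - d = m - 2 - (d + 1) + 1 by omega]
  rfl

/-- The branching law for polynomials and the splitting of values, transported by the remaining
embeddings. -/
theorem gtSpace_succ (hS : EvenIrr γ m S) {d : ℕ} (hd : d < m - 2) (a : Signs m × J m k) :
    gtSpace γ S (d + 1) a =
      ⨆ (b : Signs m × J m k) (_ : gtRel (d + 1) a b), gtSpace γ S d b := by
  apply le_antisymm
  · rw [gtSpace, monoVar_eq_iSup (r := d + 3) (by omega) (by omega)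
      (evenIrr_piece hS a.1 (by omega) (by omega)).2.1, Submodule.map_iSup]
    refine iSup_le fun j => ?_
    obtain ⟨μ, hμj, hμ⟩ := exists_entry a.2 (d := d) (j := j) (by omega)
      (Nat.le_of_lt_succ j.2)
    refine (Submodule.map_mono (Submodule.map_mono
      (monoVar_piece hS a.1 (by omega) (by omega) j))).trans ?_
    simp only [Submodule.map_iSup]
    refine iSup_le fun ν => iSup_le fun hν => ?_
    refine le_iSup_of_le (ν, μ) (le_iSup_of_le ⟨hμ, hν⟩ ?_)
    rw [gtSpace, show m - 2 - d = m - 2 - (d + 1) + 1 by omega, chain_succ, Submodule.map_comp,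
      hμj, ← hμ (d + 3) le_rfl, chain_congr (κ := μ.entry) (fun i hi => (hμ i hi).symm)]
    rfl
  · refine iSup_le fun b => iSup_le fun h => ?_
    rw [gtSpace_congr h]
    exact gtSpace_le_succ hS hd b

theorem gtSpace_le (hm : 2 ≤ m) (hS : EvenIrr γ m S) {d : ℕ} (hd : d ≤ m - 2)
    (a : Signs m × J m k) : gtSpace γ S d a ≤ monogenic γ S k := by
  induction hd using Nat.decreasingInduction with
  | self => rw [gtSpace_top hm]
  | of_succ d hd ih => exact (gtSpace_le_succ hS hd a).trans ih

theorem irr_gtSpace (hm : 2 ≤ m) (hS : EvenIrr γ m S)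
    (hc : ∀ k, Complemented (lAction γ) (monogenic γ S k)) {d : ℕ} (hd : d ≤ m - 2)
    (a : Signs m × J m k) : Irr (lAction γ) (subSpin m (d + 2)) (gtSpace γ S d a) :=
  (irr_monoVar hc (by omega) (by omega) (evenIrr_piece hS a.1 (by omega) (by omega))
    (piece_le _ _) _).map
    (fun Q hQ h => chain_eq_zero (entry_mono a.2) (by omega) (monoVar_mono le_rfl le_top _ hQ) h)
    fun s hs Q => chain_lAction _ (by omega) hs Q

/-- Labels that first separate at this level differ in the degree k_{d+2}, and then the torus
weights separate them, or else in the sign belonging to Spin(d+2), which the central element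
detects. -/
theorem noHom_gtSpace (hm : 2 ≤ m) (hS : EvenIrr γ m S)
    (hc : ∀ k, Complemented (lAction γ) (monogenic γ S k)) {d : ℕ} (hd : d < m - 2)
    {a b : Signs m × J m k} (hab : ¬ gtRel d a b) (hab' : gtRel (d + 1) a b) :
    NoHom (lAction γ) (subSpin m (d + 2)) (gtSpace γ S d a) (gtSpace γ S d b) := by
  have hirr := fun a : Signs m × J m k => irr_monoVar hc (show 2 ≤ d + 2 by omega) (by omega)
    (evenIrr_piece hS a.1 (by omega) (by omega)) (piece_le _ _) (a.2.entry (d + 2))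
  have hp := fun ν : Signs m => evenIrr_piece hS ν (show 2 ≤ d + 2 by omega) (by omega)
  refine NoHom.map (hirr b).2.1
    (fun Q hQ h => chain_eq_zero (entry_mono b.2) (by omega) (monoVar_mono le_rfl le_top _ hQ) h)
    (fun s hs Q => chain_lAction _ (by omega) hs Q)
    (fun s hs Q => chain_lAction _ (by omega) hs Q) ?_
  by_cases hj : a.2.entry (d + 2) = b.2.entry (d + 2)
  · have hent : EntryRel (d + 2) a.2 b.2 := by
      intro i hi
      rcases (by omega : i = d + 2 ∨ d + 3 ≤ i) with rfl | h
      · exact hj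
      · exact hab'.1 i h
    have hsign : ¬ SignRel (d + 2) a.1 b.1 := fun h => hab ⟨hent, h⟩
    unfold SignRel at hsign
    push Not at hsign
    obtain ⟨i, hi, hne⟩ := hsign
    have hi' : 2 * (half m - 1 - (i : ℕ)) = d + 2 := by
      by_contra hcon
      exact hne (hab'.2 i (by omega))
    rw [← hj]
    have hle : ∀ ν : Signs m, piece γ S ν (d + 2) ≤ thetaEig γ (half m - 1 - i) (ν i) :=
      fun ν t ht => (mem_piece.1 ht).2 i hi
    have := noHom_monoVar_sign (γ := γ) (p := half m - 1 - i) (by omega) hne (hle a.1) (hle b.1)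
      (a.2.entry (d + 2))
    rwa [hi'] at this
  · exact noHom_monoVar_of_ne (by omega) (by omega) (hp a.1).2.1 (hp a.1).1 (hp b.1).2.1 (hp b.1).1
      hj (hirr a) (hirr b)

end System


section Basis

variable {m k : ℕ} {T : Type*} [NormedAddCommGroup T] [NormedSpace ℂ T]
  {γ : Cl m →ₐ[ℝ] Module.End ℂ T}

/-! ### The explicit basis -/

/-- The function `x ↦ f(x) t` for the polynomial `f` given by `κ`. -/
def gtFun (γ : Cl m →ₐ[ℝ] Module.End ℂ T) (κ : ℕ → ℕ) (d : ℕ) (t : T) : E m → T :=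
  fun x => γ (gtPoly κ d x) t

theorem gtFun_zero (κ : ℕ → ℕ) (t : T) : gtFun γ κ 0 t = zPow γ (κ 2) t := rfl

theorem gtFun_succ (κ : ℕ → ℕ) (d : ℕ) (t : T) : gtFun γ κ (d + 1) t =
    mulX γ (d + 3) (κ (d + 2)) (κ (d + 3) - κ (d + 2)) (gtFun γ κ d t) := by
  ext x
  exact γ_mul _ _ _

theorem chain_gtFun (κ : ℕ → ℕ) (d n : ℕ) (t : T) :
    chain γ κ d n (gtFun γ κ d t) = gtFun γ κ (d + n) t := by
  induction n generalizing d with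
  | zero => rfl
  | succ n ih =>
    rw [chain_succ, LinearMap.comp_apply, ← gtFun_succ, ih, show d + 1 + n = d + (n + 1) by omega]

theorem gtFun_mem [FiniteDimensional ℂ T] (hm : 2 ≤ m) {κ : ℕ → ℕ} (hκ : Monotone κ) {d : ℕ}
    (hd : d + 2 ≤ m) (t : T) : gtFun γ κ d t ∈ monoVar γ (d + 2) ⊤ (κ (d + 2)) := by
  induction d with
  | zero => exact zPow_mem_monoVar hm (evenInv_top 2) _ (Submodule.mem_top)
  | succ d ih =>
    rw [gtFun_succ]
    exact mulX_mem_of_mono hκ hd (evenInv_top _) (ih (by omega))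

/-- The bottom piece of values is the line of v^ν, so the two-variable monogenics form the line of
ζ^{k_2} v^ν, which the embeddings carry to the explicit polynomial. -/
theorem gtSpace_zero [FiniteDimensional ℂ T] {S : Submodule ℂ T} (hm : 2 ≤ m)
    (hS : EvenIrr γ m S) {v : Signs m → T} (hv : ∀ ν, v ν ∈ spinorPiece γ S ν)
    (hv0 : ∀ ν, v ν ≠ 0) (a : Signs m × J m k) :
    gtSpace γ S 0 a = Submodule.span ℂ {fSpinor γ v a} := by
  have hp := evenIrr_piece hS a.1 le_rfl hm
  obtain ⟨-, -, h1⟩ := hp.eq_span hm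
  have h2 := h1 (v a.1) (by rw [piece_two]; exact hv a.1) (hv0 a.1)
  rw [gtSpace, monoVar_two_eq_span hm hp.2.1 h2, Submodule.map_span, Set.image_singleton,
    ← gtFun_zero, chain_gtFun, Nat.zero_add, Nat.sub_zero]
  rfl

theorem map_comap_monogenic {S : Submodule ℂ T} {W : Submodule ℂ (E m → T)} (h : W ≤ monogenic γ S k) :
    (W.comap (monogenic γ S k).subtype).map (monogenic γ S k).subtype = W := by
  rw [Submodule.map_comap_subtype, inf_eq_right.2 h]

theorem comap_iSup_monogenic {S : Submodule ℂ T} {ι : Type*} {p : ι → Prop}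
    {W : ι → Submodule ℂ (E m → T)} (h : ∀ i, W i ≤ monogenic γ S k) :
    (⨆ (i) (_ : p i), W i).comap (monogenic γ S k).subtype =
      ⨆ (i) (_ : p i), (W i).comap (monogenic γ S k).subtype := by
  apply Submodule.map_injective_of_injective (Submodule.injective_subtype (monogenic γ S k))
  rw [map_comap_monogenic (iSup_le fun i => iSup_le fun _ => h i)]
  simp only [Submodule.map_iSup, map_comap_monogenic (h _)]

/-- The chain of submodules generated by the explicit basis. -/
theorem branchingSystem [FiniteDimensional ℂ T] (hm : 3 ≤ m) (S : Subrepresentation (spinRep γ))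
    (hS : S.toRepresentation.IsIrreducible) {v : Signs m → T}
    (hv : ∀ ν, v ν ∈ spinorPiece γ S.toSubmodule ν) (hv0 : ∀ ν, v ν ≠ 0)
    {f : Signs m × J m k → monogenic γ S.toSubmodule k}
    (hf : ∀ a, (f a : E m → T) = fSpinor γ v a) :
    BranchingSystem (monogenicRep γ S k) (fun d => subSpin m (d + 2)) (m - 2) gtRel
      (fun d a => (gtSpace γ S.toSubmodule (min d (m - 2)) a).comap
        (monogenic γ S.toSubmodule k).subtype) f := by
  have hE := evenIrr_of_isIrreducible S hS
  have hc := complemented_monogenic S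
  have hle := fun d (a : Signs m × J m k) =>
    gtSpace_le (by omega) hE (min_le_right d (m - 2)) a
  have hj : Function.Injective (monogenic γ S.toSubmodule k).subtype :=
    Submodule.injective_subtype _
  have hρ : ∀ (s : Spin m) x, (monogenic γ S.toSubmodule k).subtype (monogenicRep γ S k s x) =
      lAction γ s ((monogenic γ S.toSubmodule k).subtype x) := fun _ _ => rfl
  have hmono : ∀ d d' (a b : Signs m × J m k), d ≤ d' → gtRel d a b → gtRel d' a b :=
    fun d d' a b hd h => ⟨fun i hi => h.1 i (by omega), fun j hj => h.2 j (by omega)⟩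
  constructor
  · intro d
    exact ⟨fun a => ⟨fun _ _ => rfl, fun _ _ => rfl⟩,
      fun h => ⟨fun i hi => (h.1 i hi).symm, fun j hj => (h.2 j hj).symm⟩,
      fun h h' => ⟨fun i hi => (h.1 i hi).trans (h'.1 i hi),
        fun j hj => (h.2 j hj).trans (h'.2 j hj)⟩⟩
  · exact fun d a b h => hmono d (d + 1) a b (Nat.le_succ d) h
  · rintro ⟨ν, μ⟩ ⟨ν', μ'⟩ ⟨h1, h2⟩
    have h3 : μ = μ' := J_ext fun i hi => h1 i hi
    have h4 : ν = ν' := funext fun j => h2 j (by have := j.2; omega)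
    rw [h3, h4]
  · intro a b
    refine ⟨fun i hi => ?_, fun j hj => ?_⟩
    · rw [entry_of_le a.2 (by omega) (by omega), entry_of_le b.2 (by omega) (by omega)]
    · have h1 : (j : ℕ) < (m + 1) / 2 - 1 := j.2
      have h2 : m - 2 + 2 ≤ 2 * ((m + 1) / 2 - 1 - (j : ℕ)) := hj
      omega
  · intro d a b h
    -- The structure asks for constancy on classes at every natural number; levels above the top are
    -- cut off by `min`.
    by_cases hd : d ≤ m - 2
    · rw [min_eq_left hd, gtSpace_congr h]
    · rw [min_eq_right (by omega), gtSpace_top (by omega), gtSpace_top (by omega)]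
  · intro d hd a
    refine Irr.of_map hj hρ ?_
    rw [map_comap_monogenic (hle d a), min_eq_left hd]
    exact irr_gtSpace (by omega) hE hc hd a
  · intro d hd a
    simp only [min_eq_left hd.le, min_eq_left (Nat.succ_le_of_lt hd)]
    rw [gtSpace_succ hE hd, comap_iSup_monogenic fun b => gtSpace_le (by omega) hE hd.le b]
  · intro d hd a b hab hab'
    refine NoHom.of_map hj hρ ?_
    rw [map_comap_monogenic (hle d a), map_comap_monogenic (hle d b), min_eq_left hd.le]
    exact noHom_gtSpace (by omega) hE hc hd hab hab'
  · intro a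
    apply Submodule.map_injective_of_injective hj
    rw [map_comap_monogenic (hle 0 a), Nat.zero_min, gtSpace_zero (by omega) hE hv hv0,
      Submodule.map_span, Set.image_singleton]
    congr 2
    exact (hf a).symm

/-! ### The Appell property -/

/-- On ζ^n t the bivector e_1 e_2 acts as iδ, so the derivative is (n+1)(1 + εδ)/2 times ζ^n t. -/
theorem pdSign_zPow_succ (hm : 2 ≤ m) {ε δ : ℤˣ} {t : T} (ht : t ∈ thetaEig γ 1 δ) (n : ℕ) :
    pdSign ε (zPow γ (n + 1) t) = if ε = δ then ((n : ℂ) + 1) • zPow γ n t else 0 := by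
  have hJ : γ (e m 1 * e m 2) t = (((δ : ℤ) : ℂ) * Complex.I) • t := by
    rw [mem_thetaEig, theta_apply, pow_one, show 2 * 1 = 0 + 1 + 1 from rfl, vol_succ, vol_succ,
      vol_zero, one_mul] at ht
    have := congrArg (Complex.I • ·) ht
    simp only [smul_smul] at this
    rw [mul_neg, Complex.I_mul_I, neg_neg, one_smul] at this
    rw [this, mul_comm]
  ext x
  rw [pdSign, pd_zPow_succ hm, pd_zPow_succ hm, zPow_biv]
  have hz : γ (e m 1 * e m 2) (zPow γ n t x) = (((δ : ℤ) : ℂ) * Complex.I) • zPow γ n t x := by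
    rw [← zPow_biv, hJ]
    exact map_smul _ _ t
  rw [hz]
  simp only [if_true, if_neg (show ¬ (1 = 2) by norm_num), if_neg (show ¬ (2 = 1) by norm_num),
    sub_zero, zero_sub]
  rw [← Complex.coe_smul, ← Complex.coe_smul, smul_neg, ← neg_smul, smul_smul, smul_smul,
    ← add_smul, smul_smul]
  have hI := Complex.I_mul_I
  split_ifs with h
  · subst h
    rw [Pi.smul_apply]
    congr 1
    have h1 := units_int_sq ε
    push_cast
    linear_combination (-(1 / 2 : ℂ) * (n + 1) * ((ε : ℤ) : ℂ) * ((ε : ℤ) : ℂ)) * hI +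
      (1 / 2 : ℂ) * (n + 1) * h1
  · have h1 : ((ε : ℤ) : ℂ) * ((δ : ℤ) : ℂ) = -1 := by
      rcases Int.units_eq_one_or ε with rfl | rfl <;> rcases Int.units_eq_one_or δ with rfl | rfl <;>
        simp_all
    rw [Pi.zero_apply]
    convert zero_smul ℂ (zPow γ n t x)
    push_cast
    linear_combination (-(1 / 2 : ℂ) * (n + 1) * ((ε : ℤ) : ℂ) * ((δ : ℤ) : ℂ)) * hI +
      (1 / 2 : ℂ) * (n + 1) * h1

theorem smoothLinear_pdSign (ε : ℤˣ) : SmoothLinear (pdSign ε : (E m → T) → (E m → T)) := by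
  intro P hP
  have h1 := smoothLinear_pd 1 P hP
  have h2 := smoothLinear_pd 2 P hP
  refine ⟨(h1.1.add (h2.1.const_smul _)).const_smul _, fun Q hQ => ?_, fun c => ?_⟩
  · ext x
    rw [pdSign, h1.2.1 Q hQ, h2.2.1 Q hQ]
    simp only [pdSign, Pi.add_apply]
    module
  · ext x
    rw [pdSign, h1.2.2, h2.2.2]
    simp only [pdSign, Pi.smul_apply]
    module

/-- For n = 0 nothing is differentiated and the sign is invisible, whence the disjunction. -/
theorem pdSign_iterate_zPow (hm : 2 ≤ m) {ε δ : ℤˣ} {t : T} (ht : t ∈ thetaEig γ 1 δ) (n : ℕ) :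
    (pdSign ε)^[n] (zPow γ n t) =
      if n = 0 ∨ ε = δ then (fun _ => (n.factorial : ℂ) • t : E m → T) else 0 := by
  have hz : ∀ l, (pdSign ε)^[l] (0 : E m → T) = 0 := by
    intro l
    have := (((smoothLinear_pdSign ε).iterate l) (0 : E m → T) contDiff_const).2.2 0
    rwa [zero_smul, zero_smul] at this
  induction n with
  | zero => simp [zPow_zero]
  | succ n ih =>
    rw [Function.iterate_succ_apply, pdSign_zPow_succ hm ht]
    by_cases h : ε = δ
    · rw [if_pos h, ((smoothLinear_pdSign ε).iterate n _
        (homogPoly_contDiff (zPow_mem_homogPoly (evenInv_top 2) n (Submodule.mem_top (x := t))))).2.2,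
        ih, if_pos (Or.inr h), if_pos (Or.inr h)]
      ext x
      rw [Pi.smul_apply, smul_smul, Nat.factorial_succ]
      push_cast
      rfl
    · rw [if_neg h, hz, if_neg (by simp [h])]

theorem smoothLinear_appellOp (ε : ℤˣ) (κ : ℕ → ℕ) (d : ℕ) :
    SmoothLinear (appellOp ε κ d : (E m → T) → (E m → T)) := by
  induction d with
  | zero => exact (smoothLinear_pdSign ε).iterate _
  | succ d ih => exact ih.comp ((smoothLinear_pd _).iterate _)

variable [FiniteDimensional ℂ T]

theorem pd_iterate_mulX {r : ℕ} (h3 : 3 ≤ r) (hr : r ≤ m) {R : Submodule ℂ T} {i : ℕ}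
    {Q : E m → T} (hQ : Q ∈ monoVar γ (r - 1) R i) (j l : ℕ) :
    (pd r)^[l] (mulX γ r j l Q) = (((j + l).factorial : ℂ) / j.factorial) • Q := by
  have hj : (j.factorial : ℂ) ≠ 0 := by exact_mod_cast j.factorial_ne_zero
  have hsm : ∀ l, ContDiff ℝ (↑(⊤ : ℕ∞)) (mulX γ r j l Q) := by
    intro l
    exact homogPoly_contDiff (homogPoly_mulX (evenInv_top r) (homogPoly_mono le_top _ hQ.1.1) j l)
  induction l with
  | zero =>
    rw [mulX_zero_right, Nat.add_zero, div_self hj, one_smul]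
    rfl
  | succ l ih =>
    rw [Function.iterate_succ_apply, pd_mulX_succ (monoVar_differentiable hQ) h3 hr
      (hQ.2 r (by omega)), ← Complex.coe_smul, ((smoothLinear_pd r).iterate l _ (hsm l)).2.2, ih,
      smul_smul, ← Nat.add_assoc, Nat.factorial_succ]
    congr 1
    push_cast
    field_simp

theorem pd_iterate_mulX_of_lt {r : ℕ} (h3 : 3 ≤ r) (hr : r ≤ m) {R : Submodule ℂ T} {i : ℕ}
    {Q : E m → T} (hQ : Q ∈ monoVar γ (r - 1) R i) (j : ℕ) {l n : ℕ} (hn : l < n) :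
    (pd r)^[n] (mulX γ r j l Q) = 0 := by
  obtain ⟨p, rfl⟩ : ∃ p, n = p + 1 + l := ⟨n - l - 1, by omega⟩
  rw [Function.iterate_add_apply, pd_iterate_mulX h3 hr hQ, Function.iterate_succ_apply,
    pd_smul (monoVar_differentiable hQ), hQ.2 r (by omega), smul_zero]
  have := (((smoothLinear_pd r).iterate p) (0 : E m → T) contDiff_const).2.2 0
  rwa [zero_smul, zero_smul] at this

/-- Operator and polynomial carry separate sequences, since uniqueness compares one index with its
permuted image; agreement of the top two entries is enough to peel off one variable. -/
theorem appellOp_gtFun_succ (hm : 2 ≤ m) (ε : ℤˣ) (κ : ℕ → ℕ) {κ' : ℕ → ℕ} (hκ' : Monotone κ')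
    {d : ℕ} (hd : d + 3 ≤ m) (h1 : κ (d + 3) = κ' (d + 3)) (h2 : κ (d + 2) = κ' (d + 2)) (t : T) :
    appellOp ε κ (d + 1) (gtFun γ κ' (d + 1) t) =
      (((κ' (d + 3)).factorial : ℂ) / (κ' (d + 2)).factorial) •
        appellOp ε κ d (gtFun γ κ' d t) := by
  have hg := gtFun_mem (γ := γ) hm hκ' (show d + 2 ≤ m by omega) t
  rw [appellOp, gtFun_succ, h1, h2, pd_iterate_mulX (by omega) hd hg,
    (smoothLinear_appellOp ε κ d _ (homogPoly_contDiff hg.1.1)).2.2,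
    Nat.add_sub_cancel' (hκ' (by omega))]

/-- The operator differentiates in the top variable more often than the exponent l of the embedding
factor allows. -/
theorem appellOp_gtFun_of_lt (hm : 2 ≤ m) (ε : ℤˣ) (κ : ℕ → ℕ) {κ' : ℕ → ℕ} (hκ' : Monotone κ')
    {d : ℕ} (hd : d + 3 ≤ m) (h1 : κ (d + 3) = κ' (d + 3)) (h2 : κ (d + 2) < κ' (d + 2)) (t : T) :
    appellOp ε κ (d + 1) (gtFun γ κ' (d + 1) t) = 0 := by
  have hg := gtFun_mem (γ := γ) hm hκ' (show d + 2 ≤ m by omega) t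
  have h3 : κ' (d + 2) ≤ κ' (d + 3) := hκ' (by omega)
  rw [appellOp, gtFun_succ, h1, pd_iterate_mulX_of_lt (by omega) hd hg _ (by omega)]
  have := (smoothLinear_appellOp ε κ d (0 : E m → T) contDiff_const).2.2 0
  rwa [zero_smul, zero_smul] at this

/-- The quotients of factorials from the successive variables telescope. -/
theorem appellOp_gtFun (hm : 2 ≤ m) {ε δ : ℤˣ} {κ : ℕ → ℕ} (hκ : Monotone κ) {d : ℕ}
    (hd : d + 2 ≤ m) {t : T} (ht : t ∈ thetaEig γ 1 δ) :
    appellOp ε κ d (gtFun γ κ d t) =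
      if κ 2 = 0 ∨ ε = δ then (fun _ => ((κ (d + 2)).factorial : ℂ) • t : E m → T) else 0 := by
  induction d with
  | zero => exact pdSign_iterate_zPow hm ht _
  | succ d ih =>
    rw [appellOp_gtFun_succ hm ε κ hκ hd rfl rfl, ih (by omega)]
    split_ifs
    · ext x
      rw [Pi.smul_apply, smul_smul, div_mul_cancel₀]
      exact_mod_cast (Nat.factorial_ne_zero _)
    · rw [smul_zero]

end Basis


/-! ### Uniqueness of the Appell-normalized basis -/

section Uniqueness

variable {m k : ℕ} {T : Type*} [NormedAddCommGroup T] [NormedSpace ℂ T]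
  {γ : Cl m →ₐ[ℝ] Module.End ℂ T} {S : Submodule ℂ T}

theorem mem_thetaEig_of_mem_spinorPiece {ν : Signs m} {t : T} (ht : t ∈ spinorPiece γ S ν)
    (j : Fin (half m - 1)) : t ∈ thetaEig γ (half m - 1 - j) (ν j) := by
  rw [← piece_two, mem_piece] at ht
  exact ht.2 j (by have := j.2; omega)

theorem mem_thetaEig_lastSign (hm : 3 ≤ m) {ν : Signs m} {t : T} (ht : t ∈ spinorPiece γ S ν) :
    t ∈ thetaEig γ 1 (lastSign ν) := by
  have h : 0 < half m - 1 := by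
    have : half m = (m + 1) / 2 := rfl
    omega
  have h1 := mem_thetaEig_of_mem_spinorPiece ht ⟨half m - 1 - 1, by omega⟩
  rw [lastSign, dif_pos h]
  convert h1 using 2
  change 1 = half m - 1 - (half m - 1 - 1)
  omega

theorem eq_of_smul_eq {ν ν' : Signs m} {t t' : T} (ht : t ∈ spinorPiece γ S ν)
    (ht' : t' ∈ spinorPiece γ S ν') (h0 : t ≠ 0) {c : ℂ} (h : c • t' = t) : ν = ν' := by
  by_contra hne
  obtain ⟨j, hj⟩ := Function.ne_iff.1 hne
  have h1 := mem_thetaEig_of_mem_spinorPiece ht j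
  have h2 := Submodule.smul_mem _ c (mem_thetaEig_of_mem_spinorPiece ht' j)
  rw [h] at h2
  exact h0 (Submodule.disjoint_def.1 (disjoint_thetaEig hj) _ h1 h2)

variable [FiniteDimensional ℂ T]

theorem contDiff_gtFun (hm : 2 ≤ m) (μ : J m k) {d : ℕ} (hd : d + 2 ≤ m) (t : T) :
    ContDiff ℝ (↑(⊤ : ℕ∞)) (gtFun γ μ.entry d t) :=
  homogPoly_contDiff (gtFun_mem hm (entry_mono μ) hd t).1.1

theorem isAppell_fSpinor (hm : 3 ≤ m) {v : Signs m → T} (hv : ∀ ν, v ν ∈ spinorPiece γ S ν) :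
    IsAppell (k := k) v (fSpinor γ v) := by
  intro ν μ
  have h := appellOp_gtFun (ε := lastSign ν) (by omega) (entry_mono μ) (d := m - 2) (by omega)
    (mem_thetaEig_lastSign hm (hv ν))
  rw [if_pos (Or.inr rfl), entry_of_le μ (by omega) (by omega)] at h
  exact h

/-- A permutation of the index set that is compatible with the Appell operators preserves the
sequences of integers. -/
theorem entry_perm_eq (hm : 3 ≤ m) {v : Signs m → T} (σ : Equiv.Perm (Signs m × J m k))
    (hσ : ∀ a, appellOp (lastSign a.1) a.2.entry (m - 2) (fSpinor γ v (σ a)) ≠ 0)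
    (a : Signs m × J m k) : (σ a).2 = a.2 := by
  have : Fintype (J m k) := Fintype.ofFinite _
  have key : ∀ n ≤ m - 2, ∀ a : Signs m × J m k,
      (∀ i, m - 2 - n + 2 ≤ i → (σ a).2.entry i = a.2.entry i) ∧
        appellOp (lastSign a.1) a.2.entry (m - 2 - n)
          (gtFun γ (σ a).2.entry (m - 2 - n) (v (σ a).1)) ≠ 0 := by
    intro n
    induction n with
    | zero =>
      intro _ a
      refine ⟨fun i hi => ?_, hσ a⟩
      rw [entry_of_le _ (by omega) (by omega), entry_of_le _ (by omega) (by omega)]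
    | succ n ih =>
      intro hn
      obtain ⟨d, hd⟩ : ∃ d, m - 2 - n = d + 1 := ⟨m - 2 - n - 1, by omega⟩
      have hd' : m - 2 - (n + 1) = d := by omega
      have ih := ih (by omega)
      rw [hd] at ih
      rw [hd']
      have h1 : ∀ a, a.2.entry (d + 3) = (σ a).2.entry (d + 3) :=
        fun a => ((ih a).1 _ (by omega)).symm
      -- A larger permuted entry would make the Appell operator vanish, by too many derivatives.
      have hle : ∀ a, (σ a).2.entry (d + 2) ≤ a.2.entry (d + 2) := by
        intro a
        by_contra! hlt
        exact (ih a).2 (appellOp_gtFun_of_lt (by omega) _ _ (entry_mono _) (by omega) (h1 a) hlt _)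
      -- The entries have the same sum over all indices before and after the permutation, so the
      -- inequalities are equalities.
      have heq : ∀ a, (σ a).2.entry (d + 2) = a.2.entry (d + 2) := by
        have := (Finset.sum_eq_sum_iff_of_le (s := Finset.univ) fun a _ => hle a).1
          (Equiv.sum_comp σ fun a => a.2.entry (d + 2))
        exact fun a => this a (Finset.mem_univ a)
      intro a
      refine ⟨fun i hi => ?_, fun h0 => (ih a).2 ?_⟩
      · rcases hi.eq_or_lt with rfl | hi
        · exact heq a
        · exact (ih a).1 i (by omega)
      · rw [appellOp_gtFun_succ (by omega) _ _ (entry_mono _) (by omega) (h1 a) (heq a).symm, h0,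
          smul_zero]
  refine J_ext fun i hi => (key (m - 2) le_rfl a).1 i (by omega)

/-- The family is a rescaled permutation of the explicit one. The Appell operators force the
permutation to preserve the integer sequences, and comparison of the resulting constants with v^ν
fixes signs and scalars. -/
theorem eq_of_isAppell (hm : 3 ≤ m) {v : Signs m → T} (hv : ∀ ν, v ν ∈ spinorPiece γ S ν)
    (hv0 : ∀ ν, v ν ≠ 0) {g : Signs m × J m k → E m → T} (hg : LinearIndependent ℂ g)
    (hgf : ∀ a, ∃ b : Signs m × J m k, ∃ c : ℂ, g a = c • fSpinor γ v b) (hA : IsAppell v g) :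
    g = fSpinor γ v := by
  choose σ c hσ using hgf
  have hk : (k.factorial : ℂ) ≠ 0 := by exact_mod_cast k.factorial_ne_zero
  -- Two members proportional to the same polynomial would be linearly dependent.
  have hinj : Function.Injective σ := by
    intro a b hab
    by_contra hne
    have hcb : c b ≠ 0 := fun h => hg.ne_zero b (by rw [hσ, h, zero_smul])
    have h2 : c b • g a + (-c a) • g b = 0 := by
      rw [hσ a, hσ b, hab, smul_smul, smul_smul, ← add_smul]
      convert zero_smul ℂ _
      ring
    exact hcb ((LinearIndepOn.pair_iff g hne).1 (hg.linearIndepOn _) _ _ h2).1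
  let τ : Equiv.Perm (Signs m × J m k) :=
    Equiv.ofBijective σ (Finite.injective_iff_bijective.1 hinj)
  have hop : ∀ a, c a • appellOp (lastSign a.1) a.2.entry (m - 2) (fSpinor γ v (σ a)) =
      fun _ => (k.factorial : ℂ) • v a.1 := by
    intro a
    rw [← hA a.1 a.2, hσ (a.1, a.2)]
    exact ((smoothLinear_appellOp _ _ _ _
      (contDiff_gtFun (by omega) (σ a).2 (by omega) _)).2.2 (c a)).symm
  have hval : ∀ a : Signs m × J m k, (fun _ => (k.factorial : ℂ) • v a.1 : E m → T) ≠ 0 := fun a h =>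
    smul_ne_zero hk (hv0 a.1) (congrFun h 0)
  have hμ : ∀ a, (σ a).2 = a.2 := by
    refine entry_perm_eq (γ := γ) (v := v) hm τ fun a h => hval a ?_
    rw [← hop a]
    exact (congrArg (c a • ·) h).trans (smul_zero _)
  funext a
  have h1 := hop a
  have h2 := appellOp_gtFun (ε := lastSign a.1) (by omega) (entry_mono (σ a).2) (d := m - 2)
    (by omega) (mem_thetaEig_lastSign hm (hv (σ a).1))
  rw [← hμ a] at h1
  change c a • appellOp (lastSign a.1) (σ a).2.entry (m - 2) (gtFun γ (σ a).2.entry (m - 2) _) = _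
    at h1
  rw [h2] at h1
  split_ifs at h1
  · have h3 := congrFun h1 0
    rw [Pi.smul_apply, entry_of_le _ (by omega) (by omega), smul_comm] at h3
    have h4 : c a • v (σ a).1 = v a.1 := smul_right_injective T hk h3
    -- Vectors from pieces with different signs lie in different θ-eigenspaces and cannot be
    -- proportional.
    have h5 : σ a = a :=
      Prod.ext (eq_of_smul_eq (hv a.1) (hv (σ a).1) (hv0 a.1) h4).symm (hμ a)
    rw [h5] at h4
    have h6 : c a = 1 := by
      have : (c a - 1) • v a.1 = 0 := by rw [sub_smul, h4, one_smul, sub_self]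
      exact sub_eq_zero.1 ((smul_eq_zero.1 this).resolve_right (hv0 a.1))
    rw [hσ a, h5, h6, one_smul]
  · rw [smul_zero] at h1
    exact absurd h1.symm (hval a)

end Uniqueness

end SpinorMonogenic

end

/-! ### The main theorem -/

open SpinorMonogenic in
theorem theorem5 {m : ℕ} (hm : 3 ≤ m)
    {T : Type*} [NormedAddCommGroup T] [NormedSpace ℂ T] [FiniteDimensional ℂ T]
    (γ : Cl m →ₐ[ℝ] Module.End ℂ T)
    (S : Subrepresentation (spinRep γ)) (hS : S.toRepresentation.IsIrreducible)
    (v : Signs m → T) (hv : ∀ ν, v ν ∈ spinorPiece γ S.toSubmodule ν) (hv0 : ∀ ν, v ν ≠ 0)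
    (k : ℕ) :
    ∃ f : Signs m × J m k → monogenic γ S.toSubmodule k,
      (∀ a, (f a : E m → T) = fSpinor γ v a) ∧
      IsGelfandTsetlinBasis (monogenicRep γ S k)
        (fun d => subSpin m (d + 2)) (m - 2) f ∧
      (∀ B : monogenic γ S.toSubmodule k → monogenic γ S.toSubmodule k → ℂ,
        IsInvariantInner (monogenicRep γ S k) B →
          ∀ a a', a ≠ a' → B (f a) (f a') = 0) ∧
      (∀ b : S.toSubmodule → S.toSubmodule → ℂ, IsInvariantInner S.toRepresentation b →
        IsInvariantInner (monogenicRep γ S k) (l2Inner b) ∧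
        IsInvariantInner (monogenicRep γ S k) (fischerInner b)) ∧
      IsAppell v (fun a => (f a : E m → T)) ∧
      (∀ g : Signs m × J m k → monogenic γ S.toSubmodule k,
        IsGelfandTsetlinBasis (monogenicRep γ S k)
          (fun d => subSpin m (d + 2)) (m - 2) g →
        IsAppell v (fun a => (g a : E m → T)) → g = f) := by
  have hE := evenIrr_of_isIrreducible S hS
  let f : Signs m × J m k → monogenic γ S.toSubmodule k := fun a => ⟨fSpinor γ v a,
    gtSpace_le (by omega) hE (Nat.zero_le _) a (by
      rw [gtSpace_zero (by omega) hE hv hv0]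
      exact Submodule.mem_span_singleton_self _)⟩
  have hsys := branchingSystem hm S hS hv hv0 (f := f) fun _ => rfl
  -- One invariant inner product suffices to deduce linear independence from orthogonality.
  obtain ⟨B₀, hB₀⟩ := exists_isInvariantInner S k
  have htop : ∀ a : Signs m × J m k, (gtSpace γ S.toSubmodule (min (m - 2) (m - 2)) a).comap
      (monogenic γ S.toSubmodule k).subtype = ⊤ := by
    intro a
    rw [min_self, gtSpace_top (by omega), Submodule.comap_subtype_self]
  have hbasis := hsys.isGelfandTsetlinBasis htop hB₀
  refine ⟨f, fun _ => rfl, hbasis, fun B hB a a' haa' => hsys.orthogonal hB haa',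
    fun b hb => ⟨isInvariantInner_l2Inner S k hb, isInvariantInner_fischerInner S k hb⟩,
    isAppell_fSpinor hm hv, fun g hg hA => ?_⟩
  have h := eq_of_isAppell hm hv hv0 (g := fun a => (g a : E m → T))
    (hg.1.map' (monogenic γ S.toSubmodule k).subtype (Submodule.ker_subtype _))
    (fun a => by
      obtain ⟨_, ⟨b, rfl⟩, c, hc⟩ := hg.2.2.exists_smul_eq hbasis.2.2 (Set.mem_range_self a)
      exact ⟨b, c, congrArg Subtype.val hc⟩) hA
  exact funext fun a => Subtype.ext (congrFun h a)
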